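/- For $\delta\in(-1,1)$ let $f_\delta:[0,\infty)\to\mathbb R$ be the profile of the radial solution $u^\delta_{\rm rad}=f_\delta(r)e^{i\theta}$ of the anisotropic Ginzburg--Landau equation $\Delta u+\delta\,\partial_\eta^2\bar u=(|u|^2-1)u$ in $\mathbb R^2$, $\partial_\eta=\partial_x+i\partial_y$; that is, $(1+\delta)\left(f_\delta''+\frac1r f_\delta'-\frac1{r^2}f_\delta\right)=(f_\delta^2-1)f_\delta$ and $f_\delta>0$ on $(0,\infty)$, $f_\delta(0)=0$ (attained continuously), $\lim_{r\to\infty}f_\delta=1$. Write $u\cdot v=\mathrm{Re}(u\bar v)$ and $$\mathfrak Q^\delta_{\rm rad}[v]=\int_{\mathbb R^2}|\nabla v|^2+\delta\,\mathrm{Re}\big((\partial_\eta\bar v)^2\big)-(1-f_\delta^2)|v|^2+2f_\delta^2(e^{i\theta}\cdot v)^2$$ for $v\in H=\{v\in H^1_{loc}(\mathbb R^2;\mathbb C):\int|\nabla v|^2+r^{-2}|v|^2+(e^{i\theta}\cdot v)^2<\infty\}$. Let $$H_0=\Big\{\varphi\in H^1_{loc}(0,\infty;\mathbb C):\int_0^\infty\big(|\varphi'|^2+\tfrac{|\varphi|^2}{r^2}+(\mathrm{Re}\,\varphi)^2\big)r\,dr<\infty\Big\},$$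 $$H_1=\Big\{(\varphi,\psi)\in H^1_{loc}(0,\infty;\mathbb C)^2:\int_0^\infty\big(|\varphi'|^2+|\psi'|^2+\tfrac{|\varphi|^2+|\psi|^2}{r^2}+|\varphi+\bar\psi|^2\big)r\,dr<\infty\Big\},$$ and define on $H_0$, respectively on $H_1$ for $n\ge1$, $$Q_0^\delta[\varphi]=\int_0^\infty\Big[|\varphi'|^2+\tfrac{|\varphi|^2}{r^2}+\delta\,\mathrm{Re}\big((\bar\varphi'+\tfrac1r\bar\varphi)^2\big)+(1+\delta)\big\{2f_0^2(\mathrm{Re}\,\varphi)^2-(1-f_0^2)|\varphi|^2\big\}\Big]r\,dr,$$ $$Q_n^\delta[\varphi,\psi]=\int_0^\infty\Big[|\varphi'|^2+|\psi'|^2+\tfrac{(1+n)^2}{r^2}|\varphi|^2+\tfrac{(1-n)^2}{r^2}|\psi|^2+2\delta\,\mathrm{Re}\big((\bar\varphi'+\tfrac{1+n}r\bar\varphi)(\bar\psi'+\tfrac{1-n}r\bar\psi)\big)+(1+\delta)\big\{f_0^2|\varphi+\bar\psi|^2-(1-f_0^2)(|\varphi|^2+|\psi|^2)\big\}\Big]r\,dr.$$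 Then: 1. for every integer $n\ge2$ and $\delta\in[-1/\sqrt5,0]$, $Q_n^\delta[\varphi,\psi]>0$ for all $(\varphi,\psi)\in H_1\setminus\{(0,0)\}$; 2. for every $\delta\in(-1,0]$, $Q_0^\delta[\varphi]>0$ for all $\varphi\in H_0\setminus\{0\}$; 3. for every $\delta\in(-1,0]$, $Q_1^\delta\ge0$ on $H_1$, and $Q_1^\delta[\varphi,\psi]=0$ only if $(\varphi,\psi)$ is in the real span of $\left(f_0'-\frac{f_0}r,\,f_0'+\frac{f_0}r\right)$ and $\left(i(f_0'-\frac{f_0}r),\,-i(f_0'+\frac{f_0}r)\right)$; 4. for every $\delta\in[-1/\sqrt5,0]$ the radial solution is nondegenerately stable: $\mathfrak Q^\delta_{\rm rad}[v]>0$ for all $v\in H$ outside the real span of $\partial_xu^\delta_{\rm rad},\partial_yu^\delta_{\rm rad}$; 5. consequently the stability threshold $\delta_1=\sup\big(\{-1\}\cup\{\delta\in(-1,0):\mathfrak Q^\delta_{\rm rad}[v]<0\text{ for some }v\in H\}\big)$ satisfies $\delta_1\le-1/\sqrt5$. -/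

import Mathlib

open scoped ContDiff ComplexConjugate

noncomputable section

namespace AnisoGL

open MeasureTheory Set Filter Topology

/-! ### The radial solution -/

/-- `f` is the profile of the radial solution `f(r) e^{iθ}` of the anisotropic Ginzburg-Landau
equation: `(1+δ) (f'' + f'/r - f/r²) = (f² - 1) f` on `(0,∞)`, `f > 0` on `(0,∞)`, `f(0) = 0`
(attained continuously) and `f → 1` at infinity. For `δ = 0` this is the classical
Ginzburg-Landau vortex profile of degree one. -/
structure IsRadialProfile (δ : ℝ) (f : ℝ → ℝ) : Prop where
  contDiffOn : ContDiffOn ℝ 2 f (Ioi 0)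
  ode : ∀ r : ℝ, 0 < r →
    (1 + δ) * (deriv (deriv f) r + 1 / r * deriv f r - 1 / r ^ 2 * f r)
      = ((f r) ^ 2 - 1) * f r
  pos : ∀ r : ℝ, 0 < r → 0 < f r
  map_zero : f 0 = 0
  tendsto_zero : Tendsto f (𝓝[>] 0) (𝓝 0)
  tendsto_one : Tendsto f atTop (𝓝 1)

/-- `e^{iθ}` at the point `z = r e^{iθ}` of the plane (identified with `ℂ`). -/
def eiTheta (z : ℂ) : ℂ := z / (‖z‖ : ℂ)

/-- The radial map `u(r e^{iθ}) = f(r) e^{iθ}`. -/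
def uRad (f : ℝ → ℝ) (z : ℂ) : ℂ := (f ‖z‖ : ℂ) * eiTheta z

/-- The inner product `u · v = Re (u v̄)` of complex numbers. -/
def dot (u v : ℂ) : ℝ := (u * conj v).re

/-! ### The energy space and the second variation in the plane -/

/-- `g` is the weak derivative of `v` in the direction `e` on the plane `ℂ = ℝ²`. -/
def HasWeakDirDeriv (e : ℂ) (v g : ℂ → ℂ) : Prop :=
  LocallyIntegrable v ∧ LocallyIntegrable g ∧
    ∀ χ : ℂ → ℝ, ContDiff ℝ ∞ χ → HasCompactSupport χ →
      ∫ z, ((fderiv ℝ χ z e : ℝ) : ℂ) * v z = - ∫ z, (χ z : ℂ) * g z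

/-- `v` belongs to the energy space, with weak derivatives `vx = ∂ₓ v` and `vy = ∂_y v`:
`v ∈ H¹_loc(ℝ²)` and `∫ (|∇v|² + |v|²/r² + (e^{iθ} · v)²) < ∞`. -/
structure MemEnergySpace (v vx vy : ℂ → ℂ) : Prop where
  weak_x : HasWeakDirDeriv 1 v vx
  weak_y : HasWeakDirDeriv Complex.I v vy
  sq_loc : LocallyIntegrable (fun z => ‖v z‖ ^ 2)
  energy : Integrable (fun z =>
    (‖vx z‖ ^ 2 + ‖vy z‖ ^ 2) + ‖v z‖ ^ 2 / ‖z‖ ^ 2 + (dot (eiTheta z) (v z)) ^ 2)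

/-- The second variation of the anisotropic energy around `f(r) e^{iθ}`,
`∫ |∇v|² + δ Re((∂_η v̄)²) - (1-f²)|v|² + 2 f² (e^{iθ}·v)²`, with `∂_η = ∂ₓ + i ∂_y`,
evaluated at `v` with `vx = ∂ₓ v`, `vy = ∂_y v`. -/
def QRad (δ : ℝ) (f : ℝ → ℝ) (v vx vy : ℂ → ℂ) : ℝ :=
  ∫ z, ((‖vx z‖ ^ 2 + ‖vy z‖ ^ 2)
    + δ * ((conj (vx z) + Complex.I * conj (vy z)) ^ 2).re
    - (1 - (f ‖z‖) ^ 2) * ‖v z‖ ^ 2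
    + 2 * (f ‖z‖) ^ 2 * (dot (eiTheta z) (v z)) ^ 2)

/-- `v` lies (as a class of functions modulo a.e. equality) in the real span of
`∂ₓ u` and `∂_y u`, where `u = f(r) e^{iθ}`. -/
def MemTranslationModes (f : ℝ → ℝ) (v : ℂ → ℂ) : Prop :=
  ∃ a b : ℝ, v =ᵐ[volume] fun z =>
    (a : ℂ) * fderiv ℝ (uRad f) z 1 + (b : ℂ) * fderiv ℝ (uRad f) z Complex.I

/-- Nondegenerate stability of `f(r) e^{iθ}`: the second variation is positive at every element of
the energy space outside the span of `∂ₓ u`, `∂_y u`. -/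
def NondegenerateStable (δ : ℝ) (f : ℝ → ℝ) : Prop :=
  ∀ v vx vy : ℂ → ℂ, MemEnergySpace v vx vy → ¬ MemTranslationModes f v →
    0 < QRad δ f v vx vy

/-- Linear instability of `f(r) e^{iθ}`: the second variation is negative at some element of the
energy space. -/
def LinearlyUnstable (δ : ℝ) (f : ℝ → ℝ) : Prop :=
  ∃ v vx vy : ℂ → ℂ, MemEnergySpace v vx vy ∧ QRad δ f v vx vy < 0

/-- The stability threshold `δ₁` of the family of radial solutions with profiles `f δ`: the
supremum of the `δ ∈ (-1,0)` at which the radial solution is unstable, read as `-1` if there are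
none. -/
def stabilityThreshold (f : ℝ → ℝ → ℝ) : ℝ :=
  sSup ({-1} ∪ {δ : ℝ | δ ∈ Ioo (-1 : ℝ) 0 ∧ LinearlyUnstable δ (f δ)})

/-! ### Fourier modes -/

/-- `g` is the weak derivative of `φ` on the half-line `(0,∞)`. -/
def HasWeakDerivHalfLine (φ g : ℝ → ℂ) : Prop :=
  LocallyIntegrableOn φ (Ioi 0) ∧ LocallyIntegrableOn g (Ioi 0) ∧
    ∀ χ : ℝ → ℝ, ContDiff ℝ ∞ χ → HasCompactSupport χ → tsupport χ ⊆ Ioi 0 →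
      ∫ r in Ioi (0 : ℝ), ((deriv χ r : ℝ) : ℂ) * φ r
        = - ∫ r in Ioi (0 : ℝ), (χ r : ℂ) * g r

/-- `φ ∈ H¹_loc(0,∞)` with weak derivative `dφ`. -/
structure MemH1Loc (φ dφ : ℝ → ℂ) : Prop where
  weak : HasWeakDerivHalfLine φ dφ
  sq_loc : LocallyIntegrableOn (fun r => ‖φ r‖ ^ 2) (Ioi 0)
  deriv_sq_loc : LocallyIntegrableOn (fun r => ‖dφ r‖ ^ 2) (Ioi 0)

/-- The space of radial coefficients of the mode `φ(r) e^{iθ}`; `dφ = φ'`. -/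
structure MemH0 (φ dφ : ℝ → ℂ) : Prop where
  h1 : MemH1Loc φ dφ
  energy : IntegrableOn (fun r : ℝ =>
    (‖dφ r‖ ^ 2 + ‖φ r‖ ^ 2 / r ^ 2 + (φ r).re ^ 2) * r) (Ioi 0)

/-- The space of pairs of radial coefficients of the modes
`e^{iθ} (φ(r) e^{inθ} + ψ(r) e^{-inθ})`, `n ≥ 1`; `dφ = φ'` and `dψ = ψ'`. -/
structure MemH1 (φ dφ ψ dψ : ℝ → ℂ) : Prop where
  h1_fst : MemH1Loc φ dφ
  h1_snd : MemH1Loc ψ dψ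
  energy : IntegrableOn (fun r : ℝ =>
    (‖dφ r‖ ^ 2 + ‖dψ r‖ ^ 2 + (‖φ r‖ ^ 2 + ‖ψ r‖ ^ 2) / r ^ 2
      + ‖φ r + conj (ψ r)‖ ^ 2) * r) (Ioi 0)

/-- The quadratic form `Q_0^δ[φ]`; `f₀` is the profile for `δ = 0` and `dφ = φ'`. -/
def Q0 (δ : ℝ) (f₀ : ℝ → ℝ) (φ dφ : ℝ → ℂ) : ℝ :=
  ∫ r in Ioi (0 : ℝ),
    (‖dφ r‖ ^ 2 + 1 / r ^ 2 * ‖φ r‖ ^ 2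
      + δ * ((conj (dφ r) + ((1 / r : ℝ) : ℂ) * conj (φ r)) ^ 2).re
      + (1 + δ) * (2 * (f₀ r) ^ 2 * (φ r).re ^ 2 - (1 - (f₀ r) ^ 2) * ‖φ r‖ ^ 2)) * r

/-- The quadratic form `Q_n^δ[φ,ψ]`, `n ≥ 1`; `f₀` is the profile for `δ = 0`, `dφ = φ'` and
`dψ = ψ'`. -/
def Qn (n : ℕ) (δ : ℝ) (f₀ : ℝ → ℝ) (φ dφ ψ dψ : ℝ → ℂ) : ℝ :=
  ∫ r in Ioi (0 : ℝ),
    (‖dφ r‖ ^ 2 + ‖dψ r‖ ^ 2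
      + (1 + (n : ℝ)) ^ 2 / r ^ 2 * ‖φ r‖ ^ 2 + (1 - (n : ℝ)) ^ 2 / r ^ 2 * ‖ψ r‖ ^ 2
      + 2 * δ * ((conj (dφ r) + (((1 + (n : ℝ)) / r : ℝ) : ℂ) * conj (φ r))
          * (conj (dψ r) + (((1 - (n : ℝ)) / r : ℝ) : ℂ) * conj (ψ r))).re
      + (1 + δ) * ((f₀ r) ^ 2 * ‖φ r + conj (ψ r)‖ ^ 2
          - (1 - (f₀ r) ^ 2) * (‖φ r‖ ^ 2 + ‖ψ r‖ ^ 2))) * r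

/-- `(φ, ψ)` lies (modulo a.e. equality on `(0,∞)`) in the real span of
`(f₀' - f₀/r, f₀' + f₀/r)` and `(i(f₀' - f₀/r), -i(f₀' + f₀/r))`, the coefficients of the
translational modes. -/
def MemTranslationPairs (f₀ : ℝ → ℝ) (φ ψ : ℝ → ℂ) : Prop :=
  ∃ a b : ℝ, ∀ᵐ r ∂(volume.restrict (Ioi (0 : ℝ))),
    φ r = ((a : ℂ) + b * Complex.I) * ((deriv f₀ r - f₀ r / r : ℝ) : ℂ) ∧
    ψ r = ((a : ℂ) - b * Complex.I) * ((deriv f₀ r + f₀ r / r : ℝ) : ℂ)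

end AnisoGL

end

open MeasureTheory Set AnisoGL

section

open Filter Topology

/-! ### The vortex profile -/

/-! For every δ in (-1,0], the density of a pair of modes, multiplied by r, is an exact derivative
plus a sum of nonnegative terms. This is `pairDensity_mul_eq`, combined with the Riccati equations
of the translational modes. The value -1/√5 enters only through -1 < -1/√5.

Put Φ = f' - f/r and Ψ = f' + f/r, the radial coefficients of the translational modes, and A = φ' +
(1+n)φ/r, B = ψ' + (1-n)ψ/r. Since 2 Re(AB) = |A|² + |B|² - |A - B̄|², and since the cross terms of
r|A|² and r|B|² are the exact derivatives of (1+n)|φ|² and (1-n)|ψ|², the anisotropic form equals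
1+δ times the isotropic form plus the integral of -δ|A - B̄|² r, up to boundary terms.

In the isotropic form one substitutes the ground state: with p = Φ'/Φ, |φ'|² = |φ' - pφ|² + p(|φ|²)'
- p²|φ|², and likewise for ψ with q = Ψ'/Ψ. The Riccati equations of rp and rq absorb the potential
into an exact derivative. What is left is κf²(2 Re(φψ) - (Ψ/Φ)|φ|² - (Φ/Ψ)|ψ|²), a square divided by
-ΦΨ (`coupling_eq`), and the centrifugal excess ((1+n)² - 4)|φ|²/r² + (1-n)²|ψ|²/r². Both are
nonnegative because Φ < 0 < Ψ (`fst_neg`, `snd_pos`) and n ≥ 1. Mode zero is treated in the same way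
with f'/f in place of p and q.

The boundary terms vanish because rp and rq are bounded, by `force_le` and `exists_decay`, and |φ|²
tends to 0 at both ends. Equality forces φ = cΦ and ψ = c̄Ψ when n = 1, and φ = ψ = 0 when n > 1; in
mode zero it forces a multiple of f, which does not decay.

In the plane, Parseval on circles is applied to v and to ∂ₓv ∓ i∂_y v. The two real parts in the
second variation couple the modes n and -n, and `hasSum_pairForm` writes the second variation as a
sum of pair forms. The strength κ makes one argument serve twice: κ = 1 for the forms built on f₀, κ
= 1/(1+δ) for the second variation at f_δ. -/

/-- Positive profiles of degree one for the Ginzburg-Landau equation with potential of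
strength `κ`. -/
structure VortexProfile (κ : ℝ) (f : ℝ → ℝ) : Prop where
  kpos : 0 < κ
  contDiffOn : ContDiffOn ℝ 2 f (Ioi 0)
  ode : ∀ r : ℝ, 0 < r → deriv (deriv f) r + deriv f r / r - f r / r ^ 2
      = - (κ * (1 - f r ^ 2) * f r)
  pos : ∀ r : ℝ, 0 < r → 0 < f r
  map_zero : f 0 = 0
  tendsto_zero : Tendsto f (𝓝[>] 0) (𝓝 0)
  tendsto_one : Tendsto f atTop (𝓝 1)

theorem AnisoGL.IsRadialProfile.vortexProfile {δ : ℝ} {f : ℝ → ℝ} (h : IsRadialProfile δ f)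
    (hδ : -1 < δ) : VortexProfile (1 / (1 + δ)) f where
  kpos := by have : 0 < 1 + δ := by linarith
             positivity
  contDiffOn := h.contDiffOn
  ode r hr := by
    have h1 := h.ode r hr
    have h2 : 0 < 1 + δ := by linarith
    field_simp at h1 ⊢
    linarith
  pos := h.pos
  map_zero := h.map_zero
  tendsto_zero := h.tendsto_zero
  tendsto_one := h.tendsto_one

/-- Were the second derivative positive, the point would be a local minimum as well, so the function
would be locally constant and the second derivative zero. -/
theorem deriv_deriv_nonpos_of_isLocalMax {f : ℝ → ℝ} {x : ℝ} (h : IsLocalMax f x)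
    (hc : ContinuousAt f x) : deriv (deriv f) x ≤ 0 := by
  by_contra! hpos
  have hmin := isLocalMin_of_deriv_deriv_pos hpos h.deriv_eq_zero hc
  have heq : f =ᶠ[𝓝 x] fun _ => f x := by
    filter_upwards [h, hmin] with y hy1 hy2 using le_antisymm hy1 hy2
  have h2 : deriv f =ᶠ[𝓝 x] fun _ => 0 := by
    filter_upwards [heq.deriv] with y hy
    simpa using hy
  have := h2.deriv_eq
  simp at this
  linarith

theorem le_of_hasDerivAt_nonneg {g g' : ℝ → ℝ} {a b : ℝ} (hab : a ≤ b)
    (hd : ∀ x ∈ Icc a b, HasDerivAt g (g' x) x) (hn : ∀ x ∈ Icc a b, 0 ≤ g' x) : g a ≤ g b := by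
  refine monotoneOn_of_deriv_nonneg (convex_Icc a b)
    (fun x hx => (hd x hx).continuousAt.continuousWithinAt)
    (fun x hx => (hd x (interior_subset hx)).differentiableAt.differentiableWithinAt)
    (fun x hx => ?_) (left_mem_Icc.2 hab) (right_mem_Icc.2 hab) hab
  rw [(hd x (interior_subset hx)).deriv]
  exact hn x (interior_subset hx)

namespace VortexProfile

variable {κ : ℝ} {f : ℝ → ℝ} (h : VortexProfile κ f)
include h

theorem hasDerivAt {r : ℝ} (hr : 0 < r) : HasDerivAt f (deriv f r) r :=
  ((h.contDiffOn.differentiableOn (by norm_num)).differentiableAt (Ioi_mem_nhds hr)).hasDerivAt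

theorem contDiffOn_deriv : ContDiffOn ℝ 1 (deriv f) (Ioi 0) :=
  ((contDiffOn_succ_iff_deriv_of_isOpen (n := 1) isOpen_Ioi).1 h.contDiffOn).2.2

theorem hasDerivAt_deriv {r : ℝ} (hr : 0 < r) :
    HasDerivAt (deriv f) (deriv (deriv f) r) r :=
  ((h.contDiffOn_deriv.differentiableOn (by norm_num)).differentiableAt
    (Ioi_mem_nhds hr)).hasDerivAt

theorem continuousOn_Ici : ContinuousOn f (Ici 0) := by
  intro x hx
  rcases eq_or_lt_of_le (show (0:ℝ) ≤ x from hx) with rfl | hx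
  · have : ContinuousWithinAt f (Ioi 0) 0 := by
      unfold ContinuousWithinAt
      rw [h.map_zero]
      exact h.tendsto_zero
    exact continuousWithinAt_Ioi_iff_Ici.1 this
  · exact (h.hasDerivAt hx).continuousAt.continuousWithinAt

/-- At a critical point the equation reads f'' = f/r² + κ(f² - 1)f, which is positive as soon as f ≥
1. -/
theorem lt_one_of_isLocalMax {r : ℝ} (hr : 0 < r) (hm : IsLocalMax f r) : f r < 1 := by
  by_contra! h1
  have h2 := deriv_deriv_nonpos_of_isLocalMax hm (h.hasDerivAt hr).continuousAt
  have h3 := h.ode r hr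
  rw [hm.deriv_eq_zero] at h3
  have h4 := h.pos r hr
  have h5 : 0 < f r / r ^ 2 := by positivity
  have h6 : 0 ≤ κ * (f r ^ 2 - 1) * f r := by
    have := h.kpos
    have : 0 ≤ f r ^ 2 - 1 := by nlinarith
    positivity
  simp only [zero_div] at h3
  nlinarith

/-- Since f starts at 0 and tends to 1, a value at least 1 would produce an interior local maximum
of height at least 1. -/
theorem lt_one {r : ℝ} (hr : 0 < r) : f r < 1 := by
  by_contra! h1
  by_cases hle : ∀ x, 0 < x → f x ≤ f r
  · have hm : IsLocalMax f r := by
      filter_upwards [Ioi_mem_nhds hr] with x hx using hle x hx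
    exact absurd (h.lt_one_of_isLocalMax hr hm) (not_lt.2 h1)
  push Not at hle
  obtain ⟨x, hx, hfx⟩ := hle
  have h1x : 1 < f x := lt_of_le_of_lt h1 hfx
  obtain ⟨R, hR'⟩ := eventually_atTop.1 ((h.tendsto_one.eventually (gt_mem_nhds h1x)).and
    (eventually_gt_atTop x))
  have hR : ∀ y, R ≤ y → f y < f x := fun y hy => (hR' y hy).1
  have hxR : x < R := (hR' R le_rfl).2
  obtain ⟨m, hm, hmax⟩ := isCompact_Icc.exists_isMaxOn (s := Icc 0 R) ⟨x, hx.le, hxR.le⟩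
    (h.continuousOn_Ici.mono Icc_subset_Ici_self)
  have hxm : f x ≤ f m := hmax ⟨hx.le, hxR.le⟩
  have hm0 : 0 < m := by
    rcases eq_or_lt_of_le hm.1 with h0 | h0
    · rw [← h0, h.map_zero] at hxm; linarith
    · exact h0
  have hloc : IsLocalMax f m := by
    filter_upwards [Ioi_mem_nhds hm0] with y hy
    rcases le_total y R with hyR | hyR
    · exact hmax ⟨le_of_lt hy, hyR⟩
    · exact (hR y hyR).le.trans hxm
  linarith [h.lt_one_of_isLocalMax hm0 hloc]

theorem sq_lt_one {r : ℝ} (hr : 0 < r) : f r ^ 2 < 1 := by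
  have := h.lt_one hr; have := h.pos r hr; nlinarith

theorem force_pos {r : ℝ} (hr : 0 < r) : 0 < κ * (1 - f r ^ 2) * f r := by
  have := h.sq_lt_one hr; have := h.pos r hr; have := h.kpos
  have : 0 < 1 - f r ^ 2 := by linarith
  positivity

/-- A drop from a to b produces a local maximum m followed by a lower local minimum l > m. The
equation gives κ(1 - f(m)²) ≥ 1/m² and κ(1 - f(l)²) ≤ 1/l², hence f(l) ≥ f(m), a contradiction. -/
theorem le_of_le {a b : ℝ} (ha : 0 < a) (hab : a ≤ b) : f a ≤ f b := by
  by_contra! hlt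
  have hb : 0 < b := ha.trans_le hab
  obtain ⟨m, hm, hmax⟩ := isCompact_Icc.exists_isMaxOn (s := Icc 0 b) ⟨a, ha.le, hab⟩
    (h.continuousOn_Ici.mono Icc_subset_Ici_self)
  have ham : f a ≤ f m := hmax ⟨ha.le, hab⟩
  have hm0 : 0 < m := by
    rcases eq_or_lt_of_le hm.1 with h0 | h0
    · rw [← h0, h.map_zero] at ham; linarith [h.pos a ha]
    · exact h0
  have hmb : m < b := by
    rcases eq_or_lt_of_le hm.2 with h0 | h0
    · rw [h0] at ham; linarith
    · exact h0
  have hloc : IsLocalMax f m := by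
    filter_upwards [Ioo_mem_nhds hm0 hmb] with y hy using hmax ⟨hy.1.le, hy.2.le⟩
  -- R is taken where f exceeds f b, so that the minimum over [m, R] is not attained at R.
  obtain ⟨R, hR, hbR⟩ := ((h.tendsto_one.eventually (lt_mem_nhds (h.lt_one hb))).and
    (eventually_gt_atTop b)).exists
  obtain ⟨l, hl, hmin⟩ := isCompact_Icc.exists_isMinOn (s := Icc m R) ⟨b, hmb.le, hbR.le⟩
    (h.continuousOn_Ici.mono (Icc_subset_Ici_self.trans (Ici_subset_Ici.2 hm0.le)))
  have hlb : f l ≤ f b := hmin ⟨hmb.le, hbR.le⟩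
  have hml : m < l := by
    rcases eq_or_lt_of_le hl.1 with h0 | h0
    · rw [← h0] at hlb; linarith
    · exact h0
  have hlR : l < R := by
    rcases eq_or_lt_of_le hl.2 with h0 | h0
    · rw [h0] at hlb; linarith
    · exact h0
  have hloc' : IsLocalMin f l := by
    filter_upwards [Ioo_mem_nhds hml hlR] with y hy using hmin ⟨hy.1.le, hy.2.le⟩
  have hl0 := hm0.trans hml
  have e1 := deriv_deriv_nonpos_of_isLocalMax hloc (h.hasDerivAt hm0).continuousAt
  have e2 := deriv_deriv_nonpos_of_isLocalMax hloc'.neg (h.hasDerivAt hl0).neg.continuousAt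
  have e3 : deriv (deriv (-f)) l = - deriv (deriv f) l := by
    have : deriv (-f) = -deriv f := by ext x; simp [deriv.neg]
    rw [this]; simp [deriv.neg]
  have e2' : - deriv (deriv f) l ≤ 0 := by rw [← e3]; exact e2
  have o1 := h.ode m hm0
  have o2 := h.ode l hl0
  rw [hloc.deriv_eq_zero] at o1
  rw [hloc'.deriv_eq_zero] at o2
  have p1 := h.pos m hm0
  have p2 := h.pos l hl0
  have q1 : 1 / m ^ 2 ≤ κ * (1 - f m ^ 2) := by
    have : f m * (1 / m ^ 2) ≤ f m * (κ * (1 - f m ^ 2)) := by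
      simp only [zero_div] at o1
      have : f m * (1 / m ^ 2) = f m / m ^ 2 := by ring
      linarith
    exact le_of_mul_le_mul_left this p1
  have q2 : κ * (1 - f l ^ 2) ≤ 1 / l ^ 2 := by
    have : f l * (κ * (1 - f l ^ 2)) ≤ f l * (1 / l ^ 2) := by
      simp only [zero_div] at o2
      have : f l * (1 / l ^ 2) = f l / l ^ 2 := by ring
      linarith
    exact le_of_mul_le_mul_left this p2
  have q3 : 1 / l ^ 2 ≤ 1 / m ^ 2 := by gcongr
  have q4 : κ * (1 - f l ^ 2) ≤ κ * (1 - f m ^ 2) := q2.trans (q3.trans q1)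
  have q5 := le_of_mul_le_mul_left q4 h.kpos
  nlinarith

theorem deriv_nonneg {r : ℝ} (hr : 0 < r) : 0 ≤ deriv f r := by
  have hm : MonotoneOn f (Ioi 0) := fun a ha b _ hab => h.le_of_le ha hab
  have := hm.derivWithin_nonneg (x := r)
  rwa [derivWithin_of_mem_nhds (Ioi_mem_nhds hr)] at this

/-- The profile equation splits into first-order equations for the two coefficients of the
translational modes. They yield the signs, the decay and the logarithmic derivatives used later. -/
theorem hasDerivAt_fst {r : ℝ} (hr : 0 < r) :
    HasDerivAt (fun r => deriv f r - f r / r)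
      (-2 * (deriv f r - f r / r) / r - κ * (1 - f r ^ 2) * f r) r := by
  have h1 := (h.hasDerivAt_deriv hr).sub ((h.hasDerivAt hr).div (hasDerivAt_id r) hr.ne')
  refine h1.congr_deriv ?_
  have h2 := h.ode r hr
  rw [sub_eq_add_neg _ (κ * _ * _), ← h2]
  simp only [id]
  field_simp
  ring

theorem hasDerivAt_snd {r : ℝ} (hr : 0 < r) :
    HasDerivAt (fun r => deriv f r + f r / r) (- (κ * (1 - f r ^ 2) * f r)) r := by
  have h1 := (h.hasDerivAt_deriv hr).add ((h.hasDerivAt hr).div (hasDerivAt_id r) hr.ne')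
  refine h1.congr_deriv ?_
  rw [← h.ode r hr]
  simp only [id]
  field_simp
  ring

theorem snd_ge {r : ℝ} (hr : 0 < r) : f r / r ≤ deriv f r + f r / r := by
  linarith [h.deriv_nonneg hr]

theorem snd_pos {r : ℝ} (hr : 0 < r) : 0 < deriv f r + f r / r := by
  have := h.snd_ge hr; have := h.pos r hr; have : 0 < f r / r := by positivity
  linarith

theorem hasDerivAt_sq_mul_fst {r : ℝ} (hr : 0 < r) :
    HasDerivAt (fun r => - (r ^ 2 * (deriv f r - f r / r)))
      (r ^ 2 * (κ * (1 - f r ^ 2) * f r)) r := by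
  refine (((hasDerivAt_pow 2 r).mul (h.hasDerivAt_fst hr)).neg).congr_deriv ?_
  field_simp
  push_cast
  ring

/-- The function -r²Φ is strictly increasing, so Φ ≥ 0 at one point would give f' ≥ M/y² near the
origin with M > 0, and f would tend to -∞ there. -/
theorem fst_neg {r : ℝ} (hr : 0 < r) : deriv f r - f r / r < 0 := by
  by_contra! h0
  set g : ℝ → ℝ := fun r => - (r ^ 2 * (deriv f r - f r / r)) with hg
  have hgd : ∀ x, 0 < x → HasDerivAt g (x ^ 2 * (κ * (1 - f x ^ 2) * f x)) x :=
    fun x hx => h.hasDerivAt_sq_mul_fst hx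
  have hs : StrictMonoOn g (Ioi 0) := by
    refine strictMonoOn_of_deriv_pos (convex_Ioi 0)
      (fun x hx => (hgd x hx).continuousAt.continuousWithinAt) fun x hx => ?_
    rw [interior_Ioi] at hx
    rw [(hgd x hx).deriv]
    have := h.force_pos hx
    have hx' : 0 < x := hx
    positivity
  set a := r / 2 with ha
  have ha0 : 0 < a := by positivity
  have hga : g a < 0 := by
    have : g a < g r := hs ha0 hr (by linarith)
    have : g r ≤ 0 := by simp only [hg]; nlinarith [sq_nonneg r]
    linarith
  set M := - g a with hM
  have hMpos : 0 < M := by linarith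
  -- The lower bound on f' makes f + M/y nondecreasing on (0, a]; the term f x on the left is
  -- positive and dropped.
  have key : ∀ x, 0 < x → x ≤ a → M / x ≤ f a + M / a := by
    intro x hx hxa
    have := le_of_hasDerivAt_nonneg (g := fun y => f y + M / y)
      (g' := fun y => deriv f y + (- (M / y ^ 2))) hxa (fun y hy => ?_) fun y hy => ?_
    · linarith [h.pos x hx]
    · have hy0 : 0 < y := hx.trans_le hy.1
      have := ((hasDerivAt_const y M).div (hasDerivAt_id y) hy0.ne')
      exact (h.hasDerivAt hy0).add (this.congr_deriv (by simp only [id]; field_simp; ring))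
    · have hy0 : 0 < y := hx.trans_le hy.1
      have h1 : g y ≤ g a := hs.monotoneOn hy0 ha0 hy.2
      have h2 : M ≤ y ^ 2 * (deriv f y - f y / y) := by simp only [hg] at h1 hM; linarith
      have h3 : M / y ^ 2 ≤ deriv f y - f y / y := by
        rw [div_le_iff₀ (by positivity)]; linarith
      have := h.pos y hy0
      have : 0 < f y / y := by positivity
      linarith
  have hC : 0 < f a + M / a := by have := h.pos a ha0; positivity
  have ht : Tendsto (fun x : ℝ => M / x) (𝓝[>] 0) atTop := by
    simpa [div_eq_mul_inv] using (tendsto_inv_nhdsGT_zero (𝕜 := ℝ)).const_mul_atTop hMpos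
  obtain ⟨x, hx1, hx2⟩ := ((ht.eventually_gt_atTop (f a + M / a)).and
    (Ioc_mem_nhdsGT ha0)).exists
  linarith [key x hx2.1 hx2.2]

theorem deriv_lt {r : ℝ} (hr : 0 < r) : deriv f r < f r / r := by linarith [h.fst_neg hr]

theorem snd_le {r : ℝ} (hr : 0 < r) : deriv f r + f r / r ≤ 2 / r := by
  have h1 := h.fst_neg hr
  have h2 : f r / r ≤ 1 / r := by gcongr; exact (h.lt_one hr).le
  have : 2 / r = 1 / r + 1 / r := by ring
  linarith

/-- Ψ decreases at the rate κ(1 - f²)f and stays between 0 and 2/r, so this rate integrates over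
[r/2, r] to at most 4/r. By monotonicity, for large r the rate is there at least κ(1 - f(r)²)/2. -/
theorem exists_decay : ∃ C, 0 ≤ C ∧ ∀ r, 0 < r → 1 - f r ^ 2 ≤ C / r ^ 2 := by
  obtain ⟨R, hR, hR0⟩ := ((h.tendsto_one.eventually (lt_mem_nhds (show (1/2:ℝ) < 1 by norm_num))).and
    (eventually_gt_atTop 0)).exists
  have hk := h.kpos
  have hRf : ∀ x, R ≤ x → 1 / 2 < f x := fun x hx => hR.trans_le (h.le_of_le hR0 hx)
  -- The term 4R² covers r ≤ 2R, where 1 - f² ≤ 1 suffices; 16/κ comes from κ(1 - f²)/2 · r/2 ≤ 4/r.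
  refine ⟨16 / κ + 4 * R ^ 2, by positivity, fun r hr => ?_⟩
  rw [le_div_iff₀ (by positivity)]
  have hsq := h.sq_lt_one hr
  rcases le_total r (2 * R) with hle | hle
  · have h1 : r ^ 2 ≤ 4 * R ^ 2 := by nlinarith
    have h2 : 0 < 16 / κ := by positivity
    have h3 : (1 - f r ^ 2) * r ^ 2 ≤ 1 * r ^ 2 := by
      gcongr; nlinarith [sq_nonneg (f r)]
    linarith
  · have hr2 : 0 < r / 2 := by positivity
    set m := κ * (1 - f r ^ 2) * (1 / 2) with hm
    have := le_of_hasDerivAt_nonneg (g := fun y => - (deriv f y + f y / y) - m * y)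
      (g' := fun y => κ * (1 - f y ^ 2) * f y - m) (a := r / 2) (b := r) (by linarith)
      (fun y hy => ?_) fun y hy => ?_
    · have a1 := h.snd_le hr2
      have a2 := h.snd_pos hr
      have a3 : m * r / 2 ≤ 2 / (r / 2) := by linarith
      have a4 : m * r / 2 * r ≤ 4 := by
        have : 2 / (r / 2) * r = 4 := by field_simp; norm_num
        nlinarith
      have a5 : (1 - f r ^ 2) * r ^ 2 ≤ 16 / κ := by
        rw [le_div_iff₀ hk]
        rw [hm] at a4
        nlinarith
      nlinarith [sq_nonneg R]
    · have hy0 : 0 < y := hr2.trans_le hy.1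
      have := ((h.hasDerivAt_snd hy0).neg).sub ((hasDerivAt_id y).const_mul m)
      exact this.congr_deriv (by ring)
    · have hy0 : 0 < y := hr2.trans_le hy.1
      have b1 := h.le_of_le hy0 hy.2
      have b2 := hRf y (by linarith [hy.1])
      have b3 : f y ^ 2 ≤ f r ^ 2 := by have := h.pos y hy0; gcongr
      have : m ≤ κ * (1 - f y ^ 2) * f y := by
        rw [hm]; gcongr <;> nlinarith
      linarith

/-- This bound keeps rΦ'/Φ between -2 and 2. The auxiliary function is r²/4 times the difference of
the two sides; it is nondecreasing because 0 ≤ rf' ≤ f, and its lower bound near the origin tends to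
0. -/
theorem force_le {r : ℝ} (hr : 0 < r) :
    r * (κ * (1 - f r ^ 2) * f r) ≤ 4 * - (deriv f r - f r / r) := by
  set g : ℝ → ℝ := fun r => - (r ^ 2 * (deriv f r - f r / r))
    - κ / 4 * (r ^ 3 * ((1 - f r ^ 2) * f r)) with hg
  have hgm : ∀ a b, 0 < a → a ≤ b → g a ≤ g b := by
    intro a b ha hab
    refine le_of_hasDerivAt_nonneg (g' := fun y => y ^ 2 * (κ * (1 - f y ^ 2) * f y)
      - κ / 4 * (3 * y ^ 2 * ((1 - f y ^ 2) * f y)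
        + y ^ 3 * ((- (2 * f y * deriv f y)) * f y + (1 - f y ^ 2) * deriv f y))) hab ?_ ?_
    · intro y hy
      have hy0 : 0 < y := ha.trans_le hy.1
      have hf := h.hasDerivAt hy0
      have e := (((hf.pow 2).const_sub 1).mul hf)
      have e2 := (((hasDerivAt_pow 3 y).mul e).const_mul (κ / 4))
      refine ((h.hasDerivAt_sq_mul_fst hy0).sub e2).congr_deriv ?_
      simp
    · intro y hy
      have hy0 : 0 < y := ha.trans_le hy.1
      have c1 := h.pos y hy0
      have c2 := h.deriv_nonneg hy0
      have c3 := h.deriv_lt hy0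
      have c4 : 0 ≤ f y - y * deriv f y := by
        rw [lt_div_iff₀ hy0] at c3; linarith
      have c5 := h.sq_lt_one hy0
      have hk := h.kpos
      have : 0 ≤ κ / 4 * y ^ 2 * ((1 - f y ^ 2) * (f y - y * deriv f y)
          + 2 * f y ^ 2 * (deriv f y * y)) := by
        have : 0 ≤ 1 - f y ^ 2 := by linarith
        positivity
      linarith
  have ht : Tendsto (fun x : ℝ => - (κ / 4 * x ^ 3)) (𝓝[>] 0) (𝓝 0) := by
    have : Continuous fun x : ℝ => - (κ / 4 * x ^ 3) := by fun_prop
    have := this.tendsto 0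
    simp only [ne_eq, OfNat.ofNat_ne_zero, not_false_eq_true, zero_pow, mul_zero, neg_zero] at this
    exact this.mono_left nhdsWithin_le_nhds
  have hg0 : 0 ≤ g r := by
    refine le_of_tendsto ht ?_
    filter_upwards [Ioc_mem_nhdsGT hr] with x hx
    refine le_trans ?_ (hgm x r hx.1 hx.2)
    have c1 := h.pos x hx.1
    have c2 := h.lt_one hx.1
    have c3 := h.fst_neg hx.1
    have hk := h.kpos
    have c4 : (1 - f x ^ 2) * f x ≤ 1 := by nlinarith [sq_nonneg (f x)]
    have hx0 := hx.1
    have c5 : κ / 4 * (x ^ 3 * ((1 - f x ^ 2) * f x)) ≤ κ / 4 * (x ^ 3 * 1) := by gcongr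
    have c6 : 0 ≤ - (x ^ 2 * (deriv f x - f x / x)) := by nlinarith [sq_nonneg x]
    simp only [hg]
    linarith
  have hr2 : 0 < r ^ 2 := by positivity
  have e1 : r ^ 2 * (r * (κ * (1 - f r ^ 2) * f r)) ≤ r ^ 2 * (4 * - (deriv f r - f r / r)) := by
    simp only [hg] at hg0
    linarith
  exact le_of_mul_le_mul_left e1 hr2

end VortexProfile

/-! ### Absolutely continuous representatives and decay -/

/-- `φ` is a locally absolutely continuous function on `(0,∞)` with derivative `g`. -/
structure IsPrimitive {E : Type*} [NormedAddCommGroup E] [NormedSpace ℝ E] (φ g : ℝ → E) :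
    Prop where
  locInt : LocallyIntegrableOn g (Ioi 0)
  sub_eq : ∀ a b, 0 < a → 0 < b → φ b - φ a = ∫ x in a..b, g x

theorem MeasureTheory.LocallyIntegrableOn.intervalIntegrable_of_pos {E : Type*}
    [NormedAddCommGroup E] {g : ℝ → E} (hg : LocallyIntegrableOn g (Ioi 0)) {a b : ℝ}
    (ha : 0 < a) (hb : 0 < b) : IntervalIntegrable g volume a b := by
  refine IntegrableOn.intervalIntegrable ?_
  refine hg.integrableOn_compact_subset ?_ isCompact_uIcc
  intro x hx
  exact (lt_min ha hb).trans_le hx.1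

theorem uIcc_subset_Ioi_zero {a b : ℝ} (ha : 0 < a) (hb : 0 < b) : uIcc a b ⊆ Ioi 0 :=
  fun _ hx => (lt_min ha hb).trans_le hx.1

namespace IsPrimitive

variable {E : Type*} [NormedAddCommGroup E] [NormedSpace ℝ E] {φ g : ℝ → E}

theorem clm {F : Type*} [NormedAddCommGroup F] [NormedSpace ℝ F]
    [CompleteSpace E] [CompleteSpace F] (h : IsPrimitive φ g) (L : E →L[ℝ] F) :
    IsPrimitive (fun x => L (φ x)) (fun x => L (g x)) where
  locInt := fun x hx => by
    obtain ⟨s, hs, hi⟩ := h.locInt x hx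
    exact ⟨s, hs, L.integrable_comp hi⟩
  sub_eq a b ha hb := by
    rw [← map_sub, h.sub_eq a b ha hb,
      L.intervalIntegral_comp_comm (h.locInt.intervalIntegrable_of_pos ha hb)]

theorem continuousOn (h : IsPrimitive φ g) : ContinuousOn φ (Ioi 0) := by
  intro x hx
  have hx0 : 0 < x := hx
  have h1 : ∀ y ∈ Ioi (0:ℝ), φ y = φ x + ∫ t in x..y, g t := fun y hy => by
    rw [← h.sub_eq x y hx hy]; abel
  have hc : ContinuousOn (fun y => ∫ t in (x / 2)..y, g t) (uIcc (x/2) (2 * x)) :=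
    intervalIntegral.continuousOn_primitive_interval'
      (h.locInt.intervalIntegrable_of_pos (by positivity) (by positivity)) left_mem_uIcc
  have hc2 : ContinuousAt (fun y => ∫ t in (x / 2)..y, g t) x :=
    hc.continuousAt (by rw [uIcc_of_le (by linarith)]; exact Icc_mem_nhds (by linarith) (by linarith))
  have : φ =ᶠ[𝓝 x] fun y => φ (x / 2) + ∫ t in (x / 2)..y, g t := by
    filter_upwards [Ioi_mem_nhds hx0] with y hy
    rw [← h.sub_eq (x/2) y (by positivity) hy]; abel
  exact ((continuousAt_const.add hc2).congr this.symm).continuousWithinAt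

/-- Lebesgue differentiation holds on each compact interval, and countably many of these exhaust the
half-line. -/
theorem ae_hasDerivAt [CompleteSpace E] (h : IsPrimitive φ g) :
    ∀ᵐ x, 0 < x → HasDerivAt φ (g x) x := by
  have h1 : ∀ n : ℕ, ∀ᵐ x, x ∈ uIcc ((1:ℝ) / (n + 1)) (n + 2) → HasDerivAt
      (fun y => ∫ t in ((1:ℝ) / (n + 1))..y, g t) (g x) x := fun n => by
    have hi : IntervalIntegrable g volume ((1:ℝ) / (n + 1)) (n + 2) :=
      h.locInt.intervalIntegrable_of_pos (by positivity) (by positivity)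
    filter_upwards [hi.ae_hasDerivAt_integral] with x hx hx2
    exact hx hx2 _ left_mem_uIcc
  filter_upwards [ae_all_iff.2 h1] with x hx hx0
  obtain ⟨n, hn1, hn2⟩ : ∃ n : ℕ, 1 / ((n:ℝ) + 1) < x ∧ x < n + 2 := by
    obtain ⟨k, hk⟩ := exists_nat_one_div_lt hx0
    obtain ⟨m, hm⟩ := exists_nat_gt x
    refine ⟨max k m, lt_of_le_of_lt ?_ hk, ?_⟩
    · gcongr; exact le_max_left _ _
    · have : (m : ℝ) ≤ (max k m : ℕ) := by exact_mod_cast le_max_right _ _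
      linarith
  have h2 := hx n ⟨(min_le_left _ _).trans hn1.le, hn2.le.trans (le_max_right _ _)⟩
  refine (h2.const_add (φ (1 / ((n:ℝ) + 1)))).congr_of_eventuallyEq ?_
  filter_upwards [Ioi_mem_nhds hx0] with y hy
  rw [← h.sub_eq _ y (by positivity) hy]; abel

theorem absolutelyContinuousOnInterval {φ g : ℝ → ℝ} (h : IsPrimitive φ g) {a b : ℝ}
    (ha : 0 < a) (hb : 0 < b) : AbsolutelyContinuousOnInterval φ a b := by
  have h1 := (h.locInt.intervalIntegrable_of_pos ha hb).absolutelyContinuousOnInterval_intervalIntegral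
    (c := a) left_mem_uIcc
  have h2 : AbsolutelyContinuousOnInterval (fun _ : ℝ => φ a) a b :=
    (LipschitzWith.const (φ a)).lipschitzOnWith.absolutelyContinuousOnInterval
  have h3 := h2.add h1
  refine (absolutelyContinuousOnInterval_iff φ a b).2 fun ε hε => ?_
  obtain ⟨δ, hδ, hh⟩ := (absolutelyContinuousOnInterval_iff _ a b).1 h3 ε hε
  refine ⟨δ, hδ, fun J hJ hlt => ?_⟩
  have h4 := hh J hJ hlt
  have key : ∀ y ∈ uIcc a b, φ a + ∫ v in a..y, g v = φ y := by
    intro y hy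
    rw [← h.sub_eq a y ha (uIcc_subset_Ioi_zero ha hb hy)]
    abel
  refine lt_of_eq_of_lt (Finset.sum_congr rfl fun i hi => ?_) h4
  simp only [Pi.add_apply]
  rw [key _ (hJ.1 i hi).1, key _ (hJ.1 i hi).2]

/-- Integration of the derivative of a product with a `C¹` weight. -/
theorem integral_weight_mul {φ g : ℝ → ℝ} (h : IsPrimitive φ g) {α α' : ℝ → ℝ}
    (hα : ∀ x, 0 < x → HasDerivAt α (α' x) x) (hα' : ContinuousOn α' (Ioi 0)) {a b : ℝ}
    (ha : 0 < a) (hb : 0 < b) :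
    ∫ x in a..b, (α' x * φ x + α x * g x) = α b * φ b - α a * φ a := by
  have hsub := uIcc_subset_Ioi_zero ha hb
  have h1 : IsPrimitive α α' := ⟨hα'.locallyIntegrableOn measurableSet_Ioi, fun c d hc hd => by
    rw [intervalIntegral.integral_eq_sub_of_hasDerivAt
      (fun x hx => hα x (uIcc_subset_Ioi_zero hc hd hx))
      ((hα'.mono (uIcc_subset_Ioi_zero hc hd)).intervalIntegrable)]⟩
  rw [← (h1.absolutelyContinuousOnInterval ha hb).integral_deriv_mul_eq_sub
    (h.absolutelyContinuousOnInterval ha hb)]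
  apply intervalIntegral.integral_congr_ae
  filter_upwards [h.ae_hasDerivAt] with x hx hx2
  have hx0 := hsub (uIoc_subset_uIcc hx2)
  rw [(hx hx0).deriv, (hα x hx0).deriv]

theorem mul {φ g ψ k : ℝ → ℝ} (h : IsPrimitive φ g) (h' : IsPrimitive ψ k) :
    IsPrimitive (fun x => φ x * ψ x) (fun x => g x * ψ x + φ x * k x) where
  locInt := by
    refine LocallyIntegrableOn.add ?_ ?_
    · exact h.locInt.mul_continuousOn h'.continuousOn isOpen_Ioi.isLocallyClosed
    · exact h'.locInt.continuousOn_mul h.continuousOn isOpen_Ioi.isLocallyClosed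
  sub_eq a b ha hb := by
    rw [← (h.absolutelyContinuousOnInterval ha hb).integral_deriv_mul_eq_sub
      (h'.absolutelyContinuousOnInterval ha hb)]
    apply intervalIntegral.integral_congr_ae
    filter_upwards [h.ae_hasDerivAt, h'.ae_hasDerivAt] with x hx hx' hx2
    have hx0 := uIcc_subset_Ioi_zero ha hb (uIoc_subset_uIcc hx2)
    rw [(hx hx0).deriv, (hx' hx0).deriv]

theorem add {ψ k : ℝ → E} (h : IsPrimitive φ g) (h' : IsPrimitive ψ k) :
    IsPrimitive (fun x => φ x + ψ x) (fun x => g x + k x) where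
  locInt := h.locInt.add h'.locInt
  sub_eq a b ha hb := by
    rw [intervalIntegral.integral_add (h.locInt.intervalIntegrable_of_pos ha hb)
      (h'.locInt.intervalIntegrable_of_pos ha hb), ← h.sub_eq a b ha hb, ← h'.sub_eq a b ha hb]
    abel

theorem norm_sq {φ g : ℝ → ℂ} (h : IsPrimitive φ g) :
    IsPrimitive (fun x => ‖φ x‖ ^ 2) (fun x => 2 * (conj (φ x) * g x).re) := by
  have h1 := h.clm Complex.reCLM
  have h2 := h.clm Complex.imCLM
  have h3 := (h1.mul h1).add (h2.mul h2)
  convert h3 using 2 with x x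
  · rw [Complex.sq_norm, Complex.normSq_apply]; rfl
  · simp; ring

theorem integral_complex_weight_mul {φ g : ℝ → ℂ} (h : IsPrimitive φ g) {α α' : ℝ → ℝ}
    (hα : ∀ x, 0 < x → HasDerivAt α (α' x) x) (hα' : ContinuousOn α' (Ioi 0)) {a b : ℝ}
    (ha : 0 < a) (hb : 0 < b) :
    ∫ x in a..b, ((α' x : ℂ) * φ x + (α x : ℂ) * g x) = α b * φ b - α a * φ a := by
  have hsub := uIcc_subset_Ioi_zero ha hb
  have hαc : ContinuousOn α (Ioi 0) := fun x hx => (hα x hx).continuousAt.continuousWithinAt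
  have hi : IntervalIntegrable (fun x => (α' x : ℂ) * φ x + (α x : ℂ) * g x) volume a b := by
    refine IntervalIntegrable.add ?_ ?_
    · refine ContinuousOn.intervalIntegrable ?_
      exact (Complex.continuous_ofReal.comp_continuousOn (hα'.mono hsub)).mul
        (h.continuousOn.mono hsub)
    · exact (h.locInt.intervalIntegrable_of_pos ha hb).continuousOn_mul
        (Complex.continuous_ofReal.comp_continuousOn (hαc.mono hsub))
  have e1 := (h.clm Complex.reCLM).integral_weight_mul hα hα' ha hb
  have e2 := (h.clm Complex.imCLM).integral_weight_mul hα hα' ha hb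
  apply Complex.ext
  · rw [← Complex.reCLM_apply, ← Complex.reCLM.intervalIntegral_comp_comm hi]
    simpa using e1
  · rw [← Complex.imCLM_apply, ← Complex.imCLM.intervalIntegral_comp_comm hi]
    simpa using e2

end IsPrimitive

/-! ### Weak derivatives on the half-line and absolutely continuous representatives -/

theorem exists_Icc_of_tsupport_subset_Ioi {χ : ℝ → ℝ} (hc : HasCompactSupport χ)
    (hs : tsupport χ ⊆ Ioi 0) : ∃ a b, 0 < a ∧ a ≤ b ∧ ∀ x, x ∉ Ioo a b → χ x = 0 := by
  have hcomp : IsCompact (tsupport χ) := hc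
  rcases (tsupport χ).eq_empty_or_nonempty with he | hne
  · exact ⟨1, 1, one_pos, le_rfl, fun x _ => image_eq_zero_of_notMem_tsupport (by simp [he])⟩
  obtain ⟨m, hm, hmin⟩ := hcomp.exists_isMinOn hne continuousOn_id
  obtain ⟨M, hM, hmax⟩ := hcomp.exists_isMaxOn hne continuousOn_id
  have hm0 : 0 < m := hs hm
  have hmM : m ≤ M := hmin hM
  refine ⟨m / 2, M + 1, by positivity, by linarith, fun x hx => ?_⟩
  refine image_eq_zero_of_notMem_tsupport fun hx' => hx ⟨?_, ?_⟩
  · have : m ≤ x := hmin hx'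
    linarith
  · have : x ≤ M := hmax hx'
    linarith

theorem setIntegral_Ioi_eq_intervalIntegral {E : Type*} [NormedAddCommGroup E] [NormedSpace ℝ E]
    {F : ℝ → E} {a b : ℝ} (ha : 0 < a) (hab : a ≤ b) (h : ∀ x, x ∉ Ioo a b → F x = 0) :
    ∫ x in Ioi (0:ℝ), F x = ∫ x in a..b, F x := by
  rw [intervalIntegral.integral_of_le hab]
  refine setIntegral_eq_of_subset_of_forall_sdiff_eq_zero measurableSet_Ioi
    (fun x hx => ha.trans hx.1) fun x hx => h x fun hx' => hx.2 ⟨hx'.1, hx'.2.le⟩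

theorem deriv_eq_zero_of_notMem_tsupport {χ : ℝ → ℝ} {x : ℝ} (h : x ∉ tsupport χ) :
    deriv χ x = 0 := by
  have := support_deriv_subset (𝕜 := ℝ) (f := χ)
  by_contra h0
  exact h (this h0)

theorem IsPrimitive.hasWeakDeriv {φ g : ℝ → ℂ} (h : IsPrimitive φ g) {χ : ℝ → ℝ}
    (hχ : ContDiff ℝ ∞ χ) (hc : HasCompactSupport χ) (hs : tsupport χ ⊆ Ioi 0) :
    ∫ r in Ioi (0 : ℝ), ((deriv χ r : ℝ) : ℂ) * φ r = - ∫ r in Ioi (0 : ℝ), (χ r : ℂ) * g r := by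
  obtain ⟨a, b, ha, hab, hz⟩ := exists_Icc_of_tsupport_subset_Ioi hc hs
  obtain ⟨a', b', ha', hab', hz'⟩ := exists_Icc_of_tsupport_subset_Ioi hc.deriv
    ((tsupport_deriv_subset (𝕜 := ℝ)).trans hs)
  set c := min a a' with hcdef
  set d := max b b' with hddef
  have hc0 : 0 < c := lt_min ha ha'
  have hcd : c ≤ d := (min_le_left _ _).trans (hab.trans (le_max_left _ _))
  have hd0 := hc0.trans_le hcd
  have z1 : ∀ x, x ∉ Ioo c d → χ x = 0 := fun x hx => hz x fun hx' =>
    hx ⟨(min_le_left _ _).trans_lt hx'.1, hx'.2.trans_le (le_max_left _ _)⟩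
  have z2 : ∀ x, x ∉ Ioo c d → deriv χ x = 0 := fun x hx => hz' x fun hx' =>
    hx ⟨(min_le_right _ _).trans_lt hx'.1, hx'.2.trans_le (le_max_right _ _)⟩
  have hdc : Continuous (deriv χ) := hχ.continuous_deriv (by norm_num)
  have hsub := uIcc_subset_Ioi_zero hc0 hd0
  rw [setIntegral_Ioi_eq_intervalIntegral hc0 hcd (fun x hx => by simp [z2 x hx]),
    setIntegral_Ioi_eq_intervalIntegral hc0 hcd (fun x hx => by simp [z1 x hx]),
    eq_neg_iff_add_eq_zero, ← intervalIntegral.integral_add]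
  · rw [h.integral_complex_weight_mul
      (fun x _ => (hχ.differentiable (by norm_num) x).hasDerivAt) hdc.continuousOn hc0 hd0,
      z1 c (by simp), z1 d (by simp)]
    simp
  · exact ((Complex.continuous_ofReal.comp hdc).continuousOn.mul
      (h.continuousOn.mono hsub)).intervalIntegrable
  · exact (h.locInt.intervalIntegrable_of_pos hc0 hd0).continuousOn_mul
      (Complex.continuous_ofReal.comp hχ.continuous).continuousOn

/-- A function on the half-line with vanishing weak derivative is constant. -/
theorem exists_ae_eq_const_of_weak_deriv_zero {w : ℝ → ℂ} (hw : LocallyIntegrableOn w (Ioi 0))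
    (h : ∀ χ : ℝ → ℝ, ContDiff ℝ ∞ χ → HasCompactSupport χ → tsupport χ ⊆ Ioi 0 →
      ∫ r in Ioi (0 : ℝ), ((deriv χ r : ℝ) : ℂ) * w r = 0) :
    ∃ c : ℂ, ∀ᵐ x, 0 < x → w x = c := by
  let B : ContDiffBump (2 : ℝ) := ⟨1/2, 1, by norm_num, by norm_num⟩
  set χ₀ : ℝ → ℝ := B.normed volume with hχ₀
  have i0 : ∫ x, χ₀ x = 1 := B.integral_normed
  have c0 : HasCompactSupport χ₀ := B.hasCompactSupport_normed
  have d0 : ContDiff ℝ ∞ χ₀ := B.contDiff_normed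
  have s0 : tsupport χ₀ ⊆ Ioi 0 := by
    rw [hχ₀, B.tsupport_normed_eq]
    intro x hx
    have := abs_le.1 (mem_closedBall_iff_norm.1 hx)
    have h1 : B.rOut = 1 := rfl
    rw [h1] at this
    have : 0 < x := by linarith
    exact this
  have hint : ∀ χ : ℝ → ℝ, Continuous χ → HasCompactSupport χ → tsupport χ ⊆ Ioi 0 →
      IntegrableOn (fun r => (χ r : ℂ) * w r) (Ioi 0) := by
    intro χ hχ hc hs
    have h1 : IntegrableOn w (tsupport χ) := hw.integrableOn_compact_subset hs hc
    have h2 : IntegrableOn (fun r => (χ r : ℂ) * w r) (tsupport χ) :=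
      h1.continuousOn_mul (Complex.continuous_ofReal.comp hχ).continuousOn hc
    refine h2.of_forall_sdiff_eq_zero measurableSet_Ioi fun x hx => ?_
    rw [image_eq_zero_of_notMem_tsupport hx.2]; simp
  -- The bump has integral one, so its pairing with w is the only candidate for the constant.
  set c : ℂ := ∫ r in Ioi (0:ℝ), (χ₀ r : ℂ) * w r with hcdef
  refine ⟨c, ?_⟩
  have hwc : LocallyIntegrableOn (fun x => w x - c) (Ioi 0) :=
    hw.sub ((locallyIntegrable_const c).locallyIntegrableOn _)
  have := isOpen_Ioi.ae_eq_zero_of_integral_contDiff_smul_eq_zero hwc fun g hg hgc hgs => ?_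
  · filter_upwards [this] with x hx hx0
    exact sub_eq_zero.1 (hx hx0)
  set m : ℝ := ∫ x, g x with hm
  -- Subtracting m times the bump makes the integral vanish, so the primitive of k is again a test
  -- function with compact support in the half-line.
  set k : ℝ → ℝ := fun x => g x - m * χ₀ x with hk
  have kd : ContDiff ℝ ∞ k := hg.sub (contDiff_const.mul d0)
  obtain ⟨a, b, ha, hab, hz⟩ := exists_Icc_of_tsupport_subset_Ioi hgc hgs
  obtain ⟨a', b', ha', hab', hz'⟩ := exists_Icc_of_tsupport_subset_Ioi c0 s0
  set p := min a a' with hp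
  set q := max b b' with hq
  have hp0 : 0 < p := lt_min ha ha'
  have hpq : p ≤ q := (min_le_left _ _).trans (hab.trans (le_max_left _ _))
  have kz : ∀ x, x ∉ Ioo p q → k x = 0 := fun x hx => by
    simp only [hk]
    rw [hz x fun hx' => hx ⟨(min_le_left _ _).trans_lt hx'.1, hx'.2.trans_le (le_max_left _ _)⟩,
      hz' x fun hx' => hx ⟨(min_le_right _ _).trans_lt hx'.1, hx'.2.trans_le (le_max_right _ _)⟩]
    simp
  have ki : ∫ x in p..q, k x = 0 := by
    have e1 : ∫ x, k x = 0 := by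
      simp only [hk]
      rw [integral_sub (hg.continuous.integrable_of_hasCompactSupport hgc)
        ((d0.continuous.integrable_of_hasCompactSupport c0).const_mul m), integral_const_mul, i0]
      simp [hm]
    rw [← e1, intervalIntegral.integral_of_le hpq]
    refine setIntegral_eq_integral_of_forall_compl_eq_zero fun x hx => kz x fun hx' =>
      hx ⟨hx'.1, hx'.2.le⟩
  set K : ℝ → ℝ := fun x => ∫ t in p..x, k t with hK
  have Kd : ∀ x, HasDerivAt K (k x) x := fun x =>
    intervalIntegral.integral_hasDerivAt_right (kd.continuous.intervalIntegrable _ _)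
      kd.continuous.stronglyMeasurable.stronglyMeasurableAtFilter kd.continuous.continuousAt
  have KD : deriv K = k := funext fun x => (Kd x).deriv
  have Kc : ContDiff ℝ ∞ K := by
    refine contDiff_infty_iff_deriv.2 ⟨fun x => (Kd x).differentiableAt, ?_⟩
    rw [KD]; exact kd
  have Kz : ∀ x, x ∉ Icc p q → K x = 0 := by
    intro x hx
    rcases lt_or_ge x p with hxp | hxp
    · have : ∀ t ∈ uIcc p x, k t = 0 := fun t ht => kz t fun ht' => by
        rw [uIcc_of_ge hxp.le] at ht
        linarith [ht.2, ht'.1]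
      rw [hK]
      simp only
      rw [intervalIntegral.integral_congr this]
      simp
    · have hxq : q < x := by
        by_contra! hh; exact hx ⟨hxp, hh⟩
      have : ∀ t ∈ uIcc q x, k t = 0 := fun t ht => kz t fun ht' => by
        rw [uIcc_of_le hxq.le] at ht
        linarith [ht.1, ht'.2]
      rw [hK]
      simp only
      rw [← intervalIntegral.integral_add_adjacent_intervals
        (kd.continuous.intervalIntegrable p q) (kd.continuous.intervalIntegrable q x), ki,
        intervalIntegral.integral_congr this]
      simp
  have Kcs : HasCompactSupport K := HasCompactSupport.intro isCompact_Icc Kz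
  have Ks : tsupport K ⊆ Ioi 0 := by
    refine (closure_minimal (fun x hx => ?_) isClosed_Icc).trans
      (fun x (hx : x ∈ Icc p q) => hp0.trans_le hx.1)
    by_contra h0; exact hx (Kz x h0)
  have e := h K Kc Kcs Ks
  rw [KD] at e
  have ig := hint g hg.continuous hgc hgs
  have i00 := hint χ₀ d0.continuous c0 s0
  have e2 : ∫ r in Ioi (0:ℝ), (k r : ℂ) * w r = (∫ r in Ioi (0:ℝ), (g r : ℂ) * w r) - m * c := by
    rw [hcdef, ← integral_const_mul, ← integral_sub ig (i00.const_mul _)]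
    congr 1; ext r; simp only [hk]; push_cast; ring
  have e3 : ∫ x, g x • (w x - c) = ∫ r in Ioi (0:ℝ), ((g r : ℂ) * w r - (g r : ℂ) * c) := by
    rw [← setIntegral_eq_integral_of_forall_compl_eq_zero (s := Ioi 0)]
    · congr 1; ext r; simp only [Complex.real_smul]; ring
    · intro x hx
      rw [image_eq_zero_of_notMem_tsupport fun hx' => hx (hgs hx')]; simp
  have e4 : ∫ r in Ioi (0:ℝ), (g r : ℂ) = m := by
    rw [setIntegral_eq_integral_of_forall_compl_eq_zero, hm, integral_complex_ofReal]
    intro x hx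
    rw [image_eq_zero_of_notMem_tsupport fun hx' => hx (hgs hx')]; simp
  rw [e3, integral_sub ig ?_, integral_mul_const, e4]
  · rw [e2] at e; exact e
  · have : Integrable (fun r => (g r : ℂ)) :=
      (hg.continuous.integrable_of_hasCompactSupport hgc).ofReal
    exact (this.mul_const c).integrableOn

/-- A function with a weak derivative on the half-line has a locally absolutely continuous
representative. -/
theorem AnisoGL.HasWeakDerivHalfLine.exists_isPrimitive {φ g : ℝ → ℂ}
    (h : HasWeakDerivHalfLine φ g) :
    ∃ φ' : ℝ → ℂ, IsPrimitive φ' g ∧ ∀ᵐ x, 0 < x → φ x = φ' x := by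
  obtain ⟨h1, h2, h3⟩ := h
  set G : ℝ → ℂ := fun x => ∫ t in (1:ℝ)..x, g t with hG
  have hGp : IsPrimitive G g := ⟨h2, fun a b ha hb => by
    simp only [hG]
    rw [intervalIntegral.integral_interval_sub_left
      (h2.intervalIntegrable_of_pos one_pos hb) (h2.intervalIntegrable_of_pos one_pos ha)]⟩
  have hGl : LocallyIntegrableOn G (Ioi 0) :=
    hGp.continuousOn.locallyIntegrableOn measurableSet_Ioi
  obtain ⟨c, hc⟩ := exists_ae_eq_const_of_weak_deriv_zero (h1.sub hGl) fun χ hχ hc hs => by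
    have hint : ∀ w : ℝ → ℂ, LocallyIntegrableOn w (Ioi 0) →
        IntegrableOn (fun r => ((deriv χ r : ℝ) : ℂ) * w r) (Ioi 0) := by
      intro w hw
      have a1 : IntegrableOn w (tsupport χ) := hw.integrableOn_compact_subset hs hc
      have a2 : IntegrableOn (fun r => ((deriv χ r : ℝ) : ℂ) * w r) (tsupport χ) :=
        a1.continuousOn_mul (Complex.continuous_ofReal.comp
          (hχ.continuous_deriv (by norm_num))).continuousOn hc
      refine a2.of_forall_sdiff_eq_zero measurableSet_Ioi fun x hx => ?_
      rw [deriv_eq_zero_of_notMem_tsupport hx.2]; simp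
    simp only [Pi.sub_apply, mul_sub]
    rw [integral_sub (hint _ h1) (hint _ hGl), h3 χ hχ hc hs, hGp.hasWeakDeriv hχ hc hs, sub_self]
  refine ⟨fun x => G x + c, ⟨h2, fun a b ha hb => ?_⟩, ?_⟩
  · rw [← hGp.sub_eq a b ha hb]; ring
  · filter_upwards [hc] with x hx hx0
    rw [← hx hx0]; simp

/-! ### Vanishing at both ends for radial functions of finite energy -/

namespace IsPrimitive

variable {φ g : ℝ → ℂ}

theorem integrableOn_conj_mul (h : IsPrimitive φ g)
    (hg : IntegrableOn (fun r => ‖g r‖ ^ 2 * r) (Ioi 0))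
    (hφ : IntegrableOn (fun r => ‖φ r‖ ^ 2 / r) (Ioi 0)) :
    IntegrableOn (fun x => 2 * (conj (φ x) * g x).re) (Ioi 0) := by
  refine (hg.add hφ).mono' h.norm_sq.locInt.aestronglyMeasurable ?_
  filter_upwards [ae_restrict_mem measurableSet_Ioi] with r hr
  have hr0 : 0 < r := hr
  have h1 : |(conj (φ r) * g r).re| ≤ ‖φ r‖ * ‖g r‖ := by
    refine (Complex.abs_re_le_norm _).trans ?_
    rw [norm_mul, RCLike.norm_conj]
  rw [Real.norm_eq_abs, abs_mul, abs_two]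
  have h2 : ‖g r‖ ^ 2 * r + ‖φ r‖ ^ 2 / r - 2 * (‖φ r‖ * ‖g r‖)
      = (‖g r‖ * r - ‖φ r‖) ^ 2 / r := by field_simp; ring
  have h3 : 0 ≤ (‖g r‖ * r - ‖φ r‖) ^ 2 / r := by positivity
  simp only [Pi.add_apply]
  linarith

/-- The derivative of |φ|² is integrable, so |φ|² has a limit; a positive limit would make 1/r
integrable at infinity. -/
theorem tendsto_norm_sq_atTop (h : IsPrimitive φ g)
    (hg : IntegrableOn (fun r => ‖g r‖ ^ 2 * r) (Ioi 0))
    (hφ : IntegrableOn (fun r => ‖φ r‖ ^ 2 / r) (Ioi 0)) :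
    Tendsto (fun r => ‖φ r‖ ^ 2) atTop (𝓝 0) := by
  have hi := h.integrableOn_conj_mul hg hφ
  have h1 := (intervalIntegral_tendsto_integral_Ioi 1 (hi.mono_set (Ioi_subset_Ioi zero_le_one))
    tendsto_id).const_add (‖φ 1‖ ^ 2)
  set l := ‖φ 1‖ ^ 2 + ∫ x in Ioi (1:ℝ), 2 * (conj (φ x) * g x).re
  have h2 : Tendsto (fun r => ‖φ r‖ ^ 2) atTop (𝓝 l) := by
    refine h1.congr' ?_
    filter_upwards [eventually_gt_atTop 0] with r hr
    have := h.norm_sq.sub_eq 1 r one_pos hr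
    simp only [id] at this ⊢
    linarith
  have hl : 0 ≤ l := ge_of_tendsto' h2 fun r => by positivity
  rcases eq_or_lt_of_le hl with h0 | h0
  · rwa [h0]
  exfalso
  obtain ⟨R, hR⟩ := eventually_atTop.1 ((h2.eventually (lt_mem_nhds (half_lt_self h0))).and
    (eventually_gt_atTop 0))
  have hR0 := (hR R le_rfl).2
  refine not_integrableOn_Ioi_inv (a := R) ?_
  have h3 := (hφ.mono_set (Ioi_subset_Ioi hR0.le)).const_mul (2 / l)
  refine h3.mono' (measurable_inv.aestronglyMeasurable) ?_
  filter_upwards [ae_restrict_mem measurableSet_Ioi] with r hr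
  have h4 := hR r (le_of_lt hr)
  have h5 := h4.2
  rw [Real.norm_of_nonneg (by positivity)]
  rw [show 2 / l * (‖φ r‖ ^ 2 / r) = (2 / l * ‖φ r‖ ^ 2) * r⁻¹ by ring]
  refine le_mul_of_one_le_left (by positivity) ?_
  rw [div_mul_eq_mul_div, le_div_iff₀ h0]
  linarith [h4.1]

/-- The same dichotomy at the origin, where 1/r is not integrable either. -/
theorem tendsto_norm_sq_zero (h : IsPrimitive φ g)
    (hg : IntegrableOn (fun r => ‖g r‖ ^ 2 * r) (Ioi 0))
    (hφ : IntegrableOn (fun r => ‖φ r‖ ^ 2 / r) (Ioi 0)) :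
    Tendsto (fun r => ‖φ r‖ ^ 2) (𝓝[>] 0) (𝓝 0) := by
  have hi := h.integrableOn_conj_mul hg hφ
  have hi1 : IntervalIntegrable (fun x => 2 * (conj (φ x) * g x).re) volume 0 1 :=
    (intervalIntegrable_iff_integrableOn_Ioc_of_le zero_le_one).2 (hi.mono_set Ioc_subset_Ioi_self)
  have hcont : ContinuousOn (fun x => ∫ t in (1:ℝ)..x, 2 * (conj (φ t) * g t).re) (uIcc 0 1) :=
    intervalIntegral.continuousOn_primitive_interval' hi1 right_mem_uIcc
  have hc0 : Tendsto (fun x => ∫ t in (1:ℝ)..x, 2 * (conj (φ t) * g t).re) (𝓝[>] 0)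
      (𝓝 (∫ t in (1:ℝ)..0, 2 * (conj (φ t) * g t).re)) := by
    have := hcont 0 left_mem_uIcc
    rw [uIcc_of_le zero_le_one] at this
    refine this.mono_left ?_
    rw [← nhdsWithin_Ioc_eq_nhdsGT (zero_lt_one' ℝ)]
    exact nhdsWithin_mono _ Ioc_subset_Icc_self
  have h1 := hc0.const_add (‖φ 1‖ ^ 2)
  set l := ‖φ 1‖ ^ 2 + ∫ t in (1:ℝ)..0, 2 * (conj (φ t) * g t).re
  have h2 : Tendsto (fun r => ‖φ r‖ ^ 2) (𝓝[>] 0) (𝓝 l) := by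
    refine h1.congr' ?_
    filter_upwards [self_mem_nhdsWithin] with r hr
    have := h.norm_sq.sub_eq 1 r one_pos hr
    linarith
  have hl : 0 ≤ l := ge_of_tendsto' h2 fun r => by positivity
  rcases eq_or_lt_of_le hl with h0 | h0
  · rwa [← h0] at h2
  exfalso
  obtain ⟨R, hR0, hR⟩ := mem_nhdsGT_iff_exists_Ioc_subset.1
    (h2.eventually (lt_mem_nhds (half_lt_self h0)))
  have hR0' : 0 < R := hR0
  have h3 := (hφ.mono_set (Ioc_subset_Ioi_self : Ioc 0 R ⊆ Ioi 0)).const_mul (2 / l)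
  have h4 : IntegrableOn (fun r : ℝ => r⁻¹) (Ioc 0 R) := by
    refine h3.mono' (measurable_inv.aestronglyMeasurable) ?_
    filter_upwards [ae_restrict_mem measurableSet_Ioc] with r hr
    have h4 : l / 2 < ‖φ r‖ ^ 2 := hR hr
    have h5 := hr.1
    rw [Real.norm_of_nonneg (by positivity)]
    rw [show 2 / l * (‖φ r‖ ^ 2 / r) = (2 / l * ‖φ r‖ ^ 2) * r⁻¹ by ring]
    refine le_mul_of_one_le_left (by positivity) ?_
    rw [div_mul_eq_mul_div, le_div_iff₀ h0]
    linarith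
  have h5 := (intervalIntegrable_iff_integrableOn_Ioc_of_le hR0'.le).2 h4
  rw [intervalIntegrable_inv_iff] at h5
  rcases h5 with h5 | h5
  · exact hR0'.ne h5
  · exact h5 left_mem_uIcc

end IsPrimitive

/-! ### Integrals with a boundary term -/

/-- Neither T' nor N is assumed integrable on the half-line. On an exhaustion by compact intervals
the integral of N is that of D minus a difference of boundary values, and monotonicity in the
interval bounds it by the full integral of D. -/
theorem IsPrimitive.integral_nonneg_of_eq_add {T T' D N : ℝ → ℝ} (hT : IsPrimitive T T')
    (h0 : Tendsto T (𝓝[>] 0) (𝓝 0)) (h1 : Tendsto T atTop (𝓝 0)) (hD : IntegrableOn D (Ioi 0))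
    (hN : ∀ r, 0 < r → 0 ≤ N r) (hDN : ∀ r, 0 < r → D r = T' r + N r) :
    0 ≤ ∫ r in Ioi 0, D r ∧ ((∫ r in Ioi 0, D r ≤ 0) → ∀ᵐ r, 0 < r → N r = 0) := by
  set S : ℕ → Set ℝ := fun k => Ioc (1 / ((k : ℝ) + 1)) (k + 1) with hS
  have hpos : ∀ k : ℕ, (0:ℝ) < 1 / ((k : ℝ) + 1) := fun k => by positivity
  have hSm : Monotone S := fun i j hij => by
    have : (i : ℝ) ≤ j := by exact_mod_cast hij
    exact Ioc_subset_Ioc (by gcongr) (by gcongr)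
  have hSU : ⋃ k, S k = Ioi 0 := by
    ext x
    simp only [hS, mem_iUnion, mem_Ioc, mem_Ioi]
    constructor
    · rintro ⟨k, hk, _⟩; exact (hpos k).trans hk
    · intro hx
      obtain ⟨k, hk⟩ := exists_nat_one_div_lt hx
      obtain ⟨m, hm⟩ := exists_nat_gt x
      refine ⟨max k m, lt_of_le_of_lt ?_ hk, ?_⟩
      · gcongr; exact le_max_left _ _
      · have : (m : ℝ) ≤ (max k m : ℕ) := by exact_mod_cast le_max_right _ _
        linarith
  have hDl : LocallyIntegrableOn D (Ioi 0) := hD.locallyIntegrableOn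
  have hNl : LocallyIntegrableOn N (Ioi 0) := fun x hx => by
    obtain ⟨s, hs, hi⟩ := (hDl.sub hT.locInt) x hx
    refine ⟨s ∩ Ioi 0, inter_mem hs self_mem_nhdsWithin, (hi.mono_set inter_subset_left).congr_fun_ae ?_⟩
    filter_upwards [ae_mono (Measure.restrict_mono inter_subset_right le_rfl)
      (ae_restrict_mem (measurableSet_Ioi (a := (0:ℝ))))] with r hr
    simp only [Pi.sub_apply]
    rw [hDN r hr]; ring
  have hlim : Tendsto (fun k : ℕ => (∫ r in S k, D r) - (T (k + 1) - T (1 / ((k : ℝ) + 1)))) atTop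
      (𝓝 (∫ r in Ioi 0, D r)) := by
    have l1 := tendsto_setIntegral_of_monotone (fun k => measurableSet_Ioc) hSm
      (by rw [hSU]; exact hD : IntegrableOn D (⋃ k, S k))
    rw [hSU] at l1
    have l2 : Tendsto (fun k : ℕ => T ((k:ℝ) + 1)) atTop (𝓝 0) :=
      h1.comp (tendsto_atTop_add_const_right _ _ tendsto_natCast_atTop_atTop)
    have l3 : Tendsto (fun k : ℕ => T (1 / ((k:ℝ) + 1))) atTop (𝓝 0) := by
      refine h0.comp (tendsto_nhdsWithin_iff.2 ⟨tendsto_one_div_add_atTop_nhds_zero_nat, ?_⟩)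
      exact Eventually.of_forall hpos
    have l4 := l1.sub (l2.sub l3)
    rwa [sub_zero, sub_zero] at l4
  have hNS : ∀ k : ℕ, IntegrableOn N (S k) := fun k => by
    have := hNl.intervalIntegrable_of_pos (hpos k) (show (0:ℝ) < k + 1 by positivity)
    exact this.1
  have hle : ∀ k : ℕ, 1 / ((k:ℝ) + 1) ≤ k + 1 := fun k => by
    rw [div_le_iff₀ (by positivity)]
    have : (0:ℝ) ≤ k := k.cast_nonneg
    nlinarith
  have heq : ∀ k : ℕ, (∫ r in S k, D r) - (T (k + 1) - T (1 / ((k : ℝ) + 1)))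
      = ∫ r in S k, N r := fun k => by
    have hk1 : (0:ℝ) < k + 1 := by positivity
    have hi := (hT.locInt.intervalIntegrable_of_pos (hpos k) hk1).1
    rw [hT.sub_eq _ _ (hpos k) hk1, intervalIntegral.integral_of_le (hle k), sub_eq_iff_eq_add,
      ← integral_add (hNS k) hi]
    refine setIntegral_congr_fun measurableSet_Ioc fun r hr => ?_
    rw [hDN r ((hpos k).trans hr.1)]; ring
  have hSsub : ∀ k, S k ⊆ Ioi 0 := fun k r hr => (hpos k).trans hr.1
  have hbound : ∀ k, ∫ r in S k, N r ≤ ∫ r in Ioi 0, D r := fun k => by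
    refine ge_of_tendsto hlim ?_
    filter_upwards [eventually_ge_atTop k] with j hj
    rw [heq j]
    refine setIntegral_mono_set (hNS j) ?_ (LE.le.eventuallyLE (hSm hj))
    filter_upwards [ae_restrict_mem measurableSet_Ioc] with r hr using hN r (hSsub j hr)
  have hnn : ∀ k, 0 ≤ ∫ r in S k, N r := fun k =>
    setIntegral_nonneg measurableSet_Ioc fun r hr => hN r (hSsub k hr)
  refine ⟨(hnn 0).trans (hbound 0), fun hle0 => ?_⟩
  have hz : ∀ k, ∀ᵐ r, r ∈ S k → N r = 0 := fun k => by
    have e : ∫ r in S k, N r = 0 := le_antisymm ((hbound k).trans hle0) (hnn k)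
    rw [setIntegral_eq_zero_iff_of_nonneg_ae ?_ (hNS k)] at e
    · exact (ae_restrict_iff' measurableSet_Ioc).1 e
    · filter_upwards [ae_restrict_mem measurableSet_Ioc] with r hr using hN r (hSsub k hr)
  filter_upwards [ae_all_iff.2 hz] with r hr hr0
  have : r ∈ ⋃ k, S k := by rw [hSU]; exact hr0
  obtain ⟨k, hk⟩ := mem_iUnion.1 this
  exact hr k hk

/-- Radial coefficients with finite weighted Dirichlet energy. -/
structure RadialEnergy (φ g : ℝ → ℂ) : Prop where
  prim : IsPrimitive φ g
  deriv_sq : IntegrableOn (fun r => ‖g r‖ ^ 2 * r) (Ioi 0)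
  sq_div : IntegrableOn (fun r => ‖φ r‖ ^ 2 / r) (Ioi 0)

namespace RadialEnergy

variable {φ g : ℝ → ℂ}

/-- Boundary terms with a bounded `C¹` weight vanish at both ends. -/
theorem weight (h : RadialEnergy φ g) {α α' : ℝ → ℝ} {C : ℝ} (hα : ContDiffOn ℝ 1 α (Ioi 0))
    (hα' : ∀ r, 0 < r → HasDerivAt α (α' r) r) (hC : ∀ r, 0 < r → |α r| ≤ C) :
    IsPrimitive (fun r => α r * ‖φ r‖ ^ 2)
      (fun r => α' r * ‖φ r‖ ^ 2 + α r * (2 * (conj (φ r) * g r).re)) ∧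
    Tendsto (fun r => α r * ‖φ r‖ ^ 2) (𝓝[>] 0) (𝓝 0) ∧
    Tendsto (fun r => α r * ‖φ r‖ ^ 2) atTop (𝓝 0) := by
  have hc : ContinuousOn α' (Ioi 0) := by
    refine (hα.continuousOn_deriv_of_isOpen isOpen_Ioi le_rfl).congr fun r hr => ?_
    exact (hα' r hr).deriv.symm
  have hb : ∀ r, 0 < r → ‖α r * ‖φ r‖ ^ 2‖ ≤ C * ‖φ r‖ ^ 2 := fun r hr => by
    rw [norm_mul, Real.norm_eq_abs, Real.norm_of_nonneg (sq_nonneg ‖φ r‖)]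
    gcongr
    exact hC r hr
  refine ⟨?_, ?_, ?_⟩
  · have h1 : IsPrimitive α α' := ⟨hc.locallyIntegrableOn measurableSet_Ioi, fun c d hc' hd => by
      rw [intervalIntegral.integral_eq_sub_of_hasDerivAt
        (fun x hx => hα' x (uIcc_subset_Ioi_zero hc' hd hx))
        ((hc.mono (uIcc_subset_Ioi_zero hc' hd)).intervalIntegrable)]⟩
    exact h1.mul h.prim.norm_sq
  · have := (h.prim.tendsto_norm_sq_zero h.deriv_sq h.sq_div).const_mul C
    rw [mul_zero] at this
    refine squeeze_zero_norm' ?_ this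
    filter_upwards [self_mem_nhdsWithin] with r hr using hb r hr
  · have := (h.prim.tendsto_norm_sq_atTop h.deriv_sq h.sq_div).const_mul C
    rw [mul_zero] at this
    refine squeeze_zero_norm' ?_ this
    filter_upwards [eventually_gt_atTop 0] with r hr using hb r hr

/-- A solution of `φ' = (w'/w) φ` is a multiple of `w`. -/
theorem _root_.IsPrimitive.eq_const_mul (h : IsPrimitive φ g) {w w' : ℝ → ℝ}
    (hw : ∀ r, 0 < r → HasDerivAt w (w' r) r) (hw' : ContinuousOn w' (Ioi 0))
    (hw0 : ∀ r, 0 < r → w r ≠ 0)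
    (he : ∀ᵐ r, 0 < r → g r = ((w' r / w r : ℝ) : ℂ) * φ r) {r : ℝ} (hr : 0 < r) :
    φ r = φ 1 / w 1 * w r := by
  have hwc : ContinuousOn w (Ioi 0) := fun x hx => (hw x hx).continuousAt.continuousWithinAt
  -- Integrating factor: φ/w has zero derivative almost everywhere.
  have e := h.integral_complex_weight_mul (α := fun r => (w r)⁻¹) (α' := fun r => - w' r / w r ^ 2)
    (fun x hx => (hw x hx).inv (hw0 x hx)) (hw'.neg.div (hwc.pow 2) fun x hx => pow_ne_zero _ (hw0 x hx))
    one_pos hr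
  have z : ∫ x in (1:ℝ)..r, (((- w' x / w x ^ 2 : ℝ) : ℂ) * φ x + (((w x)⁻¹ : ℝ) : ℂ) * g x) = 0 := by
    rw [intervalIntegral.integral_congr_ae (g := fun _ => 0)]
    · simp
    · filter_upwards [he] with x hx hx2
      have hx0 := uIcc_subset_Ioi_zero one_pos hr (uIoc_subset_uIcc hx2)
      have hne : (w x : ℂ) ≠ 0 := by exact_mod_cast hw0 x hx0
      rw [hx hx0]
      push_cast
      field_simp
      ring
  rw [z] at e
  have h1 : (w 1 : ℂ) ≠ 0 := by exact_mod_cast hw0 1 one_pos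
  have h2 : (w r : ℂ) ≠ 0 := by exact_mod_cast hw0 r hr
  push_cast at e
  field_simp at e ⊢
  linear_combination -e

end RadialEnergy

/-! ### The logarithmic derivatives of the translational modes -/

namespace VortexProfile

variable {κ : ℝ} {f : ℝ → ℝ} (h : VortexProfile κ f)
include h

theorem contDiffOn_one : ContDiffOn ℝ 1 f (Ioi 0) := h.contDiffOn.of_le (by norm_num)

theorem contDiffOn_div : ContDiffOn ℝ 1 (fun r => f r / r) (Ioi 0) :=
  h.contDiffOn_one.div contDiffOn_id fun _ hx => ne_of_gt hx

theorem contDiffOn_fst : ContDiffOn ℝ 1 (fun r => deriv f r - f r / r) (Ioi 0) :=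
  h.contDiffOn_deriv.sub h.contDiffOn_div

theorem contDiffOn_snd : ContDiffOn ℝ 1 (fun r => deriv f r + f r / r) (Ioi 0) :=
  h.contDiffOn_deriv.add h.contDiffOn_div

theorem contDiffOn_force : ContDiffOn ℝ 1 (fun r => r * (κ * (1 - f r ^ 2) * f r)) (Ioi 0) :=
  contDiffOn_id.mul ((contDiffOn_const.mul (contDiffOn_const.sub (h.contDiffOn_one.pow 2))).mul
    h.contDiffOn_one)

theorem hasDerivAt_force {r : ℝ} (hr : 0 < r) :
    HasDerivAt (fun r => r * (κ * (1 - f r ^ 2) * f r))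
      (κ * (1 - f r ^ 2) * f r + r * (κ * (1 - 3 * f r ^ 2) * deriv f r)) r := by
  have hf := h.hasDerivAt hr
  refine ((hasDerivAt_id r).mul ((((hf.pow 2).const_sub 1).const_mul κ).mul hf)).congr_deriv ?_
  simp [-mul_eq_mul_left_iff]
  ring

theorem continuousOn : ContinuousOn f (Ioi 0) := h.contDiffOn.continuousOn

/-- This function is rΦ'/Φ with Φ' eliminated by `hasDerivAt_fst`, which makes it visibly C¹. -/
theorem contDiffOn_logDeriv_fst :
    ContDiffOn ℝ 1 (fun r => -2 - r * (κ * (1 - f r ^ 2) * f r) / (deriv f r - f r / r)) (Ioi 0) :=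
  contDiffOn_const.sub (h.contDiffOn_force.div h.contDiffOn_fst fun _ hr => (h.fst_neg hr).ne)

theorem contDiffOn_logDeriv_snd :
    ContDiffOn ℝ 1 (fun r => - (r * (κ * (1 - f r ^ 2) * f r) / (deriv f r + f r / r))) (Ioi 0) :=
  (h.contDiffOn_force.div h.contDiffOn_snd fun _ hr => (h.snd_pos hr).ne').neg

/-- The Riccati equation of rΦ'/Φ. Its right side is arranged to be the coefficient of |φ|² in
`pairDensity_mul_eq` for x = Ψ/Φ, up to the factor 1+δ. -/
theorem hasDerivAt_logDeriv_fst {r : ℝ} (hr : 0 < r) :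
    HasDerivAt (fun r => -2 - r * (κ * (1 - f r ^ 2) * f r) / (deriv f r - f r / r))
      (r * (4 / r ^ 2 + κ * (f r ^ 2 * (1 + (deriv f r + f r / r) / (deriv f r - f r / r))
          - (1 - f r ^ 2))
        - ((-2 - r * (κ * (1 - f r ^ 2) * f r) / (deriv f r - f r / r)) / r) ^ 2)) r := by
  have hne := (h.fst_neg hr).ne
  refine (((h.hasDerivAt_force hr).div (h.hasDerivAt_fst hr) hne).const_sub (-2)).congr_deriv ?_
  -- Expressing everything through Φ and f/r turns the denominator Φ into a nonzero atom for
  -- `field_simp`.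
  have hd : deriv f r + f r / r = (deriv f r - f r / r) + 2 * (f r / r) := by ring
  have hd' : deriv f r = (deriv f r - f r / r) + (f r / r) := by ring
  rw [hd]
  generalize hΦ : deriv f r - f r / r = Φ at *
  rw [hd']
  field_simp
  ring

/-- The Riccati counterpart for Ψ; the term 4/r² is absent because the centrifugal coefficient
(1-n)² of ψ is zero at n = 1. -/
theorem hasDerivAt_logDeriv_snd {r : ℝ} (hr : 0 < r) :
    HasDerivAt (fun r => - (r * (κ * (1 - f r ^ 2) * f r) / (deriv f r + f r / r)))
      (r * (κ * (f r ^ 2 * (1 + (deriv f r - f r / r) / (deriv f r + f r / r)) - (1 - f r ^ 2))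
        - ((- (r * (κ * (1 - f r ^ 2) * f r) / (deriv f r + f r / r))) / r) ^ 2)) r := by
  have hne := (h.snd_pos hr).ne'
  refine (((h.hasDerivAt_force hr).div (h.hasDerivAt_snd hr) hne).neg).congr_deriv ?_
  have hd : deriv f r - f r / r = (deriv f r + f r / r) - 2 * (f r / r) := by ring
  have hd' : deriv f r = (deriv f r + f r / r) - (f r / r) := by ring
  rw [hd]
  generalize hΦ : deriv f r + f r / r = Ψ at *
  rw [hd']
  field_simp
  ring

/-- By `force_le` and the signs, the subtracted quotient lies between -4 and 0. -/
theorem abs_logDeriv_fst_le {r : ℝ} (hr : 0 < r) :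
    |-2 - r * (κ * (1 - f r ^ 2) * f r) / (deriv f r - f r / r)| ≤ 2 := by
  have h1 := h.fst_neg hr
  have h2 := h.force_le hr
  have h3 := h.force_pos hr
  have h4 : - (r * (κ * (1 - f r ^ 2) * f r) / (deriv f r - f r / r))
      = r * (κ * (1 - f r ^ 2) * f r) / (- (deriv f r - f r / r)) := by rw [div_neg]
  have h5 : 0 < - (deriv f r - f r / r) := by linarith
  have h6 : r * (κ * (1 - f r ^ 2) * f r) / (- (deriv f r - f r / r)) ≤ 4 := by
    rw [div_le_iff₀ h5]; exact h2
  have h7 : 0 ≤ r * (κ * (1 - f r ^ 2) * f r) / (- (deriv f r - f r / r)) := by positivity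
  rw [abs_le]
  constructor <;> linarith

/-- The decay of 1 - f² compensates r², and the remaining f/r is at most Ψ. -/
theorem exists_abs_logDeriv_snd_le : ∃ C, ∀ r, 0 < r →
    |- (r * (κ * (1 - f r ^ 2) * f r) / (deriv f r + f r / r))| ≤ C := by
  obtain ⟨C, hC, hdec⟩ := h.exists_decay
  refine ⟨κ * C, fun r hr => ?_⟩
  have h1 := h.snd_pos hr
  have h2 := h.snd_ge hr
  have h3 := h.force_pos hr
  have h4 := hdec r hr
  have hk := h.kpos
  rw [abs_neg, abs_of_nonneg (by positivity), div_le_iff₀ h1]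
  have hf := h.pos r hr
  calc r * (κ * (1 - f r ^ 2) * f r) ≤ r * (κ * (C / r ^ 2) * f r) := by gcongr
    _ = κ * C * (f r / r) := by field_simp
    _ ≤ κ * C * (deriv f r + f r / r) := by gcongr

theorem contDiffOn_logDeriv : ContDiffOn ℝ 1 (fun r => r * deriv f r / f r) (Ioi 0) :=
  (contDiffOn_id.mul h.contDiffOn_deriv).div h.contDiffOn_one fun r hr => (h.pos r hr).ne'

/-- The Riccati equation for f, the ground state used in mode zero. -/
theorem hasDerivAt_logDeriv {r : ℝ} (hr : 0 < r) :
    HasDerivAt (fun r => r * deriv f r / f r)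
      (r * (1 / r ^ 2 - κ * (1 - f r ^ 2) - (deriv f r / f r) ^ 2)) r := by
  have hne := (h.pos r hr).ne'
  refine (((hasDerivAt_id r).mul (h.hasDerivAt_deriv hr)).div (h.hasDerivAt hr) hne).congr_deriv ?_
  have := h.ode r hr
  have e : deriv (deriv f) r = - (κ * (1 - f r ^ 2) * f r) - deriv f r / r + f r / r ^ 2 := by
    linarith
  simp only [Pi.mul_apply, id, e]
  field_simp
  ring

theorem abs_logDeriv_le {r : ℝ} (hr : 0 < r) : |r * deriv f r / f r| ≤ 1 := by
  have h1 := h.deriv_nonneg hr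
  have h2 := h.pos r hr
  have h3 := (h.deriv_lt hr).le
  rw [le_div_iff₀ hr] at h3
  rw [abs_of_nonneg (by positivity), div_le_iff₀ h2]
  linarith

end VortexProfile

/-! ### The quadratic forms of the Fourier modes -/

/-- The integrand of the quadratic form of a pair of modes `e^{iθ} (φ e^{inθ} + ψ e^{-inθ})`. -/
noncomputable def pairDensity (n δ c F r : ℝ) (φ a ψ b : ℂ) : ℝ :=
  ‖a‖ ^ 2 + ‖b‖ ^ 2 + (1 + n) ^ 2 / r ^ 2 * ‖φ‖ ^ 2 + (1 - n) ^ 2 / r ^ 2 * ‖ψ‖ ^ 2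
    + 2 * δ * ((conj a + (((1 + n) / r : ℝ) : ℂ) * conj φ)
      * (conj b + (((1 - n) / r : ℝ) : ℂ) * conj ψ)).re
    + c * (F ^ 2 * ‖φ + conj ψ‖ ^ 2 - (1 - F ^ 2) * (‖φ‖ ^ 2 + ‖ψ‖ ^ 2))

/-- The integrand of the quadratic form of the mode `φ e^{iθ}`. -/
noncomputable def modeDensity (δ c F r : ℝ) (φ a : ℂ) : ℝ :=
  ‖a‖ ^ 2 + 1 / r ^ 2 * ‖φ‖ ^ 2 + δ * ((conj a + ((1 / r : ℝ) : ℂ) * conj φ) ^ 2).re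
    + c * (2 * F ^ 2 * φ.re ^ 2 - (1 - F ^ 2) * ‖φ‖ ^ 2)

/-- In a sum over all integers the mode n = 0 is paired with itself; this identifies its term. -/
theorem pairDensity_zero_self (δ c F r : ℝ) (φ a : ℂ) :
    pairDensity 0 δ c F r φ a φ a = 2 * modeDensity δ c F r φ a := by
  have : φ + conj φ = ((2 * φ.re : ℝ) : ℂ) := by rw [Complex.add_conj]
  simp only [pairDensity, modeDensity, this, Complex.norm_real, Real.norm_eq_abs, sq_abs,
    add_zero, sub_zero, ← sq]
  ring

theorem pairDensity_neg (n δ c F r : ℝ) (φ a ψ b : ℂ) :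
    pairDensity (-n) δ c F r φ a ψ b = pairDensity n δ c F r ψ b φ a := by
  have : ‖φ + conj ψ‖ = ‖ψ + conj φ‖ := by
    rw [← RCLike.norm_conj (φ + conj ψ)]; simp [add_comm]
  simp only [pairDensity, this, sub_neg_eq_add, ← sub_eq_add_neg]
  rw [mul_comm (conj a + _)]
  ring

/-- The part of the density of a pair of modes which is a sum of squares. -/
noncomputable def pairRemainder (n δ κ F r p q x y : ℝ) (φ a ψ b : ℂ) : ℝ :=
  r * (-δ * ‖(a + (((1 + n) / r : ℝ) : ℂ) * φ) - conj (b + (((1 - n) / r : ℝ) : ℂ) * ψ)‖ ^ 2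
    + (1 + δ) * (‖a - p * φ‖ ^ 2 + ‖b - q * ψ‖ ^ 2
      + κ * F ^ 2 * (2 * (φ * ψ).re - x * ‖φ‖ ^ 2 - y * ‖ψ‖ ^ 2)
      + ((1 + n) ^ 2 - 4) / r ^ 2 * ‖φ‖ ^ 2 + (1 - n) ^ 2 / r ^ 2 * ‖ψ‖ ^ 2))

/-- The central algebraic identity, valid for arbitrary p, q, x, y. The brackets become exact
derivatives of ((1+δ)rp + δ(1+n))|φ|² and ((1+δ)rq + δ(1-n))|ψ|² once rp and rq solve the Riccati
equations. The δ-term is split by 2 Re(AB) = |A|² + |B|² - |A - B̄|². -/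
theorem pairDensity_mul_eq (n δ κ F p q x y : ℝ) {r : ℝ} (hr : r ≠ 0) (φ a ψ b : ℂ) :
    pairDensity n δ ((1 + δ) * κ) F r φ a ψ b * r =
      ((((1 + δ) * (r * (4 / r ^ 2 + κ * (F ^ 2 * (1 + x) - (1 - F ^ 2)) - p ^ 2))) * ‖φ‖ ^ 2
        + ((1 + δ) * (r * p) + δ * (1 + n)) * (2 * (conj φ * a).re))
      + (((1 + δ) * (r * (κ * (F ^ 2 * (1 + y) - (1 - F ^ 2)) - q ^ 2))) * ‖ψ‖ ^ 2
        + ((1 + δ) * (r * q) + δ * (1 - n)) * (2 * (conj ψ * b).re)))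
      + pairRemainder n δ κ F r p q x y φ a ψ b := by
  simp only [pairDensity, pairRemainder, Complex.sq_norm, Complex.normSq_apply, Complex.add_re,
    Complex.add_im, Complex.sub_re, Complex.sub_im, Complex.mul_re, Complex.mul_im,
    Complex.conj_re, Complex.conj_im, Complex.ofReal_re, Complex.ofReal_im]
  field_simp
  ring

/-- For X = Φ < 0 < Y = Ψ the denominator is positive, so the coupling is nonnegative; it vanishes
exactly when Yφ = Xψ̄, which ties the two coefficients together in the equality case. -/
theorem coupling_eq {X Y : ℝ} (hX : X ≠ 0) (hY : Y ≠ 0) (φ ψ : ℂ) :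
    2 * (φ * ψ).re - Y / X * ‖φ‖ ^ 2 - X / Y * ‖ψ‖ ^ 2
      = ‖Y * φ - X * conj ψ‖ ^ 2 / (-(X * Y)) := by
  simp only [Complex.sq_norm, Complex.normSq_apply, Complex.sub_re, Complex.sub_im, Complex.mul_re,
    Complex.mul_im, Complex.conj_re, Complex.conj_im, Complex.ofReal_re, Complex.ofReal_im]
  field_simp
  ring

/-- The analogue in mode zero, where the anisotropic term is split by Re(w²) = |w|² - 2(Im w)². -/
theorem modeDensity_mul_eq (δ κ F s : ℝ) {r : ℝ} (hr : r ≠ 0) (φ a : ℂ) :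
    modeDensity δ ((1 + δ) * κ) F r φ a * r =
      (((1 + δ) * (r * (1 / r ^ 2 - κ * (1 - F ^ 2) - s ^ 2))) * ‖φ‖ ^ 2
        + ((1 + δ) * (r * s) + δ) * (2 * (conj φ * a).re))
      + r * (2 * -δ * (a + ((1 / r : ℝ) : ℂ) * φ).im ^ 2
        + (1 + δ) * (‖a - s * φ‖ ^ 2 + 2 * κ * F ^ 2 * φ.re ^ 2)) := by
  simp only [modeDensity, Complex.sq_norm, Complex.normSq_apply, Complex.add_re,
    Complex.add_im, Complex.sub_re, Complex.sub_im, Complex.mul_re, Complex.mul_im, sq (conj a + _),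
    Complex.conj_re, Complex.conj_im, Complex.ofReal_re, Complex.ofReal_im]
  field_simp
  ring

/-- The term with 1 - F² has no counterpart in the energy; the decay C/r² lets the weight |φ|²/r²
control it, so the density is integrable on the energy space. -/
theorem abs_pairDensity_le {n δ c F r C : ℝ} (hδ : |δ| ≤ 1) (hc : 0 ≤ c)
    (hF1 : F ^ 2 ≤ 1) (hr : 0 < r) (hC : 1 - F ^ 2 ≤ C / r ^ 2) (φ a ψ b : ℂ) :
    |pairDensity n δ c F r φ a ψ b| ≤ 3 * (‖a‖ ^ 2 + ‖b‖ ^ 2)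
      + (3 * (1 + n) ^ 2 + c * C) * (‖φ‖ ^ 2 / r ^ 2) + (3 * (1 - n) ^ 2 + c * C) * (‖ψ‖ ^ 2 / r ^ 2)
      + c * ‖φ + conj ψ‖ ^ 2 := by
  have hA : ∀ (m : ℝ) (u w : ℂ), ‖conj u + ((m / r : ℝ) : ℂ) * conj w‖ ^ 2
      ≤ 2 * (‖u‖ ^ 2 + m ^ 2 / r ^ 2 * ‖w‖ ^ 2) := by
    intro m u w
    have h1 : ‖conj u + ((m / r : ℝ) : ℂ) * conj w‖ ≤ ‖u‖ + |m / r| * ‖w‖ := by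
      refine (norm_add_le _ _).trans ?_
      rw [norm_mul, RCLike.norm_conj, RCLike.norm_conj, Complex.norm_real, Real.norm_eq_abs]
    have h2 : (|m / r| * ‖w‖) ^ 2 = m ^ 2 / r ^ 2 * ‖w‖ ^ 2 := by
      rw [mul_pow, sq_abs, div_pow]
    have h3 : 0 ≤ ‖conj u + ((m / r : ℝ) : ℂ) * conj w‖ := norm_nonneg _
    have h4 : 0 ≤ |m / r| * ‖w‖ := by positivity
    rw [← h2]
    nlinarith [sq_nonneg (‖u‖ - |m / r| * ‖w‖), norm_nonneg u]
  have hAB := Complex.abs_re_le_norm ((conj a + (((1 + n) / r : ℝ) : ℂ) * conj φ)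
      * (conj b + (((1 - n) / r : ℝ) : ℂ) * conj ψ))
  rw [norm_mul] at hAB
  have h1 := hA (1 + n) a φ
  have h2 := hA (1 - n) b ψ
  set A := ‖conj a + (((1 + n) / r : ℝ) : ℂ) * conj φ‖
  set B := ‖conj b + (((1 - n) / r : ℝ) : ℂ) * conj ψ‖
  set R := ((conj a + (((1 + n) / r : ℝ) : ℂ) * conj φ)
      * (conj b + (((1 - n) / r : ℝ) : ℂ) * conj ψ)).re with hR
  have h3 : |2 * δ * R| ≤ A ^ 2 + B ^ 2 := by
    rw [abs_mul, abs_mul, abs_two]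
    have : |δ| * |R| ≤ 1 * (A * B) := by gcongr
    nlinarith [sq_nonneg (A - B)]
  have h4 : ∀ w : ℂ, (1 - F ^ 2) * ‖w‖ ^ 2 ≤ C * (‖w‖ ^ 2 / r ^ 2) := fun w => by
    calc (1 - F ^ 2) * ‖w‖ ^ 2 ≤ C / r ^ 2 * ‖w‖ ^ 2 := by gcongr
      _ = C * (‖w‖ ^ 2 / r ^ 2) := by ring
  have hF0 := sq_nonneg F
  have h5 : F ^ 2 * ‖φ + conj ψ‖ ^ 2 ≤ 1 * ‖φ + conj ψ‖ ^ 2 := by gcongr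
  have h6 : 0 ≤ F ^ 2 * ‖φ + conj ψ‖ ^ 2 := by positivity
  have h7 : 0 ≤ (1 - F ^ 2) * (‖φ‖ ^ 2 + ‖ψ‖ ^ 2) := by
    have : 0 ≤ 1 - F ^ 2 := by linarith
    positivity
  have h8 : |c * (F ^ 2 * ‖φ + conj ψ‖ ^ 2 - (1 - F ^ 2) * (‖φ‖ ^ 2 + ‖ψ‖ ^ 2))|
      ≤ c * (‖φ + conj ψ‖ ^ 2 + C * (‖φ‖ ^ 2 / r ^ 2) + C * (‖ψ‖ ^ 2 / r ^ 2)) := by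
    rw [abs_mul, abs_of_nonneg hc]
    gcongr
    have := h4 φ
    have := h4 ψ
    have h9 : 0 ≤ ‖φ + conj ψ‖ ^ 2 := by positivity
    rw [abs_le]
    constructor <;> nlinarith
  have h10 : (0:ℝ) ≤ ‖a‖ ^ 2 := by positivity
  have h11 : (0:ℝ) ≤ ‖b‖ ^ 2 := by positivity
  have h12 : 0 ≤ (1 + n) ^ 2 / r ^ 2 * ‖φ‖ ^ 2 := by positivity
  have h13 : 0 ≤ (1 - n) ^ 2 / r ^ 2 * ‖ψ‖ ^ 2 := by positivity
  have e1 : (1 + n) ^ 2 * (‖φ‖ ^ 2 / r ^ 2) = (1 + n) ^ 2 / r ^ 2 * ‖φ‖ ^ 2 := by ring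
  have e2 : (1 - n) ^ 2 * (‖ψ‖ ^ 2 / r ^ 2) = (1 - n) ^ 2 / r ^ 2 * ‖ψ‖ ^ 2 := by ring
  unfold pairDensity
  rw [← hR]
  have t := abs_add_le (‖a‖ ^ 2 + ‖b‖ ^ 2 + (1 + n) ^ 2 / r ^ 2 * ‖φ‖ ^ 2
    + (1 - n) ^ 2 / r ^ 2 * ‖ψ‖ ^ 2 + 2 * δ * R)
    (c * (F ^ 2 * ‖φ + conj ψ‖ ^ 2 - (1 - F ^ 2) * (‖φ‖ ^ 2 + ‖ψ‖ ^ 2)))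
  have t2 := abs_add_le (‖a‖ ^ 2 + ‖b‖ ^ 2 + (1 + n) ^ 2 / r ^ 2 * ‖φ‖ ^ 2
    + (1 - n) ^ 2 / r ^ 2 * ‖ψ‖ ^ 2) (2 * δ * R)
  rw [abs_of_nonneg (by positivity : 0 ≤ ‖a‖ ^ 2 + ‖b‖ ^ 2 + (1 + n) ^ 2 / r ^ 2 * ‖φ‖ ^ 2
    + (1 - n) ^ 2 / r ^ 2 * ‖ψ‖ ^ 2)] at t2
  linarith

theorem aestronglyMeasurable_pairDensity {μ : Measure ℝ} {n δ c : ℝ} {F : ℝ → ℝ}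
    {φ a ψ b : ℝ → ℂ} (hF : AEStronglyMeasurable F μ) (hφ : AEStronglyMeasurable φ μ)
    (ha : AEStronglyMeasurable a μ) (hψ : AEStronglyMeasurable ψ μ)
    (hb : AEStronglyMeasurable b μ) :
    AEStronglyMeasurable
      (fun r => pairDensity n δ c (F r) r (φ r) (a r) (ψ r) (b r)) μ := by
  have hid : AEMeasurable (fun r : ℝ => r) μ := aemeasurable_id
  have hF := hF.aemeasurable
  have hφ := hφ.aemeasurable
  have ha := ha.aemeasurable
  have hψ := hψ.aemeasurable
  have hb := hb.aemeasurable
  have hcφ := Complex.continuous_conj.measurable.comp_aemeasurable hφ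
  have hca := Complex.continuous_conj.measurable.comp_aemeasurable ha
  have hcψ := Complex.continuous_conj.measurable.comp_aemeasurable hψ
  have hcb := Complex.continuous_conj.measurable.comp_aemeasurable hb
  have h1 : AEMeasurable (fun r : ℝ => (((1 + n) / r : ℝ) : ℂ)) μ :=
    Complex.measurable_ofReal.comp_aemeasurable (hid.const_div _)
  have h2 : AEMeasurable (fun r : ℝ => (((1 - n) / r : ℝ) : ℂ)) μ :=
    Complex.measurable_ofReal.comp_aemeasurable (hid.const_div _)
  have h3 := Complex.measurable_re.comp_aemeasurable
    ((hca.add (h1.mul hcφ)).mul (hcb.add (h2.mul hcψ)))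
  refine AEMeasurable.aestronglyMeasurable ?_
  unfold pairDensity
  exact ((((((ha.norm.pow_const 2).add (hb.norm.pow_const 2)).add
    (((hid.pow_const 2).const_div _).mul (hφ.norm.pow_const 2))).add
    (((hid.pow_const 2).const_div _).mul (hψ.norm.pow_const 2))).add
    (h3.const_mul _)).add
    (((((hF.pow_const 2).mul ((hφ.add hcψ).norm.pow_const 2)).sub
      (((hF.pow_const 2).const_sub 1).mul ((hφ.norm.pow_const 2).add (hψ.norm.pow_const 2)))).const_mul c)))

namespace VortexProfile

variable {κ : ℝ} {f : ℝ → ℝ} (h : VortexProfile κ f)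
include h

theorem integrableOn_pairDensity {n δ : ℝ} (hδ : δ ∈ Ioc (-1 : ℝ) 0) {φ a ψ b : ℝ → ℂ}
    (hφ : RadialEnergy φ a) (hψ : RadialEnergy ψ b)
    (hs : IntegrableOn (fun r => ‖φ r + conj (ψ r)‖ ^ 2 * r) (Ioi 0)) :
    IntegrableOn (fun r => pairDensity n δ ((1 + δ) * κ) (f r) r (φ r) (a r) (ψ r) (b r) * r)
      (Ioi 0) := by
  obtain ⟨C, hC, hdec⟩ := h.exists_decay
  have hc : 0 ≤ (1 + δ) * κ := mul_nonneg (by linarith [hδ.1]) h.kpos.le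
  refine ((((hφ.deriv_sq.add hψ.deriv_sq).const_mul 3).add
    (hφ.sq_div.const_mul (3 * (1 + n) ^ 2 + (1 + δ) * κ * C))).add
    (hψ.sq_div.const_mul (3 * (1 - n) ^ 2 + (1 + δ) * κ * C))).add (hs.const_mul ((1 + δ) * κ))
    |>.mono' ?_ ?_
  · exact (aestronglyMeasurable_pairDensity
      (h.continuousOn.aestronglyMeasurable measurableSet_Ioi)
      (hφ.prim.continuousOn.aestronglyMeasurable measurableSet_Ioi)
      hφ.prim.locInt.aestronglyMeasurable
      (hψ.prim.continuousOn.aestronglyMeasurable measurableSet_Ioi)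
      hψ.prim.locInt.aestronglyMeasurable).mul measurable_id.aestronglyMeasurable
  · filter_upwards [ae_restrict_mem measurableSet_Ioi] with r hr
    have hr0 : 0 < r := hr
    rw [norm_mul, Real.norm_eq_abs, Real.norm_of_nonneg hr0.le]
    have hle := abs_pairDensity_le (n := n) (abs_le.2 ⟨hδ.1.le, by linarith [hδ.2]⟩) hc
      (h.sq_lt_one hr0).le hr0 (hdec r hr0) (φ r) (a r) (ψ r) (b r)
    refine (mul_le_mul_of_nonneg_right hle hr0.le).trans (le_of_eq ?_)
    simp only [Pi.add_apply]
    field_simp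

/-- The quadratic form of a pair of modes of order at least one is nonnegative; it vanishes only at
the translational modes. -/
theorem pairForm_nonneg {n δ : ℝ} (hn : 1 ≤ n) (hδ : δ ∈ Ioc (-1 : ℝ) 0) {φ a ψ b : ℝ → ℂ}
    (hφ : RadialEnergy φ a) (hψ : RadialEnergy ψ b)
    (hs : IntegrableOn (fun r => ‖φ r + conj (ψ r)‖ ^ 2 * r) (Ioi 0)) :
    0 ≤ ∫ r in Ioi 0,
      pairDensity n δ ((1 + δ) * κ) (f r) r (φ r) (a r) (ψ r) (b r) * r ∧
    ((∫ r in Ioi 0,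
      pairDensity n δ ((1 + δ) * κ) (f r) r (φ r) (a r) (ψ r) (b r) * r ≤ 0) →
      (1 < n → ∀ᵐ r, 0 < r → φ r = 0 ∧ ψ r = 0) ∧
      ∃ c : ℂ, ∀ r, 0 < r → φ r = c * ((deriv f r - f r / r : ℝ) : ℂ) ∧
        ψ r = conj c * ((deriv f r + f r / r : ℝ) : ℂ)) := by
  have hδ0 : 0 ≤ -δ := by linarith [hδ.2]
  have hδ1 : 0 < 1 + δ := by linarith [hδ.1]
  have hk := h.kpos
  obtain ⟨C, hC⟩ := h.exists_abs_logDeriv_snd_le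
  -- The weights are 1+δ times a logarithmic derivative, shifted by the constant δ(1±n) that the
  -- anisotropic term contributes.
  have hb : ∀ {m x K : ℝ}, |x| ≤ K → |(1 + δ) * x + δ * m| ≤ (1 + δ) * K + |δ * m| := by
    intro m x K hx
    refine (abs_add_le _ _).trans ?_
    rw [abs_mul, abs_of_pos hδ1]
    gcongr
  obtain ⟨P1, Z1, I1⟩ := hφ.weight
    ((contDiffOn_const.mul h.contDiffOn_logDeriv_fst).add contDiffOn_const)
    (fun r hr => ((h.hasDerivAt_logDeriv_fst hr).const_mul (1 + δ)).add_const (δ * (1 + n)))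
    (fun r hr => hb (h.abs_logDeriv_fst_le hr))
  obtain ⟨P2, Z2, I2⟩ := hψ.weight
    ((contDiffOn_const.mul h.contDiffOn_logDeriv_snd).add contDiffOn_const)
    (fun r hr => ((h.hasDerivAt_logDeriv_snd hr).const_mul (1 + δ)).add_const (δ * (1 - n)))
    (fun r hr => hb (hC r hr))
  -- Here p = Φ'/Φ and q = Ψ'/Ψ, while x and y are the ratios that `coupling_eq` completes to a
  -- square.
  set p : ℝ → ℝ := fun r => (-2 - r * (κ * (1 - f r ^ 2) * f r) / (deriv f r - f r / r)) / r with hp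
  set q : ℝ → ℝ := fun r => (- (r * (κ * (1 - f r ^ 2) * f r) / (deriv f r + f r / r))) / r with hq
  set x : ℝ → ℝ := fun r => (deriv f r + f r / r) / (deriv f r - f r / r) with hx
  set y : ℝ → ℝ := fun r => (deriv f r - f r / r) / (deriv f r + f r / r) with hy
  have hcoup : ∀ r, 0 < r → 0 ≤ 2 * (φ r * ψ r).re - x r * ‖φ r‖ ^ 2 - y r * ‖ψ r‖ ^ 2 := by
    intro r hr
    rw [hx, hy]
    simp only
    rw [coupling_eq (h.fst_neg hr).ne (h.snd_pos hr).ne']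
    have : 0 < -((deriv f r - f r / r) * (deriv f r + f r / r)) := by
      have := mul_neg_of_neg_of_pos (h.fst_neg hr) (h.snd_pos hr); linarith
    positivity
  have hn4 : 0 ≤ (1 + n) ^ 2 - 4 := by nlinarith
  obtain ⟨hnn, hz⟩ := (P1.add P2).integral_nonneg_of_eq_add (by simpa using Z1.add Z2)
    (by simpa using I1.add I2) (h.integrableOn_pairDensity (n := n) hδ hφ hψ hs)
    (N := fun r => pairRemainder n δ κ (f r) r (p r) (q r) (x r) (y r) (φ r) (a r) (ψ r) (b r))
    (fun r hr => by
      have := hcoup r hr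
      unfold pairRemainder
      positivity)
    (fun r hr => by
      rw [pairDensity_mul_eq n δ κ (f r) (p r) (q r) (x r) (y r) hr.ne']
      have e1 : r * p r = -2 - r * (κ * (1 - f r ^ 2) * f r) / (deriv f r - f r / r) :=
        mul_div_cancel₀ _ hr.ne'
      have e2 : r * q r = - (r * (κ * (1 - f r ^ 2) * f r) / (deriv f r + f r / r)) :=
        mul_div_cancel₀ _ hr.ne'
      rw [e1, e2])
  refine ⟨hnn, fun hle => ?_⟩
  have hN : ∀ᵐ r, 0 < r → ‖a r - p r * φ r‖ ^ 2 = 0 ∧ ‖b r - q r * ψ r‖ ^ 2 = 0 ∧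
      (2 * (φ r * ψ r).re - x r * ‖φ r‖ ^ 2 - y r * ‖ψ r‖ ^ 2) = 0 ∧
      ((1 + n) ^ 2 - 4) / r ^ 2 * ‖φ r‖ ^ 2 = 0 ∧ (1 - n) ^ 2 / r ^ 2 * ‖ψ r‖ ^ 2 = 0 := by
    filter_upwards [hz hle] with r hr hr0
    have e := hr hr0
    unfold pairRemainder at e
    have c0 := hcoup r hr0
    have hf := h.pos r hr0
    have c1 : 0 ≤ κ * f r ^ 2 * (2 * (φ r * ψ r).re - x r * ‖φ r‖ ^ 2 - y r * ‖ψ r‖ ^ 2) := by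
      positivity
    have c2 : 0 ≤ ((1 + n) ^ 2 - 4) / r ^ 2 * ‖φ r‖ ^ 2 := by positivity
    have c3 : 0 ≤ (1 - n) ^ 2 / r ^ 2 * ‖ψ r‖ ^ 2 := by positivity
    have c4 : 0 ≤ ‖a r - p r * φ r‖ ^ 2 := by positivity
    have c5 : 0 ≤ ‖b r - q r * ψ r‖ ^ 2 := by positivity
    -- The remainder is a sum of nonnegative terms; its vanishing kills each of those multiplied by
    -- 1+δ > 0.
    have e1 := (mul_eq_zero.1 e).resolve_left hr0.ne'
    have c6 : 0 ≤ -δ * ‖(a r + (((1 + n) / r : ℝ) : ℂ) * φ r)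
      - conj (b r + (((1 - n) / r : ℝ) : ℂ) * ψ r)‖ ^ 2 := by positivity
    have e2 : (1 + δ) * (‖a r - p r * φ r‖ ^ 2 + ‖b r - q r * ψ r‖ ^ 2
      + κ * f r ^ 2 * (2 * (φ r * ψ r).re - x r * ‖φ r‖ ^ 2 - y r * ‖ψ r‖ ^ 2)
      + ((1 + n) ^ 2 - 4) / r ^ 2 * ‖φ r‖ ^ 2 + (1 - n) ^ 2 / r ^ 2 * ‖ψ r‖ ^ 2) = 0 :=
      le_antisymm (by linarith) (by positivity)
    have e3 := (mul_eq_zero.1 e2).resolve_left hδ1.ne'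
    have e4 : κ * f r ^ 2 * (2 * (φ r * ψ r).re - x r * ‖φ r‖ ^ 2 - y r * ‖ψ r‖ ^ 2) = 0 := by
      linarith
    refine ⟨by linarith, by linarith, (mul_eq_zero.1 e4).resolve_left (by positivity),
      by linarith, by linarith⟩
  constructor
  · intro hn1
    filter_upwards [hN] with r hr hr0
    obtain ⟨-, -, -, h4, h5⟩ := hr hr0
    have a1 : ((1 + n) ^ 2 - 4) / r ^ 2 ≠ 0 := by
      have : 0 < (1 + n) ^ 2 - 4 := by nlinarith
      positivity
    have a2 : (1 - n) ^ 2 / r ^ 2 ≠ 0 := by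
      have : 0 < (1 - n) ^ 2 := by nlinarith
      positivity
    exact ⟨by simpa [a1] using h4, by simpa [a2] using h5⟩
  have hcd := h.contDiffOn_fst.continuousOn
  have hcf : ContinuousOn (fun r => κ * (1 - f r ^ 2) * f r) (Ioi 0) :=
    (continuousOn_const.mul (continuousOn_const.sub (h.continuousOn.pow 2))).mul h.continuousOn
  have k1 : ∀ r, 0 < r → φ r = φ 1 / ((deriv f 1 - f 1 / 1 : ℝ) : ℂ)
      * ((deriv f r - f r / r : ℝ) : ℂ) := fun r hr =>
    hφ.prim.eq_const_mul (w := fun r => deriv f r - f r / r) (fun r hr => h.hasDerivAt_fst hr)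
      (((continuousOn_const.mul hcd).div continuousOn_id fun x hx => ne_of_gt hx).sub hcf)
      (fun r hr => (h.fst_neg hr).ne) (by
        filter_upwards [hN] with r hr hr0
        have e := (hr hr0).1
        have e2 := sub_eq_zero.1 (norm_eq_zero.1 (pow_eq_zero_iff two_ne_zero |>.1 e))
        rw [e2, hp]
        have := (h.fst_neg hr0).ne
        congr 2
        simp only
        generalize deriv f r - f r / r = Φ at *
        field_simp) hr
  have k2 : ∀ r, 0 < r → ψ r = ψ 1 / ((deriv f 1 + f 1 / 1 : ℝ) : ℂ)
      * ((deriv f r + f r / r : ℝ) : ℂ) := fun r hr =>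
    hψ.prim.eq_const_mul (w := fun r => deriv f r + f r / r) (fun r hr => h.hasDerivAt_snd hr)
      hcf.neg (fun r hr => (h.snd_pos hr).ne') (by
        filter_upwards [hN] with r hr hr0
        have e := (hr hr0).2.1
        have e2 := sub_eq_zero.1 (norm_eq_zero.1 (pow_eq_zero_iff two_ne_zero |>.1 e))
        rw [e2, hq]
        have := (h.snd_pos hr0).ne'
        congr 2
        field_simp) hr
  refine ⟨φ 1 / ((deriv f 1 - f 1 / 1 : ℝ) : ℂ), fun r hr => ⟨k1 r hr, ?_⟩⟩
  -- Both functions are now known up to constants, so vanishing of the coupling at a single point t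
  -- makes the constants conjugate.
  obtain ⟨t, ht, ht0⟩ : ∃ t, (2 * (φ t * ψ t).re - x t * ‖φ t‖ ^ 2 - y t * ‖ψ t‖ ^ 2) = 0 ∧
      0 < t := by
    have : (ae (volume.restrict (Ioi (0:ℝ)))).NeBot := by
      rw [ae_neBot, Ne, Measure.restrict_eq_zero]; simp
    obtain ⟨t, ht1, ht2⟩ := (((ae_restrict_iff' measurableSet_Ioi).2 hN).and
      (ae_restrict_mem measurableSet_Ioi)).exists
    exact ⟨t, ht1.2.2.1, ht2⟩
  have hX := h.fst_neg ht0
  have hY := h.snd_pos ht0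
  rw [hx, hy] at ht
  simp only at ht
  rw [coupling_eq hX.ne hY.ne', div_eq_zero_iff] at ht
  have ht2 := ht.resolve_right (by
    have := mul_neg_of_neg_of_pos hX hY
    linarith [this])
  have ht3 := sub_eq_zero.1 (norm_eq_zero.1 (pow_eq_zero_iff two_ne_zero |>.1 ht2))
  rw [k1 t ht0, k2 t ht0] at ht3
  have hXc : ((deriv f t - f t / t : ℝ) : ℂ) ≠ 0 := by exact_mod_cast hX.ne
  have hYc : ((deriv f t + f t / t : ℝ) : ℂ) ≠ 0 := by exact_mod_cast hY.ne'
  rw [map_mul, Complex.conj_ofReal] at ht3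
  have ht4 : φ 1 / ((deriv f 1 - f 1 / 1 : ℝ) : ℂ)
      = conj (ψ 1 / ((deriv f 1 + f 1 / 1 : ℝ) : ℂ)) := by
    apply mul_left_cancel₀ (mul_ne_zero hXc hYc)
    linear_combination ht3
  rw [ht4, Complex.conj_conj]
  exact k2 r hr

/-- The quadratic form of the mode zero is positive definite. -/
theorem modeForm_nonneg {δ : ℝ} (hδ : δ ∈ Ioc (-1 : ℝ) 0) {φ a : ℝ → ℂ}
    (hφ : RadialEnergy φ a) (hs : IntegrableOn (fun r => (φ r).re ^ 2 * r) (Ioi 0)) :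
    0 ≤ ∫ r in Ioi 0, modeDensity δ ((1 + δ) * κ) (f r) r (φ r) (a r) * r ∧
    ((∫ r in Ioi 0, modeDensity δ ((1 + δ) * κ) (f r) r (φ r) (a r) * r ≤ 0) →
      ∀ r, 0 < r → φ r = 0) := by
  have hδ0 : 0 ≤ -δ := by linarith [hδ.2]
  have hδ1 : 0 < 1 + δ := by linarith [hδ.1]
  have hk := h.kpos
  obtain ⟨P1, Z1, I1⟩ := hφ.weight (C := (1 + δ) * 1 + |δ|)
    ((contDiffOn_const.mul h.contDiffOn_logDeriv).add contDiffOn_const)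
    (fun r hr => ((h.hasDerivAt_logDeriv hr).const_mul (1 + δ)).add_const δ)
    (fun r hr => by
      refine (abs_add_le _ _).trans ?_
      rw [abs_mul, abs_of_pos hδ1]
      gcongr
      exact h.abs_logDeriv_le hr)
  have hi : IntegrableOn (fun r => modeDensity δ ((1 + δ) * κ) (f r) r (φ r) (a r) * r)
      (Ioi 0) := by
    -- Integrability is borrowed from the pair density of φ with itself, using φ + φ̄ = 2 Re φ.
    have := (h.integrableOn_pairDensity (n := 0) hδ hφ hφ (by
      have := hs.const_mul 4
      refine IntegrableOn.congr_fun this (fun r _ => ?_) measurableSet_Ioi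
      rw [Complex.add_conj, Complex.norm_real, Real.norm_eq_abs, sq_abs]
      ring)).const_mul (1 / 2)
    refine IntegrableOn.congr_fun this (fun r _ => ?_) measurableSet_Ioi
    rw [pairDensity_zero_self]
    ring
  obtain ⟨hnn, hz⟩ := P1.integral_nonneg_of_eq_add Z1 I1 hi
    (N := fun r => r * (2 * -δ * (a r + ((1 / r : ℝ) : ℂ) * φ r).im ^ 2
        + (1 + δ) * (‖a r - (deriv f r / f r : ℝ) * φ r‖ ^ 2 + 2 * κ * f r ^ 2 * (φ r).re ^ 2)))
    (fun r hr => by positivity)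
    (fun r hr => by
      rw [modeDensity_mul_eq δ κ (f r) (deriv f r / f r) hr.ne', mul_div_assoc])
  refine ⟨hnn, fun hle => ?_⟩
  have k1 : ∀ r, 0 < r → φ r = φ 1 / f 1 * f r := fun r hr =>
    hφ.prim.eq_const_mul (fun r hr => h.hasDerivAt hr) h.contDiffOn_deriv.continuousOn
      (fun r hr => (h.pos r hr).ne') (by
        filter_upwards [hz hle] with r hr hr0
        have e := (mul_eq_zero.1 (hr hr0)).resolve_left hr0.ne'
        have c1 : 0 ≤ 2 * -δ * (a r + ((1 / r : ℝ) : ℂ) * φ r).im ^ 2 := by positivity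
        have c2 : 0 ≤ 2 * κ * f r ^ 2 * (φ r).re ^ 2 := by positivity
        have c3 : 0 ≤ ‖a r - (deriv f r / f r : ℝ) * φ r‖ ^ 2 := by positivity
        have e2 : (1 + δ) * (‖a r - (deriv f r / f r : ℝ) * φ r‖ ^ 2
            + 2 * κ * f r ^ 2 * (φ r).re ^ 2) = 0 := le_antisymm (by linarith) (by positivity)
        have e3 := (mul_eq_zero.1 e2).resolve_left hδ1.ne'
        have e4 : ‖a r - (deriv f r / f r : ℝ) * φ r‖ ^ 2 = 0 := by linarith
        exact sub_eq_zero.1 (norm_eq_zero.1 (pow_eq_zero_iff two_ne_zero |>.1 e4))) hr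
  -- φ is a multiple of f, which tends to 1, whereas |φ|² tends to 0; hence the multiple is zero.
  have hl := hφ.prim.tendsto_norm_sq_atTop hφ.deriv_sq hφ.sq_div
  have hl2 : Tendsto (fun r => ‖φ r‖ ^ 2) atTop (𝓝 (‖φ 1 / f 1‖ ^ 2 * 1 ^ 2)) := by
    refine ((h.tendsto_one.pow 2).const_mul (‖φ 1 / f 1‖ ^ 2)).congr' ?_
    filter_upwards [eventually_gt_atTop 0] with r hr
    rw [k1 r hr, norm_mul, Complex.norm_real, mul_pow, Real.norm_eq_abs, sq_abs]
  have e := tendsto_nhds_unique hl2 hl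
  have e2 : φ 1 / f 1 = 0 := by simpa using e
  intro r hr
  rw [k1 r hr, e2, zero_mul]

end VortexProfile

/-! ### The forms on the spaces of radial coefficients -/

/-- Boundary values make sense only for the continuous representative, so the forms are evaluated
there and the conclusions carried back almost everywhere. -/
theorem AnisoGL.MemH1Loc.exists_radialEnergy {φ dφ : ℝ → ℂ} (h : MemH1Loc φ dφ)
    {e : ℝ → ℝ} (he : IntegrableOn (fun r => e r * r) (Ioi 0))
    (hle : ∀ r, 0 < r → ‖dφ r‖ ^ 2 + ‖φ r‖ ^ 2 / r ^ 2 ≤ e r) :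
    ∃ φ' : ℝ → ℂ, RadialEnergy φ' dφ ∧ ∀ᵐ r ∂(volume.restrict (Ioi (0 : ℝ))), φ r = φ' r := by
  obtain ⟨φ', hp, hae⟩ := h.weak.exists_isPrimitive
  have hae' := (ae_restrict_iff' measurableSet_Ioi).2 hae
  refine ⟨φ', ⟨hp, ?_, ?_⟩, hae'⟩
  · refine he.mono' ((hp.locInt.aestronglyMeasurable.norm.pow 2).mul
      measurable_id.aestronglyMeasurable) ?_
    filter_upwards [ae_restrict_mem measurableSet_Ioi] with r hr
    have hr0 : 0 < r := hr
    rw [Real.norm_of_nonneg (by positivity)]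
    have h1 := hle r hr0
    have h2 : 0 ≤ ‖φ r‖ ^ 2 / r ^ 2 := by positivity
    gcongr
    linarith
  · refine he.mono' (((hp.continuousOn.aestronglyMeasurable measurableSet_Ioi).norm.pow
      2).aemeasurable.div measurable_id.aemeasurable).aestronglyMeasurable ?_
    filter_upwards [ae_restrict_mem measurableSet_Ioi, hae'] with r hr hφ
    have hr0 : 0 < r := hr
    rw [Real.norm_of_nonneg (by positivity), ← hφ]
    have h1 := hle r hr0
    have h2 : 0 ≤ ‖dφ r‖ ^ 2 := by positivity
    calc ‖φ r‖ ^ 2 / r = ‖φ r‖ ^ 2 / r ^ 2 * r := by field_simp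
      _ ≤ e r * r := by gcongr; linarith

namespace VortexProfile

variable {κ : ℝ} {f : ℝ → ℝ} (h : VortexProfile κ f)
include h

theorem pairForm_nonneg_of_memH1 {n δ : ℝ} (hn : 1 ≤ n) (hδ : δ ∈ Ioc (-1 : ℝ) 0)
    {φ a ψ b : ℝ → ℂ} (hm : MemH1 φ a ψ b) :
    0 ≤ ∫ r in Ioi 0,
      pairDensity n δ ((1 + δ) * κ) (f r) r (φ r) (a r) (ψ r) (b r) * r ∧
    ((∫ r in Ioi 0,
      pairDensity n δ ((1 + δ) * κ) (f r) r (φ r) (a r) (ψ r) (b r) * r ≤ 0) →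
      (1 < n → ∀ᵐ r ∂(volume.restrict (Ioi (0 : ℝ))), φ r = 0 ∧ ψ r = 0) ∧
      ∃ c : ℂ, ∀ᵐ r ∂(volume.restrict (Ioi (0 : ℝ))),
        φ r = c * ((deriv f r - f r / r : ℝ) : ℂ) ∧
        ψ r = conj c * ((deriv f r + f r / r : ℝ) : ℂ)) := by
  obtain ⟨φ', h1, e1⟩ := hm.h1_fst.exists_radialEnergy hm.energy fun r _ => by
    have : 0 ≤ ‖b r‖ ^ 2 := by positivity
    have : 0 ≤ ‖ψ r‖ ^ 2 / r ^ 2 := by positivity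
    have : 0 ≤ ‖φ r + conj (ψ r)‖ ^ 2 := by positivity
    rw [add_div]
    linarith
  obtain ⟨ψ', h2, e2⟩ := hm.h1_snd.exists_radialEnergy hm.energy fun r _ => by
    have : 0 ≤ ‖a r‖ ^ 2 := by positivity
    have : 0 ≤ ‖φ r‖ ^ 2 / r ^ 2 := by positivity
    have : 0 ≤ ‖φ r + conj (ψ r)‖ ^ 2 := by positivity
    rw [add_div]
    linarith
  have m1 := h1.prim.continuousOn.aestronglyMeasurable (μ := volume) measurableSet_Ioi
  have m2 := h2.prim.continuousOn.aestronglyMeasurable (μ := volume) measurableSet_Ioi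
  have hs : IntegrableOn (fun r => ‖φ' r + conj (ψ' r)‖ ^ 2 * r) (Ioi 0) := by
    refine hm.energy.mono' (((m1.add
      (Complex.continuous_conj.comp_aestronglyMeasurable m2)).norm.pow 2).mul
      measurable_id.aestronglyMeasurable) ?_
    filter_upwards [ae_restrict_mem measurableSet_Ioi, e1, e2] with r hr k1 k2
    have hr0 : 0 < r := hr
    rw [Real.norm_of_nonneg (by positivity), ← k1, ← k2]
    gcongr
    have : 0 ≤ ‖a r‖ ^ 2 + ‖b r‖ ^ 2 + (‖φ r‖ ^ 2 + ‖ψ r‖ ^ 2) / r ^ 2 := by positivity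
    linarith
  have key := h.pairForm_nonneg hn hδ h1 h2 hs
  have heq : ∫ r in Ioi 0, pairDensity n δ ((1 + δ) * κ) (f r) r (φ r) (a r) (ψ r) (b r) * r
      = ∫ r in Ioi 0, pairDensity n δ ((1 + δ) * κ) (f r) r (φ' r) (a r) (ψ' r) (b r) * r := by
    refine integral_congr_ae ?_
    filter_upwards [e1, e2] with r k1 k2
    rw [k1, k2]
  rw [heq]
  refine ⟨key.1, fun hle => ?_⟩
  obtain ⟨z1, c, hc⟩ := key.2 hle
  refine ⟨fun hn1 => ?_, c, ?_⟩
  · filter_upwards [e1, e2, (ae_restrict_iff' measurableSet_Ioi).2 (z1 hn1)] with r k1 k2 k3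
    rwa [k1, k2]
  · filter_upwards [ae_restrict_mem measurableSet_Ioi, e1, e2] with r hr k1 k2
    rw [k1, k2]
    exact hc r hr

theorem modeForm_nonneg_of_memH0 {δ : ℝ} (hδ : δ ∈ Ioc (-1 : ℝ) 0) {φ a : ℝ → ℂ}
    (hm : MemH0 φ a) :
    0 ≤ ∫ r in Ioi 0, modeDensity δ ((1 + δ) * κ) (f r) r (φ r) (a r) * r ∧
    ((∫ r in Ioi 0, modeDensity δ ((1 + δ) * κ) (f r) r (φ r) (a r) * r ≤ 0) →
      ∀ᵐ r ∂(volume.restrict (Ioi (0 : ℝ))), φ r = 0) := by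
  obtain ⟨φ', h1, e1⟩ := hm.h1.exists_radialEnergy hm.energy fun r _ => by
    have : 0 ≤ (φ r).re ^ 2 := by positivity
    linarith
  have m1 := h1.prim.continuousOn.aestronglyMeasurable (μ := volume) measurableSet_Ioi
  have hs : IntegrableOn (fun r => (φ' r).re ^ 2 * r) (Ioi 0) := by
    refine hm.energy.mono' (((Complex.continuous_re.comp_aestronglyMeasurable m1).pow 2).mul
      measurable_id.aestronglyMeasurable) ?_
    filter_upwards [ae_restrict_mem measurableSet_Ioi, e1] with r hr k1
    have hr0 : 0 < r := hr
    rw [Real.norm_of_nonneg (by positivity), ← k1]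
    gcongr
    have : 0 ≤ ‖a r‖ ^ 2 + ‖φ r‖ ^ 2 / r ^ 2 := by positivity
    linarith
  have key := h.modeForm_nonneg hδ h1 hs
  have heq : ∫ r in Ioi 0, modeDensity δ ((1 + δ) * κ) (f r) r (φ r) (a r) * r
      = ∫ r in Ioi 0, modeDensity δ ((1 + δ) * κ) (f r) r (φ' r) (a r) * r := by
    refine integral_congr_ae ?_
    filter_upwards [e1] with r k1
    rw [k1]
  rw [heq]
  refine ⟨key.1, fun hle => ?_⟩
  filter_upwards [ae_restrict_mem measurableSet_Ioi, e1] with r hr k1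
  rw [k1, key.2 hle r hr]

end VortexProfile

theorem AnisoGL.MemH1.memH0 {φ a : ℝ → ℂ} (hm : MemH1 φ a φ a) : MemH0 φ a where
  h1 := hm.h1_fst
  energy := by
    have hφ := hm.h1_fst.weak.1.aestronglyMeasurable
    have ha := hm.h1_fst.weak.2.1.aestronglyMeasurable
    refine hm.energy.mono' ((((ha.norm.pow 2).add ((hφ.norm.pow 2).aemeasurable.div
      (measurable_id.pow_const 2).aemeasurable).aestronglyMeasurable).add
      ((Complex.continuous_re.comp_aestronglyMeasurable hφ).pow 2)).mul
      measurable_id.aestronglyMeasurable) ?_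
    filter_upwards [ae_restrict_mem measurableSet_Ioi] with r hr
    have hr0 : 0 < r := hr
    have e : ‖φ r + conj (φ r)‖ ^ 2 = 4 * (φ r).re ^ 2 := by
      rw [Complex.add_conj, Complex.norm_real, Real.norm_eq_abs, sq_abs]; ring
    rw [Real.norm_of_nonneg (by positivity), e, add_div]
    gcongr
    · linarith [sq_nonneg ‖a r‖]
    · have : 0 ≤ ‖φ r‖ ^ 2 / r ^ 2 := by positivity
      linarith
    · linarith [sq_nonneg (φ r).re]

/-! ### The forms at the profile for δ = 0, where κ = 1 and the potential has coefficient 1+δ -/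

theorem AnisoGL.Qn_eq_integral_pairDensity (n : ℕ) (δ : ℝ) (f₀ : ℝ → ℝ) (φ dφ ψ dψ : ℝ → ℂ) :
    Qn n δ f₀ φ dφ ψ dψ = ∫ r in Ioi 0,
      pairDensity n δ ((1 + δ) * 1) (f₀ r) r (φ r) (dφ r) (ψ r) (dψ r) * r := by
  rw [mul_one]; rfl

theorem AnisoGL.Q0_eq_integral_modeDensity (δ : ℝ) (f₀ : ℝ → ℝ) (φ dφ : ℝ → ℂ) :
    Q0 δ f₀ φ dφ = ∫ r in Ioi 0, modeDensity δ ((1 + δ) * 1) (f₀ r) r (φ r) (dφ r) * r := by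
  rw [mul_one]; rfl

namespace AnisoGL.IsRadialProfile

variable {f₀ : ℝ → ℝ} (h : IsRadialProfile 0 f₀)
include h

theorem vortexProfile_one : VortexProfile 1 f₀ := by
  simpa using h.vortexProfile (by norm_num)

theorem Qn_pos {n : ℕ} (hn : 2 ≤ n) {δ : ℝ} (hδ : δ ∈ Ioc (-1 : ℝ) 0) {φ dφ ψ dψ : ℝ → ℂ}
    (hm : MemH1 φ dφ ψ dψ)
    (hne : ¬ ∀ᵐ r ∂(volume.restrict (Ioi (0 : ℝ))), φ r = 0 ∧ ψ r = 0) :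
    0 < Qn n δ f₀ φ dφ ψ dψ := by
  have hn2 : (2 : ℝ) ≤ n := by exact_mod_cast hn
  have key := h.vortexProfile_one.pairForm_nonneg_of_memH1 (n := n) (by linarith) hδ hm
  rw [← Qn_eq_integral_pairDensity] at key
  by_contra! hle
  exact hne ((key.2 hle).1 (by linarith))

theorem Q0_pos {δ : ℝ} (hδ : δ ∈ Ioc (-1 : ℝ) 0) {φ dφ : ℝ → ℂ} (hm : MemH0 φ dφ)
    (hne : ¬ ∀ᵐ r ∂(volume.restrict (Ioi (0 : ℝ))), φ r = 0) : 0 < Q0 δ f₀ φ dφ := by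
  have key := h.vortexProfile_one.modeForm_nonneg_of_memH0 hδ hm
  rw [← Q0_eq_integral_modeDensity] at key
  by_contra! hle
  exact hne (key.2 hle)

theorem Q1_nonneg {δ : ℝ} (hδ : δ ∈ Ioc (-1 : ℝ) 0) {φ dφ ψ dψ : ℝ → ℂ}
    (hm : MemH1 φ dφ ψ dψ) :
    0 ≤ Qn 1 δ f₀ φ dφ ψ dψ ∧
      (Qn 1 δ f₀ φ dφ ψ dψ = 0 → MemTranslationPairs f₀ φ ψ) := by
  have key := h.vortexProfile_one.pairForm_nonneg_of_memH1 (n := (1 : ℕ)) (by simp) hδ hm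
  rw [← Qn_eq_integral_pairDensity] at key
  refine ⟨key.1, fun h0 => ?_⟩
  obtain ⟨-, c, hc⟩ := key.2 h0.le
  refine ⟨c.re, c.im, ?_⟩
  have e : conj c = (c.re : ℂ) - c.im * Complex.I := by
    apply Complex.ext <;> simp
  filter_upwards [hc] with r hr
  rw [Complex.re_add_im, ← e]
  exact hr

end AnisoGL.IsRadialProfile

/-! ### Polar coordinates -/

/-- The measure `r dr` on `(0,∞)`. -/
noncomputable def radialMeasure : Measure ℝ :=
  (volume.restrict (Ioi 0)).withDensity fun r => ENNReal.ofReal r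

/-- The measure `dθ` on `(-π,π]`. -/
noncomputable def angleMeasure : Measure ℝ := volume.restrict (Ioc (-Real.pi) Real.pi)

/-- The point with polar coordinates `(r,θ)`. -/
noncomputable def polarMap (p : ℝ × ℝ) : ℂ := p.1 * Complex.exp (p.2 * Complex.I)

instance : IsFiniteMeasure angleMeasure := by unfold angleMeasure; infer_instance

instance : SFinite radialMeasure := by unfold radialMeasure; infer_instance

theorem continuous_polarMap : Continuous polarMap := by unfold polarMap; fun_prop

theorem norm_polarMap {r : ℝ} (hr : 0 < r) (θ : ℝ) : ‖polarMap (r, θ)‖ = r := by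
  simp [polarMap, Complex.norm_exp_ofReal_mul_I, abs_of_pos hr]

theorem measurePreserving_polarMap :
    MeasurePreserving polarMap (radialMeasure.prod angleMeasure) volume := by
  refine ⟨continuous_polarMap.measurable, ?_⟩
  have hprod : radialMeasure.prod angleMeasure
      = (volume.restrict polarCoord.target).withDensity fun p => ENNReal.ofReal p.1 := by
    unfold radialMeasure angleMeasure
    rw [prod_withDensity_left ENNReal.measurable_ofReal, Measure.prod_restrict]
    congr 1
    -- Polar coordinates use the open angular interval, Fourier series the half-open one; the
    -- difference is a null set.
    have e : (Ioi (0:ℝ) ×ˢ Ioc (-Real.pi) Real.pi : Set (ℝ × ℝ)) =ᵐ[volume.prod volume]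
        (Ioi (0:ℝ) ×ˢ Ioo (-Real.pi) Real.pi : Set (ℝ × ℝ)) :=
      Measure.set_prod_ae_eq (Filter.EventuallyEq.refl _ _) Ioo_ae_eq_Ioc.symm
    rw [Measure.restrict_congr_set e]
    rfl
  ext s hs
  rw [Measure.map_apply continuous_polarMap.measurable hs, hprod,
    withDensity_apply _ (continuous_polarMap.measurable hs),
    ← lintegral_indicator_one hs, ← Complex.lintegral_comp_polarCoord_symm,
    ← lintegral_indicator (continuous_polarMap.measurable hs)]
  refine lintegral_congr fun p => ?_
  have : Complex.polarCoord.symm p = polarMap p := by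
    rw [Complex.polarCoord_symm_apply, polarMap, Complex.exp_mul_I]
    simp
  rw [this]
  by_cases h : polarMap p ∈ s
  · rw [indicator_of_mem (by exact h), indicator_of_mem h]; simp
  · rw [indicator_of_notMem (by exact h), indicator_of_notMem h]; simp

theorem ae_radialMeasure_iff {p : ℝ → Prop} :
    (∀ᵐ r ∂radialMeasure, p r) ↔ ∀ᵐ r ∂(volume.restrict (Ioi (0:ℝ))), p r := by
  unfold radialMeasure
  rw [ae_withDensity_iff ENNReal.measurable_ofReal]
  refine eventually_congr ?_
  filter_upwards [ae_restrict_mem measurableSet_Ioi] with r hr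
  have : ENNReal.ofReal r ≠ 0 := by simpa using hr
  simp [this]

theorem ae_radialMeasure_pos : ∀ᵐ r ∂radialMeasure, 0 < r :=
  ae_radialMeasure_iff.2 (ae_restrict_mem measurableSet_Ioi)

theorem aestronglyMeasurable_radialMeasure_iff {E : Type*} [NormedAddCommGroup E] {g : ℝ → E} :
    AEStronglyMeasurable g radialMeasure ↔ AEStronglyMeasurable g (volume.restrict (Ioi (0:ℝ))) := by
  refine ⟨fun h => h.mono_ac ?_, fun h => h.mono_ac (withDensity_absolutelyContinuous _ _)⟩
  refine withDensity_absolutelyContinuous' ENNReal.measurable_ofReal.aemeasurable ?_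
  filter_upwards [ae_restrict_mem measurableSet_Ioi] with r hr
  simpa using hr

theorem integral_radialMeasure {E : Type*} [NormedAddCommGroup E] [NormedSpace ℝ E] (g : ℝ → E) :
    ∫ r, g r ∂radialMeasure = ∫ r in Ioi (0:ℝ), r • g r := by
  unfold radialMeasure
  rw [integral_withDensity_eq_integral_toReal_smul ENNReal.measurable_ofReal (by simp)]
  refine setIntegral_congr_fun measurableSet_Ioi fun r hr => ?_
  rw [ENNReal.toReal_ofReal (le_of_lt hr)]

theorem integrable_radialMeasure_iff {E : Type*} [NormedAddCommGroup E] [NormedSpace ℝ E]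
    {g : ℝ → E} : Integrable g radialMeasure ↔ IntegrableOn (fun r => r • g r) (Ioi 0) := by
  unfold radialMeasure
  rw [integrable_withDensity_iff_integrable_smul' ENNReal.measurable_ofReal (by simp)]
  refine integrableOn_congr_fun (fun r hr => ?_) measurableSet_Ioi
  rw [ENNReal.toReal_ofReal (le_of_lt hr)]

theorem integrable_comp_polarMap {E : Type*} [NormedAddCommGroup E] {F : ℂ → E}
    (hF : Integrable F) : Integrable (fun p => F (polarMap p)) (radialMeasure.prod angleMeasure) :=
  measurePreserving_polarMap.integrable_comp_of_integrable hF

theorem integral_eq_integral_polar {E : Type*} [NormedAddCommGroup E] [NormedSpace ℝ E]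
    {F : ℂ → E} (hF : Integrable F) :
    ∫ z, F z = ∫ r, ∫ θ, F (polarMap (r, θ)) ∂angleMeasure ∂radialMeasure := by
  have h1 := integrable_comp_polarMap hF
  rw [← integral_prod _ h1, ← measurePreserving_polarMap.map_eq,
    integral_map measurePreserving_polarMap.aemeasurable]
  rw [measurePreserving_polarMap.map_eq]
  exact hF.aestronglyMeasurable

/-! ### Fourier coefficients on the circle -/

/-- The Fourier coefficient of order `k` of a function of the angle. -/
noncomputable def angleCoeff (g : ℝ → ℂ) (k : ℤ) : ℂ :=
  (2 * Real.pi : ℂ)⁻¹ * ∫ θ, Complex.exp (-(k * θ * Complex.I)) * g θ ∂angleMeasure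

/-- The mean of a function of the angle. -/
noncomputable def angleMean (g : ℝ → ℝ) : ℝ := (2 * Real.pi)⁻¹ * ∫ θ, g θ ∂angleMeasure

theorem norm_exp_neg_int_mul (k : ℤ) (θ : ℝ) : ‖Complex.exp (-(k * θ * Complex.I))‖ = 1 := by
  have : (-(k * θ * Complex.I) : ℂ) = ((-(k * θ) : ℝ) : ℂ) * Complex.I := by push_cast; ring
  rw [this, Complex.norm_exp_ofReal_mul_I]

theorem integrable_exp_mul {g : ℝ → ℂ} (hg : Integrable g angleMeasure) (k : ℤ) :
    Integrable (fun θ : ℝ => Complex.exp (-(k * θ * Complex.I)) * g θ) angleMeasure := by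
  refine hg.bdd_mul (c := 1) (by fun_prop : Continuous fun θ : ℝ =>
    Complex.exp (-(k * θ * Complex.I))).aestronglyMeasurable (Eventually.of_forall fun θ => ?_)
  rw [norm_exp_neg_int_mul]

theorem angleCoeff_eq_fourierCoeffOn (g : ℝ → ℂ) (k : ℤ) :
    angleCoeff g k = fourierCoeffOn (neg_lt_self Real.pi_pos) g k := by
  rw [fourierCoeffOn_eq_integral, intervalIntegral.integral_of_le (neg_le_self Real.pi_pos.le),
    angleCoeff, angleMeasure]
  simp only [fourier_coe_apply, smul_eq_mul, Complex.real_smul]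
  congr 1
  · push_cast; ring_nf
  · refine integral_congr_ae (Eventually.of_forall fun θ => ?_)
    simp only
    congr 2
    have : (Real.pi : ℂ) ≠ 0 := by exact_mod_cast Real.pi_ne_zero
    push_cast
    field_simp
    ring

theorem hasSum_sq_angleCoeff {g : ℝ → ℂ} (hg : MemLp g 2 angleMeasure) :
    HasSum (fun k : ℤ => ‖angleCoeff g k‖ ^ 2) (angleMean fun θ => ‖g θ‖ ^ 2) := by
  have := hasSum_sq_fourierCoeffOn (neg_lt_self Real.pi_pos) hg
  simp only [angleCoeff_eq_fourierCoeffOn]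
  convert this using 1
  rw [angleMean, intervalIntegral.integral_of_le (neg_le_self Real.pi_pos.le), angleMeasure,
    smul_eq_mul]
  congr 2
  ring

theorem angleCoeff_sub {g k : ℝ → ℂ} (hg : Integrable g angleMeasure)
    (hk : Integrable k angleMeasure) (n : ℤ) :
    angleCoeff (fun θ => g θ - k θ) n = angleCoeff g n - angleCoeff k n := by
  simp only [angleCoeff, mul_sub]
  rw [integral_sub (integrable_exp_mul hg n) (integrable_exp_mul hk n), mul_sub]

theorem angleCoeff_add {g k : ℝ → ℂ} (hg : Integrable g angleMeasure)
    (hk : Integrable k angleMeasure) (n : ℤ) :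
    angleCoeff (fun θ => g θ + k θ) n = angleCoeff g n + angleCoeff k n := by
  simp only [angleCoeff, mul_add]
  rw [integral_add (integrable_exp_mul hg n) (integrable_exp_mul hk n), mul_add]

theorem angleCoeff_const_mul (g : ℝ → ℂ) (c : ℂ) (n : ℤ) :
    angleCoeff (fun θ => c * g θ) n = c * angleCoeff g n := by
  simp only [angleCoeff, mul_left_comm _ c]
  rw [integral_const_mul]
  ring

theorem angleCoeff_exp_mul (g : ℝ → ℂ) (n m : ℤ) :
    angleCoeff (fun θ => Complex.exp (-(m * θ * Complex.I)) * g θ) n = angleCoeff g (n + m) := by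
  simp only [angleCoeff]
  congr 1
  refine integral_congr_ae (Eventually.of_forall fun θ => ?_)
  simp only
  rw [← mul_assoc, ← Complex.exp_add]
  congr 2
  push_cast
  ring

theorem angleCoeff_conj (g : ℝ → ℂ) (n : ℤ) :
    angleCoeff (fun θ => conj (g θ)) n = conj (angleCoeff g (-n)) := by
  simp only [angleCoeff, map_mul, map_inv₀, Complex.conj_ofReal, map_ofNat]
  rw [← integral_conj]
  congr 2
  ext θ
  rw [map_mul, ← Complex.exp_conj]
  congr 2
  simp

/-- Taking a real part mixes the orders n and -n; this is why modes of the second variation come in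
pairs. -/
theorem angleCoeff_re {g : ℝ → ℂ} (hg : Integrable g angleMeasure) (n : ℤ) :
    angleCoeff (fun θ => ((g θ).re : ℂ)) n = (angleCoeff g n + conj (angleCoeff g (-n))) / 2 := by
  have h1 : (fun θ => ((g θ).re : ℂ)) = fun θ => (1 / 2 : ℂ) * (g θ + conj (g θ)) := by
    ext θ
    rw [Complex.add_conj]
    push_cast; ring
  have hc : Integrable (fun θ => conj (g θ)) angleMeasure :=
    Complex.conjLIE.toContinuousLinearEquiv.toContinuousLinearMap.integrable_comp hg
  rw [h1, angleCoeff_const_mul, angleCoeff_add hg hc, angleCoeff_conj]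
  ring

theorem angleCoeff_exp (n m : ℤ) :
    angleCoeff (fun θ => Complex.exp (m * θ * Complex.I)) n = if n = m then 1 else 0 := by
  have hpi : (Real.pi : ℂ) ≠ 0 := by exact_mod_cast Real.pi_ne_zero
  have e : ∀ θ : ℝ, Complex.exp (-(n * θ * Complex.I)) * Complex.exp (m * θ * Complex.I)
      = Complex.exp (((m - n : ℤ) * Complex.I) * θ) := fun θ => by
    rw [← Complex.exp_add]; congr 1; push_cast; ring
  simp only [angleCoeff, e, angleMeasure]
  rw [← intervalIntegral.integral_of_le (neg_le_self Real.pi_pos.le)]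
  split_ifs with h
  · subst h
    simp
    field_simp
    norm_num
  · have hne : ((m - n : ℤ) * Complex.I : ℂ) ≠ 0 := by
      refine mul_ne_zero ?_ Complex.I_ne_zero
      exact_mod_cast sub_ne_zero.2 (Ne.symm h)
    rw [integral_exp_mul_complex hne]
    have : Complex.exp (((m - n : ℤ) * Complex.I) * (Real.pi : ℝ))
        = Complex.exp (((m - n : ℤ) * Complex.I) * ((-Real.pi : ℝ) : ℂ)) := by
      rw [Complex.exp_eq_exp_iff_exists_int]
      exact ⟨m - n, by push_cast; ring⟩
    rw [this]
    simp

/-! ### Circular slices of functions on the plane -/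

/-- For v only |v|²/r² is known to be integrable over the plane; the weight is constant on each
circle and can be divided out. -/
theorem ae_memLp_slice {F : ℂ → ℂ} (hF : AEStronglyMeasurable F volume) {wt : ℝ → ℝ}
    (hwt : ∀ r, 0 < r → wt r ≠ 0) (hi : Integrable fun z => ‖F z‖ ^ 2 * wt ‖z‖) :
    ∀ᵐ r ∂radialMeasure, MemLp (fun θ => F (polarMap (r, θ))) 2 angleMeasure := by
  have hm : AEStronglyMeasurable (fun p => F (polarMap p)) (radialMeasure.prod angleMeasure) :=
    hF.comp_quasiMeasurePreserving measurePreserving_polarMap.quasiMeasurePreserving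
  filter_upwards [hm.prodMk_left, (integrable_comp_polarMap hi).prod_right_ae,
    ae_radialMeasure_pos] with r h1 h2 hr
  rw [memLp_two_iff_integrable_sq_norm h1]
  have := h2.mul_const (wt r)⁻¹
  refine this.congr (Eventually.of_forall fun θ => ?_)
  simp only
  rw [norm_polarMap hr, mul_assoc, mul_inv_cancel₀ (hwt r hr), mul_one]

theorem integrable_angleMean {F : ℂ → ℝ} (hF : Integrable F) :
    Integrable (fun r => angleMean fun θ => F (polarMap (r, θ))) radialMeasure :=
  (integrable_comp_polarMap hF).integral_prod_left.const_mul _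

theorem integral_angleMean {F : ℂ → ℝ} (hF : Integrable F) :
    ∫ r, (angleMean fun θ => F (polarMap (r, θ))) ∂radialMeasure
      = (2 * Real.pi)⁻¹ * ∫ z, F z := by
  simp only [angleMean]
  rw [integral_const_mul, integral_eq_integral_polar hF]

theorem aestronglyMeasurable_angleCoeff {F : ℂ → ℂ} (hF : AEStronglyMeasurable F volume) (k : ℤ) :
    AEStronglyMeasurable (fun r => angleCoeff (fun θ => F (polarMap (r, θ))) k) radialMeasure := by
  have hm : AEStronglyMeasurable (fun p => F (polarMap p)) (radialMeasure.prod angleMeasure) :=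
    hF.comp_quasiMeasurePreserving measurePreserving_polarMap.quasiMeasurePreserving
  have he : AEStronglyMeasurable (fun p : ℝ × ℝ => Complex.exp (-(k * p.2 * Complex.I)))
      (radialMeasure.prod angleMeasure) := by
    refine Continuous.aestronglyMeasurable ?_
    fun_prop
  exact ((he.mul hm).integral_prod_right').const_mul _

/-- Parseval on almost every circle, followed by Tonelli in polar coordinates. -/
theorem ae_eq_zero_of_angleCoeff_eq_zero {F : ℂ → ℂ} (hF : AEStronglyMeasurable F volume)
    (hL : ∀ᵐ r ∂radialMeasure, MemLp (fun θ => F (polarMap (r, θ))) 2 angleMeasure)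
    (h0 : ∀ᵐ r ∂radialMeasure, ∀ k, angleCoeff (fun θ => F (polarMap (r, θ))) k = 0) :
    ∀ᵐ z, F z = 0 := by
  have hm : AEStronglyMeasurable (fun p => F (polarMap p)) (radialMeasure.prod angleMeasure) :=
    hF.comp_quasiMeasurePreserving measurePreserving_polarMap.quasiMeasurePreserving
  have h1 : ∀ᵐ r ∂radialMeasure, ∀ᵐ θ ∂angleMeasure, F (polarMap (r, θ)) = 0 := by
    filter_upwards [hL, h0] with r hr hr0
    have hs := hasSum_sq_angleCoeff hr
    simp only [hr0] at hs
    have e : angleMean (fun θ => ‖F (polarMap (r, θ))‖ ^ 2) = 0 := by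
      simp only [norm_zero, ne_eq, OfNat.ofNat_ne_zero, not_false_eq_true, zero_pow] at hs
      exact hs.unique hasSum_zero
    rw [angleMean, mul_eq_zero] at e
    have e2 := e.resolve_left (by have := Real.pi_pos; positivity)
    rw [integral_eq_zero_iff_of_nonneg (fun θ => by positivity)
      ((memLp_two_iff_integrable_sq_norm hr.1).1 hr)] at e2
    filter_upwards [e2] with θ hθ
    simpa using hθ
  have h2 : ∫⁻ z, ‖F z‖ₑ = 0 := by
    rw [← measurePreserving_polarMap.map_eq, lintegral_map' _ measurePreserving_polarMap.aemeasurable,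
      lintegral_prod _ hm.enorm]
    · rw [lintegral_eq_zero_iff' hm.enorm.lintegral_prod_right']
      filter_upwards [h1] with r hr
      simp only [Pi.zero_apply]
      rw [lintegral_congr_ae (g := fun _ => 0)]
      · simp
      · filter_upwards [hr] with θ hθ
        simp [hθ]
    · rw [measurePreserving_polarMap.map_eq]; exact hF.enorm
  rw [lintegral_eq_zero_iff' hF.enorm] at h2
  filter_upwards [h2] with z hz
  simpa using hz

/-! ### Weak derivatives tested with functions of separated variables -/

/-- Complex test functions are needed because those used below carry an angular factor. -/
theorem AnisoGL.HasWeakDirDeriv.complex_test {e : ℂ} {v g : ℂ → ℂ} (h : HasWeakDirDeriv e v g)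
    {η : ℂ → ℂ} (hη : ContDiff ℝ ∞ η) (hc : HasCompactSupport η) :
    Integrable (fun z => fderiv ℝ η z e * v z) ∧ Integrable (fun z => η z * g z) ∧
    ∫ z, fderiv ℝ η z e * v z = - ∫ z, η z * g z := by
  obtain ⟨hv, hg, ht⟩ := h
  have hdc : Continuous fun z => fderiv ℝ η z e := by
    have := hη.continuous_fderiv (by norm_num)
    exact this.clm_apply continuous_const
  have hdcs : HasCompactSupport fun z => fderiv ℝ η z e := hc.fderiv_apply ℝ e
  refine ⟨hv.integrable_smul_left_of_hasCompactSupport hdc hdcs,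
    hg.integrable_smul_left_of_hasCompactSupport hη.continuous hc, ?_⟩
  set χ₁ : ℂ → ℝ := fun z => (η z).re with h1
  set χ₂ : ℂ → ℝ := fun z => (η z).im with h2
  have s1 : ContDiff ℝ ∞ χ₁ := Complex.reCLM.contDiff.comp hη
  have s2 : ContDiff ℝ ∞ χ₂ := Complex.imCLM.contDiff.comp hη
  have c1 : HasCompactSupport χ₁ := hc.comp_left (g := Complex.re) rfl
  have c2 : HasCompactSupport χ₂ := hc.comp_left (g := Complex.im) rfl
  have hd : ∀ z, HasFDerivAt η (fderiv ℝ η z) z := fun z =>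
    (hη.differentiable (by norm_num) z).hasFDerivAt
  have d1 : ∀ z, fderiv ℝ χ₁ z e = (fderiv ℝ η z e).re := fun z => by
    have := (Complex.reCLM.hasFDerivAt.comp z (hd z)).fderiv
    rw [show χ₁ = Complex.reCLM ∘ η from rfl, this]; rfl
  have d2 : ∀ z, fderiv ℝ χ₂ z e = (fderiv ℝ η z e).im := fun z => by
    have := (Complex.imCLM.hasFDerivAt.comp z (hd z)).fderiv
    rw [show χ₂ = Complex.imCLM ∘ η from rfl, this]; rfl
  have cont : ∀ χ : ℂ → ℝ, ContDiff ℝ ∞ χ → Continuous fun z => ((fderiv ℝ χ z e : ℝ) : ℂ) :=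
    fun χ hχ => Complex.continuous_ofReal.comp
      ((hχ.continuous_fderiv (by norm_num)).clm_apply continuous_const)
  have supp : ∀ χ : ℂ → ℝ, HasCompactSupport χ →
      HasCompactSupport fun z => ((fderiv ℝ χ z e : ℝ) : ℂ) := fun χ hχ =>
    (hχ.fderiv_apply ℝ e).comp_left (g := ((↑) : ℝ → ℂ)) Complex.ofReal_zero
  have iv : ∀ χ : ℂ → ℝ, ContDiff ℝ ∞ χ → HasCompactSupport χ →
      Integrable fun z => ((fderiv ℝ χ z e : ℝ) : ℂ) * v z := fun χ hχ hχc =>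
    hv.integrable_smul_left_of_hasCompactSupport (cont χ hχ) (supp χ hχc)
  have ig : ∀ χ : ℂ → ℝ, ContDiff ℝ ∞ χ → HasCompactSupport χ →
      Integrable fun z => (χ z : ℂ) * g z := fun χ hχ hχc =>
    hg.integrable_smul_left_of_hasCompactSupport (Complex.continuous_ofReal.comp hχ.continuous)
      (hχc.comp_left (g := ((↑) : ℝ → ℂ)) Complex.ofReal_zero)
  have e1 : ∫ z, fderiv ℝ η z e * v z = (∫ z, ((fderiv ℝ χ₁ z e : ℝ) : ℂ) * v z)
      + Complex.I * ∫ z, ((fderiv ℝ χ₂ z e : ℝ) : ℂ) * v z := by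
    rw [← integral_const_mul, ← integral_add (iv _ s1 c1) ((iv _ s2 c2).const_mul _)]
    congr 1; ext z
    rw [d1, d2]
    nth_rw 1 [← Complex.re_add_im (fderiv ℝ η z e)]
    ring
  have e2 : ∫ z, η z * g z = (∫ z, (χ₁ z : ℂ) * g z) + Complex.I * ∫ z, (χ₂ z : ℂ) * g z := by
    rw [← integral_const_mul, ← integral_add (ig _ s1 c1) ((ig _ s2 c2).const_mul _)]
    congr 1; ext z
    nth_rw 1 [← Complex.re_add_im (η z)]
    simp only [h1, h2]
    ring
  rw [e1, e2, ht _ s1 c1, ht _ s2 c2]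
  ring

theorem contDiff_mul_of_zero_near {χ g : ℝ → ℝ} {a : ℝ} (ha : 0 < a) (hχ : ContDiff ℝ ∞ χ)
    (hz : ∀ x, x ≤ a → χ x = 0) (hg : ContDiffOn ℝ ∞ g (Ioi 0)) :
    ContDiff ℝ ∞ fun x => χ x * g x := by
  rw [contDiff_iff_contDiffAt]
  intro x
  rcases lt_or_ge 0 x with hx | hx
  · exact hχ.contDiffAt.mul (hg.contDiffAt (Ioi_mem_nhds hx))
  · refine (contDiffAt_const (c := (0:ℝ))).congr_of_eventuallyEq ?_
    filter_upwards [Iio_mem_nhds (hx.trans_lt ha)] with y hy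
    rw [hz y (le_of_lt hy), zero_mul]

theorem continuous_mul_of_zero_near {χ g : ℝ → ℝ} {a : ℝ} (ha : 0 < a) (hχ : Continuous χ)
    (hz : ∀ x, x ≤ a → χ x = 0) (hg : ContinuousOn g (Ioi 0)) :
    Continuous fun x => χ x * g x := by
  rw [continuous_iff_continuousAt]
  intro x
  rcases lt_or_ge 0 x with hx | hx
  · exact hχ.continuousAt.mul (hg.continuousAt (Ioi_mem_nhds hx))
  · refine (continuousAt_const (y := (0:ℝ))).congr ?_
    filter_upwards [Iio_mem_nhds (hx.trans_lt ha)] with y hy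
    rw [hz y (le_of_lt hy), zero_mul]

section Separated

variable {ρ : ℝ → ℝ} {a b : ℝ} (m : ℤ)

theorem hasCompactSupport_norm_mul_zpow (hz : ∀ x, x ∉ Ioo a b → ρ x = 0) :
    HasCompactSupport fun z : ℂ => (ρ ‖z‖ : ℂ) * z ^ m := by
  refine HasCompactSupport.intro (isCompact_closedBall (0:ℂ) b) fun z hzb => ?_
  rw [hz ‖z‖ fun h => hzb (by simpa using h.2.le)]
  simp

/-- Negative powers are allowed, since ρ vanishes near the origin. -/
theorem contDiff_norm_mul_zpow (ha : 0 < a) (hρ : ContDiff ℝ ∞ ρ)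
    (hz : ∀ x, x ∉ Ioo a b → ρ x = 0) :
    ContDiff ℝ ∞ fun z : ℂ => (ρ ‖z‖ : ℂ) * z ^ m := by
  rw [contDiff_iff_contDiffAt]
  intro z
  by_cases h0 : z = 0
  · subst h0
    refine (contDiffAt_const (c := (0:ℂ))).congr_of_eventuallyEq ?_
    filter_upwards [Metric.ball_mem_nhds (0:ℂ) ha] with y hy
    rw [hz ‖y‖ fun h => by
      have : ‖y‖ < a := by simpa using hy
      linarith [h.1]]
    simp
  · have h1 : ContDiffAt ℝ ∞ (fun z : ℂ => (ρ ‖z‖ : ℂ)) z :=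
      Complex.ofRealCLM.contDiff.contDiffAt.comp z
        (hρ.contDiffAt.comp z (contDiffAt_norm ℝ h0))
    have h2 : ContDiffAt ℂ ∞ (fun z : ℂ => z ^ m) z :=
      (analyticAt_id.zpow (by simpa using h0)).contDiffAt
    exact h1.mul (h2.restrict_scalars ℝ)

theorem continuous_norm_mul_zpow (ha : 0 < a) (hρ : Continuous ρ)
    (hz : ∀ x, x ∉ Ioo a b → ρ x = 0) :
    Continuous fun z : ℂ => (ρ ‖z‖ : ℂ) * z ^ m := by
  rw [continuous_iff_continuousAt]
  intro z
  by_cases h0 : z = 0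
  · subst h0
    refine (continuousAt_const (y := (0:ℂ))).congr ?_
    filter_upwards [Metric.ball_mem_nhds (0:ℂ) ha] with y hy
    rw [hz ‖y‖ fun h => by
      have : ‖y‖ < a := by simpa using hy
      linarith [h.1]]
    simp
  · exact (Complex.continuous_ofReal.comp (hρ.comp continuous_norm)).continuousAt.mul
      (continuousAt_zpow₀ z m (Or.inl h0))

theorem fderiv_norm_mul_zpow (ha : 0 < a) (hρ : ContDiff ℝ ∞ ρ)
    (hz : ∀ x, x ∉ Ioo a b → ρ x = 0) {z : ℂ} (h0 : z ≠ 0) (e : ℂ) :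
    fderiv ℝ (fun z : ℂ => (ρ ‖z‖ : ℂ) * z ^ m) z e
      = ((deriv ρ ‖z‖ * ((conj z * e).re / ‖z‖) : ℝ) : ℂ) * z ^ m
        + (ρ ‖z‖ : ℂ) * (m * z ^ (m - 1) * e) := by
  have hd := ((contDiff_norm_mul_zpow m ha hρ hz).differentiable (by norm_num) z).hasFDerivAt
  have hl : HasDerivAt (fun t : ℝ => z + t * e) e 0 := by
    simpa using ((Complex.ofRealCLM.hasDerivAt (x := (0:ℝ))).mul_const e).const_add z
  have hzl : z + ((0:ℝ) : ℂ) * e = z := by simp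
  have k1 : HasDerivAt (fun t : ℝ => (ρ ‖z + t * e‖ : ℂ) * (z + t * e) ^ m)
      (fderiv ℝ (fun z : ℂ => (ρ ‖z‖ : ℂ) * z ^ m) z e) 0 := by
    refine HasFDerivAt.comp_hasDerivAt (f := fun t : ℝ => z + t * e)
      (l := fun z : ℂ => (ρ ‖z‖ : ℂ) * z ^ m) (0:ℝ) ?_ hl
    rw [hzl]; exact hd
  have hn : ‖z + ((0:ℝ) : ℂ) * e‖ ^ 2 ≠ 0 := by rw [hzl]; simpa using h0
  have k2 : HasDerivAt (fun t : ℝ => ‖z + t * e‖) ((conj z * e).re / ‖z‖) 0 := by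
    have q := (hl.norm_sq).sqrt hn
    simp only [Real.sqrt_sq (norm_nonneg _)] at q
    refine q.congr_deriv ?_
    rw [hzl, Complex.inner]
    field_simp
  have k3 : HasDerivAt (fun t : ℝ => ρ ‖z + t * e‖)
      (deriv ρ ‖z‖ * ((conj z * e).re / ‖z‖)) 0 := by
    refine HasDerivAt.comp (h₂ := ρ) (h := fun t : ℝ => ‖z + t * e‖) (0:ℝ) ?_ k2
    rw [hzl]
    exact (hρ.differentiable (by norm_num) _).hasDerivAt
  have k4 : HasDerivAt (fun t : ℝ => (z + t * e) ^ m) (m * z ^ (m - 1) * e) 0 := by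
    refine HasDerivAt.comp_of_eq (h₂ := fun w : ℂ => w ^ m) (h := fun t : ℝ => z + t * e)
      (0:ℝ) ?_ hl hzl.symm
    exact hasDerivAt_zpow m z (Or.inl h0)
  have k5 := k3.ofReal_comp.mul k4
  have k6 := k1.unique k5
  rw [k6]
  simp

/-- Separation of variables in an integral over the plane. -/
theorem integral_norm_mul_zpow_mul (ha : 0 < a) (hρ : Continuous ρ)
    (hz : ∀ x, x ∉ Ioo a b → ρ x = 0) {F : ℂ → ℂ} (hF : LocallyIntegrable F) :
    ∫ z, (ρ ‖z‖ : ℂ) * z ^ m * F z = 2 * Real.pi * ∫ r in Ioi (0:ℝ),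
      ((r * ρ r * r ^ m : ℝ) : ℂ) * angleCoeff (fun θ => F (polarMap (r, θ))) (-m) := by
  have hi : Integrable fun z => (ρ ‖z‖ : ℂ) * z ^ m * F z :=
    hF.integrable_smul_left_of_hasCompactSupport (continuous_norm_mul_zpow m ha hρ hz)
      (hasCompactSupport_norm_mul_zpow m hz)
  rw [integral_eq_integral_polar hi, integral_radialMeasure, ← integral_const_mul]
  refine setIntegral_congr_fun measurableSet_Ioi fun r hr => ?_
  have hr0 : 0 < r := hr
  have hpi : (Real.pi : ℂ) ≠ 0 := by exact_mod_cast Real.pi_ne_zero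
  have e : ∀ θ : ℝ, (ρ ‖polarMap (r, θ)‖ : ℂ) * polarMap (r, θ) ^ m * F (polarMap (r, θ))
      = ((ρ r * r ^ m : ℝ) : ℂ) * (Complex.exp (-((-m : ℤ) * θ * Complex.I)) * F (polarMap (r, θ))) := by
    intro θ
    rw [norm_polarMap hr0, polarMap]
    simp only
    rw [mul_zpow, ← Complex.exp_int_mul]
    push_cast
    rw [show (-(-(m:ℂ) * θ * Complex.I)) = m * (θ * Complex.I) by ring]
    ring
  simp only [e, angleCoeff]
  rw [integral_const_mul, Complex.real_smul]
  push_cast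
  rw [mul_left_comm (2 * (Real.pi : ℂ)), mul_inv_cancel_left₀ (by simp)]
  ring

end Separated

/-- The weak derivatives are tested with χ(r)r⁻¹e^{-i(n+2)θ} and χ(r)r⁻¹e^{-inθ}, written as
ρ(|z|)z^m; the factor r⁻¹ cancels the area element. These are the weak forms of the radial formulas
for ∂ₓ ± i∂_y on the mode e^{i(n+1)θ}. -/
theorem AnisoGL.HasWeakDirDeriv.angleCoeff_test {v vx vy : ℂ → ℂ} (hx : HasWeakDirDeriv 1 v vx)
    (hy : HasWeakDirDeriv Complex.I v vy) (n : ℤ) {χ : ℝ → ℝ} (hχ : ContDiff ℝ ∞ χ)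
    (hc : HasCompactSupport χ) (hs : tsupport χ ⊆ Ioi 0) :
    (∫ r in Ioi (0:ℝ), ((deriv χ r + (n + 1) * χ r / r : ℝ) : ℂ)
        * angleCoeff (fun θ => v (polarMap (r, θ))) (n + 1)
      = - ∫ r in Ioi (0:ℝ), (χ r : ℂ) * angleCoeff
          (fun θ => vx (polarMap (r, θ)) + Complex.I * vy (polarMap (r, θ))) (n + 2)) ∧
    (∫ r in Ioi (0:ℝ), ((deriv χ r - (n + 1) * χ r / r : ℝ) : ℂ)
        * angleCoeff (fun θ => v (polarMap (r, θ))) (n + 1)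
      = - ∫ r in Ioi (0:ℝ), (χ r : ℂ) * angleCoeff
          (fun θ => vx (polarMap (r, θ)) - Complex.I * vy (polarMap (r, θ))) n) := by
  obtain ⟨a₁, b₁, ha₁, hab₁, hz₁⟩ := exists_Icc_of_tsupport_subset_Ioi hc hs
  obtain ⟨a₂, b₂, ha₂, hab₂, hz₂⟩ := exists_Icc_of_tsupport_subset_Ioi hc.deriv
    ((tsupport_deriv_subset (𝕜 := ℝ)).trans hs)
  set a := min a₁ a₂ with hadef
  set b := max b₁ b₂ with hbdef
  have ha : 0 < a := lt_min ha₁ ha₂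
  have z1 : ∀ x, x ∉ Ioo a b → χ x = 0 := fun x hx => hz₁ x fun hx' =>
    hx ⟨(min_le_left _ _).trans_lt hx'.1, hx'.2.trans_le (le_max_left _ _)⟩
  have z2 : ∀ x, x ∉ Ioo a b → deriv χ x = 0 := fun x hx => hz₂ x fun hx' =>
    hx ⟨(min_le_right _ _).trans_lt hx'.1, hx'.2.trans_le (le_max_right _ _)⟩
  have hdc : Continuous (deriv χ) := hχ.continuous_deriv (by norm_num)
  have hzs : ∀ k : ℤ, ContDiffOn ℝ ∞ (fun r : ℝ => r ^ k) (Ioi 0) := fun k r hr =>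
    ((analyticAt_id (𝕜 := ℝ)).zpow (n := k) (by simpa using ne_of_gt hr)).contDiffAt.contDiffWithinAt
  have hle : ∀ x, x ≤ a → x ∉ Ioo a b := fun x hx h => absurd h.1 (not_lt.2 hx)
  have hρs : ∀ k : ℤ, ContDiff ℝ ∞ fun r => χ r * r ^ k := fun k =>
    contDiff_mul_of_zero_near ha hχ (fun x hx => z1 x (hle x hx)) (hzs k)
  have hρz : ∀ k : ℤ, ∀ x, x ∉ Ioo a b → χ x * x ^ k = 0 := fun k x hx => by
    rw [z1 x hx, zero_mul]
  have hρd : ∀ (k : ℤ) (r : ℝ), 0 < r →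
      deriv (fun r => χ r * r ^ k) r = deriv χ r * r ^ k + χ r * (k * r ^ (k - 1)) := fun k r hr =>
    ((hχ.differentiable (by norm_num) r).hasDerivAt.mul
      (hasDerivAt_zpow k r (Or.inl hr.ne'))).deriv
  have hca : ∀ k : ℤ, Continuous fun r => (deriv χ r) * r ^ k := fun k =>
    continuous_mul_of_zero_near ha hdc (fun x hx => z2 x (hle x hx)) (hzs k).continuousOn
  have hcb : ∀ k : ℤ, Continuous fun r => χ r * r ^ k := fun k => (hρs k).continuous
  have lv := hx.1
  have lx := hx.2.1
  have ly := hy.2.1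
  have lIy : LocallyIntegrable (fun z => Complex.I * vy z) := fun z => by
    obtain ⟨s, hs, hi⟩ := ly z
    exact ⟨s, hs, hi.const_mul _⟩
  have hne : ∀ᵐ z : ℂ, z ≠ 0 := by
    rw [ae_iff]; simp
  constructor
  · set ρ : ℝ → ℝ := fun r => χ r * r ^ (n + 1) with hρ
    set m : ℤ := -(n + 2) with hm
    have hη := contDiff_norm_mul_zpow m ha (hρs (n + 1)) (hρz (n + 1))
    have hηc := hasCompactSupport_norm_mul_zpow m (hρz (n + 1))
    obtain ⟨i1, i2, i3⟩ := hx.complex_test hη hηc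
    obtain ⟨j1, j2, j3⟩ := hy.complex_test hη hηc
    -- ∂ₓ + i∂_y annihilates z^m away from the origin, so only ρ is differentiated and σ = ρ'/r,
    -- with a factor z left over.
    set σ : ℝ → ℝ := fun r => deriv χ r * r ^ n + (n + 1) * (χ r * r ^ (n - 1)) with hσ
    have hσc : Continuous σ := (hca n).add (continuous_const.mul (hcb (n - 1)))
    have hσz : ∀ x, x ∉ Ioo a b → σ x = 0 := fun x hx => by
      simp only [hσ, z1 x hx, z2 x hx]; ring
    have ladd : LocallyIntegrable (fun z => vx z + Complex.I * vy z) := lx.add lIy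
    have E : ∫ z, (σ ‖z‖ : ℂ) * z ^ (m + 1) * v z
        = - ∫ z, (ρ ‖z‖ : ℂ) * z ^ m * (vx z + Complex.I * vy z) := by
      have l1 : ∫ z, (σ ‖z‖ : ℂ) * z ^ (m + 1) * v z
          = (∫ z, fderiv ℝ (fun z : ℂ => (ρ ‖z‖ : ℂ) * z ^ m) z 1 * v z)
            + Complex.I * ∫ z, fderiv ℝ (fun z : ℂ => (ρ ‖z‖ : ℂ) * z ^ m) z Complex.I * v z := by
        rw [← integral_const_mul, ← integral_add i1 (j1.const_mul _)]
        refine integral_congr_ae ?_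
        filter_upwards [hne] with z h0
        have hn0 : 0 < ‖z‖ := norm_pos_iff.2 h0
        have hzz : ((conj z * 1).re : ℂ) + Complex.I * ((conj z * Complex.I).re : ℂ) = z := by
          apply Complex.ext <;> simp
        have hnc : (‖z‖ : ℂ) ≠ 0 := by exact_mod_cast hn0.ne'
        have e1 : (‖z‖ : ℂ) ^ (n + 1) = ‖z‖ ^ n * ‖z‖ := zpow_add_one₀ hnc n
        have e2 : (‖z‖ : ℂ) ^ n = ‖z‖ ^ (n - 1) * ‖z‖ := by
          rw [← zpow_add_one₀ hnc, sub_add_cancel]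
        have e3 : z ^ (m + 1) = z ^ m * z := zpow_add_one₀ h0 m
        set D : ℂ := ((deriv χ ‖z‖ : ℝ) : ℂ) * (‖z‖ : ℂ) ^ (n + 1)
          + (χ ‖z‖ : ℂ) * ((n + 1) * (‖z‖ : ℂ) ^ n) with hD
        have t1 : (σ ‖z‖ : ℂ) = D / ‖z‖ := by
          rw [eq_div_iff hnc]
          simp only [hσ, hD]
          push_cast
          rw [e1, e2]
          ring
        have t2 : (((deriv χ ‖z‖ * ‖z‖ ^ (n + 1) + χ ‖z‖ * (((n + 1 : ℤ) : ℝ)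
            * ‖z‖ ^ (n + 1 - 1)) : ℝ)) : ℂ) = D := by
          simp only [hD, add_sub_cancel_right]; push_cast; ring
        have hfd : ∀ e : ℂ, fderiv ℝ (fun z : ℂ => (ρ ‖z‖ : ℂ) * z ^ m) z e
            = D * (((conj z * e).re : ℂ) / ‖z‖) * z ^ m
              + (χ ‖z‖ : ℂ) * (‖z‖ : ℂ) ^ (n + 1) * (m * z ^ (m - 1) * e) := fun e => by
          rw [fderiv_norm_mul_zpow m ha (hρs (n + 1)) (hρz (n + 1)) h0, hρd (n + 1) _ hn0,
            Complex.ofReal_mul, t2]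
          push_cast
          rfl
        rw [hfd, hfd, t1, e3]
        have t3 : D * (((conj z * 1).re : ℂ) / ‖z‖) * z ^ m
            + Complex.I * (D * (((conj z * Complex.I).re : ℂ) / ‖z‖) * z ^ m)
            = D / ‖z‖ * (z ^ m * z) := by
          calc _ = D / ‖z‖ * z ^ m * (((conj z * 1).re : ℂ)
                + Complex.I * ((conj z * Complex.I).re : ℂ)) := by ring
            _ = _ := by rw [hzz]; ring
        linear_combination (-v z) * t3
          - (v z * (χ ‖z‖ * ‖z‖ ^ (n + 1)) * m * z ^ (m - 1)) * Complex.I_sq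
      have l2 : ∫ z, (ρ ‖z‖ : ℂ) * z ^ m * (vx z + Complex.I * vy z)
          = (∫ z, (ρ ‖z‖ : ℂ) * z ^ m * vx z) + Complex.I * ∫ z, (ρ ‖z‖ : ℂ) * z ^ m * vy z := by
        rw [← integral_const_mul, ← integral_add i2 (j2.const_mul _)]
        congr 1; ext z; ring
      rw [l1, l2, i3, j3]; ring
    rw [integral_norm_mul_zpow_mul (m + 1) ha hσc hσz lv,
      integral_norm_mul_zpow_mul m ha (hcb (n + 1) : Continuous ρ) (hρz (n + 1)) ladd, ← mul_neg] at E
    have E2 := mul_left_cancel₀ (by simp) E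
    rw [show -(m + 1) = n + 1 by omega, show -m = n + 2 by omega] at E2
    convert E2 using 1
    · refine setIntegral_congr_fun measurableSet_Ioi fun r hr => ?_
      have hr0 : r ≠ 0 := ne_of_gt hr
      simp only [hσ]
      congr 2
      rw [show m + 1 = -(n + 1) by omega, zpow_neg, zpow_add_one₀ hr0, zpow_sub_one₀ hr0]
      field_simp
    · congr 1
      refine setIntegral_congr_fun measurableSet_Ioi fun r hr => ?_
      have hr0 : r ≠ 0 := ne_of_gt hr
      congr 2
      rw [show m = -(n + 1 + 1) by omega, zpow_neg, zpow_add_one₀ hr0 (n + 1)]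
      field_simp
  · set ρ : ℝ → ℝ := fun r => χ r * r ^ (n - 1) with hρ
    set m : ℤ := -n with hm
    have hη := contDiff_norm_mul_zpow m ha (hρs (n - 1)) (hρz (n - 1))
    have hηc := hasCompactSupport_norm_mul_zpow m (hρz (n - 1))
    obtain ⟨i1, i2, i3⟩ := hx.complex_test hη hηc
    obtain ⟨j1, j2, j3⟩ := hy.complex_test hη hηc
    -- For ∂ₓ - i∂_y both factors contribute: σ = rρ' + 2mρ with m = -n, multiplying z^{m-1}.
    set σ : ℝ → ℝ := fun r => deriv χ r * r ^ n - (n + 1) * (χ r * r ^ (n - 1)) with hσ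
    have hσc : Continuous σ := (hca n).sub (continuous_const.mul (hcb (n - 1)))
    have hσz : ∀ x, x ∉ Ioo a b → σ x = 0 := fun x hx => by
      simp only [hσ, z1 x hx, z2 x hx]; ring
    have lsub : LocallyIntegrable (fun z => vx z - Complex.I * vy z) := lx.sub lIy
    have E : ∫ z, (σ ‖z‖ : ℂ) * z ^ (m - 1) * v z
        = - ∫ z, (ρ ‖z‖ : ℂ) * z ^ m * (vx z - Complex.I * vy z) := by
      have l1 : ∫ z, (σ ‖z‖ : ℂ) * z ^ (m - 1) * v z
          = (∫ z, fderiv ℝ (fun z : ℂ => (ρ ‖z‖ : ℂ) * z ^ m) z 1 * v z)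
            - Complex.I * ∫ z, fderiv ℝ (fun z : ℂ => (ρ ‖z‖ : ℂ) * z ^ m) z Complex.I * v z := by
        rw [← integral_const_mul, ← integral_sub i1 (j1.const_mul _)]
        refine integral_congr_ae ?_
        filter_upwards [hne] with z h0
        have hn0 : 0 < ‖z‖ := norm_pos_iff.2 h0
        have hzz : ((conj z * 1).re : ℂ) - Complex.I * ((conj z * Complex.I).re : ℂ) = conj z := by
          apply Complex.ext <;> simp
        have hcz : conj z * z = (‖z‖ : ℂ) ^ 2 := Complex.conj_mul' z
        have hnc : (‖z‖ : ℂ) ≠ 0 := by exact_mod_cast hn0.ne'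
        have e1 : (‖z‖ : ℂ) ^ n = ‖z‖ ^ (n - 1) * ‖z‖ := by
          rw [← zpow_add_one₀ hnc, sub_add_cancel]
        have e2 : (‖z‖ : ℂ) ^ (n - 1) = ‖z‖ ^ (n - 1 - 1) * ‖z‖ := by
          rw [← zpow_add_one₀ hnc, sub_add_cancel]
        have e3 : z ^ m = z ^ (m - 1) * z := by rw [← zpow_add_one₀ h0, sub_add_cancel]
        have hmn : (m : ℂ) = -n := by rw [hm]; push_cast; ring
        set D : ℂ := ((deriv χ ‖z‖ : ℝ) : ℂ) * (‖z‖ : ℂ) ^ (n - 1)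
          + (χ ‖z‖ : ℂ) * ((n - 1) * (‖z‖ : ℂ) ^ (n - 1 - 1)) with hD
        have t1 : (σ ‖z‖ : ℂ) = ‖z‖ * D + 2 * m * ((χ ‖z‖ : ℂ) * (‖z‖ : ℂ) ^ (n - 1)) := by
          simp only [hσ, hD, hmn]
          push_cast
          rw [e1, e2]
          ring
        have t2 : (((deriv χ ‖z‖ * ‖z‖ ^ (n - 1) + χ ‖z‖ * (((n - 1 : ℤ) : ℝ)
            * ‖z‖ ^ (n - 1 - 1)) : ℝ)) : ℂ) = D := by
          simp only [hD]; push_cast; ring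
        have hfd : ∀ e : ℂ, fderiv ℝ (fun z : ℂ => (ρ ‖z‖ : ℂ) * z ^ m) z e
            = D * (((conj z * e).re : ℂ) / ‖z‖) * z ^ m
              + (χ ‖z‖ : ℂ) * (‖z‖ : ℂ) ^ (n - 1) * (m * z ^ (m - 1) * e) := fun e => by
          rw [fderiv_norm_mul_zpow m ha (hρs (n - 1)) (hρz (n - 1)) h0, hρd (n - 1) _ hn0,
            Complex.ofReal_mul, t2]
          push_cast
          rfl
        rw [hfd, hfd, t1, e3]
        have t3 : D * (((conj z * 1).re : ℂ) / ‖z‖) * (z ^ (m - 1) * z)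
            - Complex.I * (D * (((conj z * Complex.I).re : ℂ) / ‖z‖) * (z ^ (m - 1) * z))
            = ‖z‖ * D * z ^ (m - 1) := by
          calc _ = D / ‖z‖ * z ^ (m - 1) * ((((conj z * 1).re : ℂ)
                - Complex.I * ((conj z * Complex.I).re : ℂ)) * z) := by ring
            _ = _ := by rw [hzz, hcz]; field_simp
        linear_combination (-v z) * t3
          + (v z * (χ ‖z‖ * ‖z‖ ^ (n - 1)) * m * z ^ (m - 1)) * Complex.I_sq
      have l2 : ∫ z, (ρ ‖z‖ : ℂ) * z ^ m * (vx z - Complex.I * vy z)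
          = (∫ z, (ρ ‖z‖ : ℂ) * z ^ m * vx z) - Complex.I * ∫ z, (ρ ‖z‖ : ℂ) * z ^ m * vy z := by
        rw [← integral_const_mul, ← integral_sub i2 (j2.const_mul _)]
        congr 1; ext z; ring
      rw [l1, l2, i3, j3]; ring
    rw [integral_norm_mul_zpow_mul (m - 1) ha hσc hσz lv,
      integral_norm_mul_zpow_mul m ha (hcb (n - 1) : Continuous ρ) (hρz (n - 1)) lsub, ← mul_neg] at E
    have E2 := mul_left_cancel₀ (by simp) E
    rw [show -(m - 1) = n + 1 by omega, show -m = n by omega] at E2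
    convert E2 using 1
    · refine setIntegral_congr_fun measurableSet_Ioi fun r hr => ?_
      have hr0 : r ≠ 0 := ne_of_gt hr
      simp only [hσ]
      congr 2
      rw [show m - 1 = -(n + 1) by omega, zpow_neg, zpow_add_one₀ hr0, zpow_sub_one₀ hr0]
      field_simp
    · congr 1
      refine setIntegral_congr_fun measurableSet_Ioi fun r hr => ?_
      have hr0 : r ≠ 0 := ne_of_gt hr
      congr 2
      rw [show m = -n by omega, zpow_neg, zpow_sub_one₀ hr0]
      field_simp

/-! ### The Fourier modes of an element of the energy space -/

theorem hasSum_sq_angleCoeff_re {g : ℝ → ℂ} (hg : MemLp g 2 angleMeasure) :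
    HasSum (fun n : ℤ => ‖(angleCoeff g n + conj (angleCoeff g (-n))) / 2‖ ^ 2)
      (angleMean fun θ => (g θ).re ^ 2) := by
  have hm : MemLp (fun θ => ((g θ).re : ℂ)) 2 angleMeasure :=
    hg.of_le (Complex.continuous_ofReal.comp_aestronglyMeasurable
      (Complex.continuous_re.comp_aestronglyMeasurable hg.1))
      (Eventually.of_forall fun θ => by
        rw [Complex.norm_real]; exact Complex.abs_re_le_norm _)
  have := hasSum_sq_angleCoeff hm
  simp only [angleCoeff_re (hg.integrable one_le_two), Complex.norm_real, Real.norm_eq_abs,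
    sq_abs] at this
  exact this

theorem integrableOn_test_mul {w : ℝ → ℂ} (hw : LocallyIntegrableOn w (Ioi 0)) {χ : ℝ → ℝ}
    (hχ : Continuous χ) (hc : HasCompactSupport χ) (hs : tsupport χ ⊆ Ioi 0) :
    IntegrableOn (fun r => (χ r : ℂ) * w r) (Ioi 0) := by
  have h1 : IntegrableOn w (tsupport χ) := hw.integrableOn_compact_subset hs hc
  have h2 : IntegrableOn (fun r => (χ r : ℂ) * w r) (tsupport χ) :=
    h1.continuousOn_mul (Complex.continuous_ofReal.comp hχ).continuousOn hc
  refine h2.of_forall_sdiff_eq_zero measurableSet_Ioi fun x hx => ?_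
  rw [image_eq_zero_of_notMem_tsupport hx.2]; simp

/-- The weight is bounded away from zero on compact subsets, and |g| ≤ |g|² + 1. -/
theorem locallyIntegrableOn_of_weighted_sq {g : ℝ → ℂ}
    (hg : AEStronglyMeasurable g (volume.restrict (Ioi (0:ℝ)))) {h : ℝ → ℝ}
    (hh : ContinuousOn h (Ioi 0)) (hpos : ∀ r, 0 < r → 0 < h r)
    (hi : IntegrableOn (fun r => ‖g r‖ ^ 2 * h r) (Ioi 0)) :
    LocallyIntegrableOn (fun r => ‖g r‖ ^ 2) (Ioi 0) ∧ LocallyIntegrableOn g (Ioi 0) := by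
  have h1 : LocallyIntegrableOn (fun r => ‖g r‖ ^ 2) (Ioi 0) := by
    have h2 := hi.locallyIntegrableOn.mul_continuousOn
      (hh.inv₀ fun x hx => (hpos x hx).ne') isOpen_Ioi.isLocallyClosed
    intro x hx
    obtain ⟨s, hs, hsi⟩ := h2 x hx
    refine ⟨s ∩ Ioi 0, inter_mem hs self_mem_nhdsWithin,
      (hsi.mono_set inter_subset_left).congr_fun_ae ?_⟩
    filter_upwards [ae_mono (Measure.restrict_mono inter_subset_right le_rfl)
      (ae_restrict_mem (measurableSet_Ioi (a := (0:ℝ))))] with r hr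
    simp only [Pi.inv_apply]
    rw [mul_assoc, mul_inv_cancel₀ (hpos r hr).ne', mul_one]
  refine ⟨h1, fun x hx => ?_⟩
  obtain ⟨s, hs, hsi⟩ := (h1.add ((locallyIntegrable_const (1:ℝ)).locallyIntegrableOn _)) x hx
  refine ⟨s ∩ Ioi 0, inter_mem hs self_mem_nhdsWithin, ?_⟩
  refine Integrable.mono' (hsi.mono_set inter_subset_left)
    (hg.mono_measure (Measure.restrict_mono inter_subset_right le_rfl))
    (Eventually.of_forall fun r => ?_)
  simp only [Pi.add_apply]
  nlinarith [sq_nonneg (‖g r‖ - 1), norm_nonneg (g r)]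

/-- The coefficient of `e^{i(n+1)θ}` in `v`. -/
noncomputable def valueMode (v : ℂ → ℂ) (n : ℤ) (r : ℝ) : ℂ :=
  angleCoeff (fun θ => v (polarMap (r, θ))) (n + 1)

/-- The coefficient of `e^{inθ}` in `∂ₓ v - i ∂_y v`. -/
noncomputable def holMode (vx vy : ℂ → ℂ) (n : ℤ) (r : ℝ) : ℂ :=
  angleCoeff (fun θ => vx (polarMap (r, θ)) - Complex.I * vy (polarMap (r, θ))) n

/-- The coefficient of `e^{i(n+2)θ}` in `∂ₓ v + i ∂_y v`. -/
noncomputable def antiholMode (vx vy : ℂ → ℂ) (n : ℤ) (r : ℝ) : ℂ :=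
  angleCoeff (fun θ => vx (polarMap (r, θ)) + Complex.I * vy (polarMap (r, θ))) (n + 2)

/-- The radial derivative of the coefficient of `e^{i(n+1)θ}` in `v`. -/
noncomputable def derivMode (vx vy : ℂ → ℂ) (n : ℤ) (r : ℝ) : ℂ :=
  (holMode vx vy n r + antiholMode vx vy n r) / 2

theorem measurable_eiTheta : Measurable eiTheta := by
  unfold eiTheta
  exact measurable_id.div (Complex.measurable_ofReal.comp measurable_norm)

theorem eiTheta_polarMap {r : ℝ} (hr : 0 < r) (θ : ℝ) :
    eiTheta (polarMap (r, θ)) = Complex.exp (θ * Complex.I) := by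
  have : (r : ℂ) ≠ 0 := by exact_mod_cast hr.ne'
  rw [eiTheta, norm_polarMap hr, polarMap]
  field_simp

theorem norm_sub_I_mul_sq_add (x y : ℂ) :
    ‖x - Complex.I * y‖ ^ 2 + ‖x + Complex.I * y‖ ^ 2 = 2 * (‖x‖ ^ 2 + ‖y‖ ^ 2) := by
  simp only [Complex.sq_norm, Complex.normSq_apply, Complex.add_re, Complex.add_im, Complex.sub_re,
    Complex.sub_im, Complex.mul_re, Complex.mul_im, Complex.I_re, Complex.I_im]
  ring

theorem sq_norm_half_add_le (x y : ℂ) : ‖(x + y) / 2‖ ^ 2 ≤ (‖x‖ ^ 2 + ‖y‖ ^ 2) / 2 := by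
  rw [norm_div, Complex.norm_ofNat, div_pow]
  nlinarith [norm_add_le x y, norm_nonneg (x + y), sq_nonneg (‖x‖ - ‖y‖)]

namespace AnisoGL.MemEnergySpace

variable {v vx vy : ℂ → ℂ} (h : MemEnergySpace v vx vy)
include h

theorem aesm : AEStronglyMeasurable v volume := h.weak_x.1.aestronglyMeasurable

theorem aesm_x : AEStronglyMeasurable vx volume := h.weak_x.2.1.aestronglyMeasurable

theorem aesm_y : AEStronglyMeasurable vy volume := h.weak_y.2.1.aestronglyMeasurable

theorem aesm_hol : AEStronglyMeasurable (fun z => vx z - Complex.I * vy z) volume :=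
  h.aesm_x.sub (h.aesm_y.const_mul _)

theorem aesm_antihol : AEStronglyMeasurable (fun z => vx z + Complex.I * vy z) volume :=
  h.aesm_x.add (h.aesm_y.const_mul _)

theorem aesm_dot : AEStronglyMeasurable (fun z => dot (eiTheta z) (v z)) volume := by
  unfold AnisoGL.dot
  exact Complex.continuous_re.comp_aestronglyMeasurable
    (measurable_eiTheta.aestronglyMeasurable.mul
      (Complex.continuous_conj.comp_aestronglyMeasurable h.aesm))

theorem integrable_hol_sq : Integrable fun z => ‖vx z - Complex.I * vy z‖ ^ 2 := by
  refine (h.energy.const_mul 2).mono' (h.aesm_hol.norm.pow 2) (Eventually.of_forall fun z => ?_)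
  have e := norm_sub_I_mul_sq_add (vx z) (vy z)
  have : 0 ≤ ‖v z‖ ^ 2 / ‖z‖ ^ 2 := by positivity
  rw [Real.norm_of_nonneg (by positivity)]
  nlinarith [sq_nonneg (dot (eiTheta z) (v z)), sq_nonneg ‖vx z + Complex.I * vy z‖]

theorem integrable_antihol_sq : Integrable fun z => ‖vx z + Complex.I * vy z‖ ^ 2 := by
  refine (h.energy.const_mul 2).mono' (h.aesm_antihol.norm.pow 2) (Eventually.of_forall fun z => ?_)
  have e := norm_sub_I_mul_sq_add (vx z) (vy z)
  have : 0 ≤ ‖v z‖ ^ 2 / ‖z‖ ^ 2 := by positivity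
  rw [Real.norm_of_nonneg (by positivity)]
  nlinarith [sq_nonneg (dot (eiTheta z) (v z)), sq_nonneg ‖vx z - Complex.I * vy z‖]

theorem integrable_dot_sq : Integrable fun z => dot (eiTheta z) (v z) ^ 2 := by
  refine h.energy.mono' (h.aesm_dot.pow 2) (Eventually.of_forall fun z => ?_)
  have : 0 ≤ ‖v z‖ ^ 2 / ‖z‖ ^ 2 := by positivity
  rw [Real.norm_of_nonneg (by positivity)]
  nlinarith [sq_nonneg ‖vx z‖, sq_nonneg ‖vy z‖]

theorem integrable_sq_weight : Integrable fun z => ‖v z‖ ^ 2 * (‖z‖ ^ 2)⁻¹ := by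
  refine h.energy.mono' ?_ (Eventually.of_forall fun z => ?_)
  · exact (h.aesm.norm.pow 2).mul
      ((measurable_norm.pow_const 2).inv.aestronglyMeasurable)
  · rw [Real.norm_of_nonneg (by positivity), ← div_eq_mul_inv]
    nlinarith [sq_nonneg ‖vx z‖, sq_nonneg ‖vy z‖, sq_nonneg (dot (eiTheta z) (v z))]

theorem ae_memLp : ∀ᵐ r ∂radialMeasure, MemLp (fun θ => v (polarMap (r, θ))) 2 angleMeasure :=
  ae_memLp_slice h.aesm (wt := fun r => (r ^ 2)⁻¹) (fun r hr => by positivity)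
    h.integrable_sq_weight

theorem ae_memLp_hol : ∀ᵐ r ∂radialMeasure, MemLp
    (fun θ => vx (polarMap (r, θ)) - Complex.I * vy (polarMap (r, θ))) 2 angleMeasure := by
  have hi : Integrable fun z : ℂ => ‖(fun z => vx z - Complex.I * vy z) z‖ ^ 2
      * (fun _ => 1 : ℝ → ℝ) ‖z‖ := by
    simpa only [mul_one] using h.integrable_hol_sq
  have := ae_memLp_slice h.aesm_hol (fun _ _ => one_ne_zero) hi
  exact this

theorem ae_memLp_antihol : ∀ᵐ r ∂radialMeasure, MemLp
    (fun θ => vx (polarMap (r, θ)) + Complex.I * vy (polarMap (r, θ))) 2 angleMeasure := by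
  have hi : Integrable fun z : ℂ => ‖(fun z => vx z + Complex.I * vy z) z‖ ^ 2
      * (fun _ => 1 : ℝ → ℝ) ‖z‖ := by
    simpa only [mul_one] using h.integrable_antihol_sq
  have := ae_memLp_slice h.aesm_antihol (fun _ _ => one_ne_zero) hi
  exact this

theorem ae_hasSum_value : ∀ᵐ r ∂radialMeasure, HasSum (fun n : ℤ => ‖valueMode v n r‖ ^ 2)
    (r ^ 2 * angleMean fun θ => ‖v (polarMap (r, θ))‖ ^ 2 * (‖polarMap (r, θ)‖ ^ 2)⁻¹) := by
  filter_upwards [h.ae_memLp, ae_radialMeasure_pos] with r hr hr0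
  have e := (Equiv.addRight (1:ℤ)).hasSum_iff.2 (hasSum_sq_angleCoeff hr)
  have e2 : (r ^ 2 * angleMean fun θ => ‖v (polarMap (r, θ))‖ ^ 2 * (‖polarMap (r, θ)‖ ^ 2)⁻¹)
      = angleMean fun θ => ‖v (polarMap (r, θ))‖ ^ 2 := by
    simp only [norm_polarMap hr0, angleMean]
    rw [integral_mul_const]
    field_simp
  rw [e2]
  exact e

theorem ae_hasSum_hol : ∀ᵐ r ∂radialMeasure, HasSum (fun n : ℤ => ‖holMode vx vy n r‖ ^ 2)
    (angleMean fun θ => ‖vx (polarMap (r, θ)) - Complex.I * vy (polarMap (r, θ))‖ ^ 2) := by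
  filter_upwards [h.ae_memLp_hol] with r hr using hasSum_sq_angleCoeff hr

theorem ae_hasSum_antihol : ∀ᵐ r ∂radialMeasure, HasSum (fun n : ℤ => ‖antiholMode vx vy n r‖ ^ 2)
    (angleMean fun θ => ‖vx (polarMap (r, θ)) + Complex.I * vy (polarMap (r, θ))‖ ^ 2) := by
  filter_upwards [h.ae_memLp_antihol] with r hr
  exact (Equiv.addRight (2:ℤ)).hasSum_iff.2 (hasSum_sq_angleCoeff hr)

theorem ae_hasSum_hol_re : ∀ᵐ r ∂radialMeasure,
    HasSum (fun n : ℤ => ‖(holMode vx vy n r + conj (holMode vx vy (-n) r)) / 2‖ ^ 2)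
    (angleMean fun θ => (vx (polarMap (r, θ)) - Complex.I * vy (polarMap (r, θ))).re ^ 2) := by
  filter_upwards [h.ae_memLp_hol] with r hr using hasSum_sq_angleCoeff_re hr

theorem ae_hasSum_dot : ∀ᵐ r ∂radialMeasure,
    HasSum (fun n : ℤ => ‖(valueMode v n r + conj (valueMode v (-n) r)) / 2‖ ^ 2)
    (angleMean fun θ => dot (eiTheta (polarMap (r, θ))) (v (polarMap (r, θ))) ^ 2) := by
  filter_upwards [h.ae_memLp, ae_radialMeasure_pos] with r hr hr0
  set g : ℝ → ℂ := fun θ => Complex.exp (-((1:ℤ) * θ * Complex.I)) * v (polarMap (r, θ)) with hg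
  have hgm : MemLp g 2 angleMeasure := by
    refine hr.of_le ?_ (Eventually.of_forall fun θ => ?_)
    · exact ((by fun_prop : Continuous fun θ : ℝ =>
        Complex.exp (-(((1:ℤ):ℂ) * θ * Complex.I))).aestronglyMeasurable).mul hr.1
    · rw [hg]
      simp only
      rw [norm_mul, norm_exp_neg_int_mul, one_mul]
  have e := hasSum_sq_angleCoeff_re hgm
  simp only [hg, angleCoeff_exp_mul] at e
  have e2 : ∀ θ : ℝ, (Complex.exp (-((1:ℤ) * θ * Complex.I)) * v (polarMap (r, θ))).re
      = dot (eiTheta (polarMap (r, θ))) (v (polarMap (r, θ))) := fun θ => by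
    rw [eiTheta_polarMap hr0, dot, ← Complex.conj_re, map_mul, ← Complex.exp_conj]
    simp
  simp only [e2] at e
  exact e

theorem integrableOn_hol_sq (n : ℤ) : IntegrableOn (fun r => ‖holMode vx vy n r‖ ^ 2 * r) (Ioi 0) := by
  have h1 := integrable_radialMeasure_iff.1 (integrable_angleMean h.integrable_hol_sq)
  have hm := aestronglyMeasurable_radialMeasure_iff.1 (aestronglyMeasurable_angleCoeff h.aesm_hol n)
  refine h1.mono' ((hm.norm.pow 2).mul measurable_id.aestronglyMeasurable) ?_
  filter_upwards [ae_radialMeasure_iff.1 h.ae_hasSum_hol, ae_restrict_mem measurableSet_Ioi]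
    with r hr hr0
  have hr1 : 0 < r := hr0
  rw [Real.norm_of_nonneg (by positivity), mul_comm, smul_eq_mul]
  gcongr
  exact le_hasSum hr n fun j _ => by positivity

theorem integrableOn_antihol_sq (n : ℤ) :
    IntegrableOn (fun r => ‖antiholMode vx vy n r‖ ^ 2 * r) (Ioi 0) := by
  have h1 := integrable_radialMeasure_iff.1 (integrable_angleMean h.integrable_antihol_sq)
  have hm := aestronglyMeasurable_radialMeasure_iff.1
    (aestronglyMeasurable_angleCoeff h.aesm_antihol (n + 2))
  refine h1.mono' ((hm.norm.pow 2).mul measurable_id.aestronglyMeasurable) ?_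
  filter_upwards [ae_radialMeasure_iff.1 h.ae_hasSum_antihol, ae_restrict_mem measurableSet_Ioi]
    with r hr hr0
  have hr1 : 0 < r := hr0
  rw [Real.norm_of_nonneg (by positivity), mul_comm, smul_eq_mul]
  gcongr
  exact le_hasSum hr n fun j _ => by positivity

theorem integrableOn_value_sq (n : ℤ) :
    IntegrableOn (fun r => ‖valueMode v n r‖ ^ 2 * r⁻¹) (Ioi 0) := by
  have h1 := integrable_radialMeasure_iff.1 (integrable_angleMean h.integrable_sq_weight)
  have hm := aestronglyMeasurable_radialMeasure_iff.1
    (aestronglyMeasurable_angleCoeff h.aesm (n + 1))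
  refine h1.mono' ((hm.norm.pow 2).mul measurable_inv.aestronglyMeasurable) ?_
  filter_upwards [ae_radialMeasure_iff.1 h.ae_hasSum_value, ae_restrict_mem measurableSet_Ioi]
    with r hr hr0
  have hr1 : 0 < r := hr0
  have := le_hasSum hr n fun j _ => by positivity
  rw [Real.norm_of_nonneg (by positivity), smul_eq_mul]
  calc ‖valueMode v n r‖ ^ 2 * r⁻¹ ≤ (r ^ 2 * angleMean fun θ =>
        ‖v (polarMap (r, θ))‖ ^ 2 * (‖polarMap (r, θ)‖ ^ 2)⁻¹) * r⁻¹ := by gcongr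
    _ = _ := by field_simp

theorem locInt_hol (n : ℤ) : LocallyIntegrableOn (fun r => ‖holMode vx vy n r‖ ^ 2) (Ioi 0) ∧
    LocallyIntegrableOn (holMode vx vy n) (Ioi 0) :=
  locallyIntegrableOn_of_weighted_sq
    (aestronglyMeasurable_radialMeasure_iff.1 (aestronglyMeasurable_angleCoeff h.aesm_hol n))
    continuousOn_id (fun _ hr => hr) (h.integrableOn_hol_sq n)

theorem locInt_antihol (n : ℤ) :
    LocallyIntegrableOn (fun r => ‖antiholMode vx vy n r‖ ^ 2) (Ioi 0) ∧
    LocallyIntegrableOn (antiholMode vx vy n) (Ioi 0) :=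
  locallyIntegrableOn_of_weighted_sq (aestronglyMeasurable_radialMeasure_iff.1
    (aestronglyMeasurable_angleCoeff h.aesm_antihol (n + 2)))
    continuousOn_id (fun _ hr => hr) (h.integrableOn_antihol_sq n)

theorem locInt_value (n : ℤ) : LocallyIntegrableOn (fun r => ‖valueMode v n r‖ ^ 2) (Ioi 0) ∧
    LocallyIntegrableOn (valueMode v n) (Ioi 0) :=
  locallyIntegrableOn_of_weighted_sq (aestronglyMeasurable_radialMeasure_iff.1
    (aestronglyMeasurable_angleCoeff h.aesm (n + 1)))
    (continuousOn_inv₀.mono fun _ hx => ne_of_gt hx) (fun _ hr => inv_pos.2 hr)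
    (h.integrableOn_value_sq n)

/-- The Fourier modes of `v` tested against a function of the radius. -/
theorem mode_test (n : ℤ) {χ : ℝ → ℝ} (hχ : ContDiff ℝ ∞ χ) (hc : HasCompactSupport χ)
    (hs : tsupport χ ⊆ Ioi 0) :
    (∫ r in Ioi (0:ℝ), ((deriv χ r : ℝ) : ℂ) * valueMode v n r
      = - ∫ r in Ioi (0:ℝ), (χ r : ℂ) * derivMode vx vy n r) ∧
    ∫ r in Ioi (0:ℝ), (χ r : ℂ) * (holMode vx vy n r - antiholMode vx vy n r
      - (2 * (n + 1) * r⁻¹ : ℝ) * valueMode v n r) = 0 := by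
  obtain ⟨e1, e2⟩ := h.weak_x.angleCoeff_test h.weak_y n hχ hc hs
  have hdc : Continuous (deriv χ) := hχ.continuous_deriv (by norm_num)
  have hds : tsupport (deriv χ) ⊆ Ioi 0 := (tsupport_deriv_subset (𝕜 := ℝ)).trans hs
  have i1 := integrableOn_test_mul (h.locInt_value n).2 hdc hc.deriv hds
  have hlv : LocallyIntegrableOn (fun r => ((r⁻¹ : ℝ) : ℂ) * valueMode v n r) (Ioi 0) :=
    (h.locInt_value n).2.continuousOn_mul (Complex.continuous_ofReal.comp_continuousOn
      (continuousOn_inv₀.mono fun _ hx => ne_of_gt hx)) isOpen_Ioi.isLocallyClosed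
  have i2 := integrableOn_test_mul hlv hχ.continuous hc hs
  have i3 := integrableOn_test_mul (h.locInt_hol n).2 hχ.continuous hc hs
  have i4 := integrableOn_test_mul (h.locInt_antihol n).2 hχ.continuous hc hs
  have k1 : ∫ r in Ioi (0:ℝ), ((deriv χ r + (n + 1) * χ r / r : ℝ) : ℂ) * valueMode v n r
      = (∫ r in Ioi (0:ℝ), ((deriv χ r : ℝ) : ℂ) * valueMode v n r)
        + (n + 1) * ∫ r in Ioi (0:ℝ), (χ r : ℂ) * (((r⁻¹ : ℝ) : ℂ) * valueMode v n r) := by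
    rw [← integral_const_mul, ← integral_add i1 (i2.const_mul _)]
    refine integral_congr_ae (Eventually.of_forall fun r => ?_)
    simp only
    push_cast
    ring
  have k2 : ∫ r in Ioi (0:ℝ), ((deriv χ r - (n + 1) * χ r / r : ℝ) : ℂ) * valueMode v n r
      = (∫ r in Ioi (0:ℝ), ((deriv χ r : ℝ) : ℂ) * valueMode v n r)
        - (n + 1) * ∫ r in Ioi (0:ℝ), (χ r : ℂ) * (((r⁻¹ : ℝ) : ℂ) * valueMode v n r) := by
    rw [← integral_const_mul, ← integral_sub i1 (i2.const_mul _)]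
    refine integral_congr_ae (Eventually.of_forall fun r => ?_)
    simp only
    push_cast
    ring
  -- Half the sum of E1 and E2 isolates the radial derivative; their difference isolates the term
  -- with 1/r.
  have E1 := k1.symm.trans e1
  have E2 := k2.symm.trans e2
  change _ = - ∫ r in Ioi (0:ℝ), (χ r : ℂ) * antiholMode vx vy n r at E1
  change _ = - ∫ r in Ioi (0:ℝ), (χ r : ℂ) * holMode vx vy n r at E2
  have k3 : ∫ r in Ioi (0:ℝ), (χ r : ℂ) * derivMode vx vy n r
      = ((∫ r in Ioi (0:ℝ), (χ r : ℂ) * holMode vx vy n r)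
        + ∫ r in Ioi (0:ℝ), (χ r : ℂ) * antiholMode vx vy n r) * (1 / 2) := by
    rw [← integral_add i3 i4, ← integral_mul_const]
    refine integral_congr_ae (Eventually.of_forall fun r => ?_)
    simp only [derivMode]
    ring
  have k4 : ∫ r in Ioi (0:ℝ), (χ r : ℂ) * (holMode vx vy n r - antiholMode vx vy n r
      - (2 * (n + 1) * r⁻¹ : ℝ) * valueMode v n r)
      = (∫ r in Ioi (0:ℝ), (χ r : ℂ) * holMode vx vy n r)
        - (∫ r in Ioi (0:ℝ), (χ r : ℂ) * antiholMode vx vy n r)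
        - 2 * (n + 1) * ∫ r in Ioi (0:ℝ), (χ r : ℂ) * (((r⁻¹ : ℝ) : ℂ) * valueMode v n r) := by
    have i34 : IntegrableOn (fun r => (χ r : ℂ) * holMode vx vy n r
      - (χ r : ℂ) * antiholMode vx vy n r) (Ioi 0) := i3.sub i4
    rw [← integral_const_mul, ← integral_sub i3 i4, ← integral_sub i34 (i2.const_mul _)]
    refine integral_congr_ae (Eventually.of_forall fun r => ?_)
    simp only
    push_cast
    ring
  constructor
  · rw [k3]
    linear_combination (1 / 2 : ℂ) * E1 + (1 / 2 : ℂ) * E2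
  · rw [k4]
    linear_combination E2 - E1

/-- Since ∂ₓ ∓ i∂_y = e^{∓iθ}(∂_r ∓ (i/r)∂_θ), the two operators send the mode φe^{i(n+1)θ} to the
coefficients φ' ± (1+n)φ/r. The angular part thus becomes a pointwise relation. -/
theorem ae_hol_sub_antihol (n : ℤ) : ∀ᵐ r ∂radialMeasure,
    holMode vx vy n r - antiholMode vx vy n r
      = (2 * ((1 + n) / r) : ℝ) * valueMode v n r := by
  have hlv : LocallyIntegrableOn (fun r => ((2 * (n + 1) * r⁻¹ : ℝ) : ℂ) * valueMode v n r) (Ioi 0) :=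
    (h.locInt_value n).2.continuousOn_mul (Complex.continuous_ofReal.comp_continuousOn
      (continuousOn_const.mul (continuousOn_inv₀.mono fun _ hx => ne_of_gt hx)))
      isOpen_Ioi.isLocallyClosed
  have hl := ((h.locInt_hol n).2.sub (h.locInt_antihol n).2).sub hlv
  have := isOpen_Ioi.ae_eq_zero_of_integral_contDiff_smul_eq_zero hl fun χ hχ hc hs => by
    rw [← (h.mode_test n hχ hc hs).2, ← setIntegral_eq_integral_of_forall_compl_eq_zero (s := Ioi 0)]
    · refine integral_congr_ae (Eventually.of_forall fun r => ?_)
      simp [Complex.real_smul]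
    · intro x hx
      rw [image_eq_zero_of_notMem_tsupport fun hx' => hx (hs hx')]; simp
  rw [ae_radialMeasure_iff, ae_restrict_iff' measurableSet_Ioi]
  filter_upwards [this] with r hr hr0
  have := sub_eq_zero.1 (hr hr0)
  simp only [Pi.sub_apply] at this
  rw [this]
  congr 2
  ring

theorem aesm_derivMode (n : ℤ) :
    AEStronglyMeasurable (derivMode vx vy n) (volume.restrict (Ioi 0)) := by
  have h1 := aestronglyMeasurable_radialMeasure_iff.1 (aestronglyMeasurable_angleCoeff h.aesm_hol n)
  have h2 := aestronglyMeasurable_radialMeasure_iff.1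
    (aestronglyMeasurable_angleCoeff h.aesm_antihol (n + 2))
  have h3 := (h1.add h2).mul_const (2⁻¹ : ℂ)
  exact h3

theorem integrableOn_deriv_sq (n : ℤ) :
    IntegrableOn (fun r => ‖derivMode vx vy n r‖ ^ 2 * r) (Ioi 0) := by
  have hi : IntegrableOn (fun r => ‖holMode vx vy n r‖ ^ 2 * r + ‖antiholMode vx vy n r‖ ^ 2 * r)
    (Ioi 0) := (h.integrableOn_hol_sq n).add (h.integrableOn_antihol_sq n)
  refine hi.mono' (((h.aesm_derivMode n).norm.pow 2).mul measurable_id.aestronglyMeasurable) ?_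
  filter_upwards [ae_restrict_mem measurableSet_Ioi] with r hr
  have hr0 : 0 < r := hr
  rw [Real.norm_of_nonneg (by positivity), ← add_mul]
  have := sq_norm_half_add_le (holMode vx vy n r) (antiholMode vx vy n r)
  have h1 := sq_nonneg ‖holMode vx vy n r‖
  have h2 := sq_nonneg ‖antiholMode vx vy n r‖
  gcongr
  rw [derivMode]
  linarith

theorem memH1Loc_mode (n : ℤ) : MemH1Loc (valueMode v n) (derivMode vx vy n) := by
  have hl := locallyIntegrableOn_of_weighted_sq (h.aesm_derivMode n) continuousOn_id
    (fun _ hr => hr) (h.integrableOn_deriv_sq n)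
  exact ⟨⟨(h.locInt_value n).2, hl.2, fun χ hχ hc hs => (h.mode_test n hχ hc hs).1⟩,
    (h.locInt_value n).1, hl.1⟩

end AnisoGL.MemEnergySpace

/-! ### Decomposition of the second variation into Fourier modes -/

/-- The contribution of a single Fourier mode to the angular mean of the density of the second
variation; `A`, `A'` are the modes `±n` of `∂ₓ v - i ∂_y v`, `B` is a mode of `∂ₓ v + i ∂_y v`, and
`φ`, `ψ` are modes of `v`. -/
noncomputable def modeTerm (δ F : ℝ) (A A' B φ ψ : ℂ) : ℝ :=
  (‖A‖ ^ 2 + ‖B‖ ^ 2) / 2 + δ * (2 * ‖(A + conj A') / 2‖ ^ 2 - ‖A‖ ^ 2) - (1 - F ^ 2) * ‖φ‖ ^ 2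
    + 2 * F ^ 2 * ‖(φ + conj ψ) / 2‖ ^ 2

/-- The constraints mean A, B = φ' ± (1+n)φ/r, so (|A|² + |B|²)/2 = |φ'|² + (1+n)²|φ|²/r². Adding
the two δ-terms completes |A + Ā'|² - |A|² - |A'|² = 2 Re(AA'). -/
theorem modeTerm_add_modeTerm (n δ F r : ℝ) {A A' B B' φ ψ : ℂ}
    (hA : A - B = (2 * ((1 + n) / r) : ℝ) * φ) (hA' : A' - B' = (2 * ((1 - n) / r) : ℝ) * ψ) :
    modeTerm δ F A A' B φ ψ + modeTerm δ F A' A B' ψ φ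
      = pairDensity n δ 1 F r φ ((A + B) / 2) ψ ((A' + B') / 2) := by
  obtain rfl : B = A - (2 * ((1 + n) / r) : ℝ) * φ := by rw [← hA]; ring
  obtain rfl : B' = A' - (2 * ((1 - n) / r) : ℝ) * ψ := by rw [← hA']; ring
  simp only [modeTerm, pairDensity, ← div_pow]
  generalize (1 + n) / r = s
  generalize (1 - n) / r = t
  have e1 : (A + (A - ((2 * s : ℝ) : ℂ) * φ)) / 2 = A - s * φ := by push_cast; ring
  have e2 : (A' + (A' - ((2 * t : ℝ) : ℂ) * ψ)) / 2 = A' - t * ψ := by push_cast; ring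
  simp only [e1, e2, norm_div, Complex.norm_ofNat, div_pow]
  simp only [Complex.sq_norm, Complex.normSq_apply, Complex.add_re,
    Complex.add_im, Complex.sub_re, Complex.sub_im, Complex.mul_re, Complex.mul_im,
    Complex.conj_re, Complex.conj_im, Complex.ofReal_re, Complex.ofReal_im]
  ring

theorem abs_modeTerm_le {δ F r C : ℝ} (hδ : |δ| ≤ 1) (hF : F ^ 2 ≤ 1) 
    (hC : 1 - F ^ 2 ≤ C / r ^ 2) (A A' B φ ψ : ℂ) :
    |modeTerm δ F A A' B φ ψ| ≤ 3 * ‖A‖ ^ 2 + ‖A'‖ ^ 2 + ‖B‖ ^ 2 + C / r ^ 2 * ‖φ‖ ^ 2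
      + 2 * ‖(φ + conj ψ) / 2‖ ^ 2 := by
  have h1 := sq_norm_half_add_le A (conj A')
  rw [RCLike.norm_conj] at h1
  obtain ⟨d1, d2⟩ := abs_le.1 hδ
  have a1 := sq_nonneg ‖A‖
  have a2 := sq_nonneg ‖B‖
  have a3 := sq_nonneg ‖A'‖
  have a4 := sq_nonneg ‖φ‖
  have a5 := sq_nonneg ‖(φ + conj ψ) / 2‖
  have a6 := sq_nonneg ‖(A + conj A') / 2‖
  have a7 := sq_nonneg F
  have b1 : (1 - F ^ 2) * ‖φ‖ ^ 2 ≤ C / r ^ 2 * ‖φ‖ ^ 2 := by gcongr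
  have b2 : 0 ≤ (1 - F ^ 2) * ‖φ‖ ^ 2 := mul_nonneg (by linarith) a4
  have b3 : F ^ 2 * ‖(φ + conj ψ) / 2‖ ^ 2 ≤ 1 * ‖(φ + conj ψ) / 2‖ ^ 2 := by gcongr
  have b4 : 0 ≤ F ^ 2 * ‖(φ + conj ψ) / 2‖ ^ 2 := mul_nonneg a7 a5
  have b5 : |δ * (2 * ‖(A + conj A') / 2‖ ^ 2 - ‖A‖ ^ 2)| ≤ 2 * ‖A‖ ^ 2 + ‖A'‖ ^ 2 := by
    rw [abs_mul]
    calc _ ≤ 1 * |2 * ‖(A + conj A') / 2‖ ^ 2 - ‖A‖ ^ 2| := by gcongr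
      _ ≤ _ := by
        rw [one_mul, abs_le]
        constructor <;> linarith
  obtain ⟨b6, b7⟩ := abs_le.1 b5
  rw [modeTerm, abs_le]
  constructor <;> linarith

theorem aestronglyMeasurable_modeTerm {μ : Measure ℝ} {δ : ℝ} {F : ℝ → ℝ} {A A' B φ ψ : ℝ → ℂ}
    (hF : AEStronglyMeasurable F μ) (hA : AEStronglyMeasurable A μ)
    (hA' : AEStronglyMeasurable A' μ) (hB : AEStronglyMeasurable B μ)
    (hφ : AEStronglyMeasurable φ μ) (hψ : AEStronglyMeasurable ψ μ) :
    AEStronglyMeasurable (fun r => modeTerm δ (F r) (A r) (A' r) (B r) (φ r) (ψ r)) μ := by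
  have hc : Continuous fun p : ℝ × ℂ × ℂ × ℂ × ℂ × ℂ =>
      modeTerm δ p.1 p.2.1 p.2.2.1 p.2.2.2.1 p.2.2.2.2.1 p.2.2.2.2.2 := by
    unfold modeTerm
    fun_prop
  have hm := hF.prodMk (hA.prodMk (hA'.prodMk (hB.prodMk (hφ.prodMk hψ))))
  have := hc.comp_aestronglyMeasurable hm
  exact this

theorem angleMean_add {g k : ℝ → ℝ} (hg : Integrable g angleMeasure)
    (hk : Integrable k angleMeasure) :
    angleMean (fun θ => g θ + k θ) = angleMean g + angleMean k := by
  simp only [angleMean]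
  rw [integral_add hg hk, mul_add]

theorem angleMean_const_mul (c : ℝ) (g : ℝ → ℝ) :
    angleMean (fun θ => c * g θ) = c * angleMean g := by
  simp only [angleMean]
  rw [integral_const_mul]
  ring

/-- The density of the second variation in terms of `∂ₓ v ∓ i ∂_y v`. -/
theorem density_eq (δ F d : ℝ) (x y w : ℂ) {r : ℝ} (hr : r ≠ 0) :
    (‖x‖ ^ 2 + ‖y‖ ^ 2) + δ * ((conj x + Complex.I * conj y) ^ 2).re - (1 - F ^ 2) * ‖w‖ ^ 2
        + 2 * F ^ 2 * d ^ 2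
      = (1 / 2 - δ) * ‖x - Complex.I * y‖ ^ 2 + 1 / 2 * ‖x + Complex.I * y‖ ^ 2
        + 2 * δ * (x - Complex.I * y).re ^ 2 + (-((1 - F ^ 2) * r ^ 2)) * (‖w‖ ^ 2 * (r ^ 2)⁻¹)
        + 2 * F ^ 2 * d ^ 2 := by
  have e : (-((1 - F ^ 2) * r ^ 2)) * (‖w‖ ^ 2 * (r ^ 2)⁻¹) = - ((1 - F ^ 2) * ‖w‖ ^ 2) := by
    field_simp
  rw [e]
  simp only [Complex.sq_norm, Complex.normSq_apply, Complex.add_re, Complex.add_im, Complex.sub_re,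
    Complex.sub_im, Complex.mul_re, Complex.mul_im, Complex.I_re, Complex.I_im, sq (conj x + _),
    Complex.conj_re, Complex.conj_im]
  ring

/-- The potential is written as (1 - f²)r², which is bounded, times |v|²/r², which is integrable; so
each summand is integrable by itself. -/
theorem QRad_eq_integral (δ : ℝ) (f : ℝ → ℝ) (v vx vy : ℂ → ℂ) : QRad δ f v vx vy = ∫ z, ((1 / 2 - δ) * ‖vx z - Complex.I * vy z‖ ^ 2
    + 1 / 2 * ‖vx z + Complex.I * vy z‖ ^ 2 + 2 * δ * (vx z - Complex.I * vy z).re ^ 2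
    + (-((1 - f ‖z‖ ^ 2) * ‖z‖ ^ 2)) * (‖v z‖ ^ 2 * (‖z‖ ^ 2)⁻¹)
    + 2 * f ‖z‖ ^ 2 * dot (eiTheta z) (v z) ^ 2) := by
  rw [QRad]
  refine integral_congr_ae ?_
  filter_upwards [Measure.ae_ne volume (0:ℂ)] with z hz
  exact density_eq δ _ _ _ _ _ (norm_ne_zero_iff.2 hz)

theorem HasSum.of_eq {ι α : Type*} [AddCommMonoid α] [TopologicalSpace α] {g g' : ι → α}
    {a b : α} (hg : HasSum g a) (he : ∀ n, g' n = g n) (hab : a = b) : HasSum g' b := by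
  rw [← hab, funext he]
  exact hg

namespace AnisoGL.MemEnergySpace

variable {v vx vy : ℂ → ℂ} (h : MemEnergySpace v vx vy)
include h

theorem integrable_hol_re_sq : Integrable fun z => (vx z - Complex.I * vy z).re ^ 2 := by
  refine h.integrable_hol_sq.mono'
    ((Complex.continuous_re.comp_aestronglyMeasurable h.aesm_hol).pow 2)
    (Eventually.of_forall fun z => ?_)
  rw [Real.norm_of_nonneg (by positivity), ← sq_abs]
  gcongr
  exact Complex.abs_re_le_norm _

theorem integrableOn_dot_mode (n : ℤ) :
    IntegrableOn (fun r => ‖valueMode v n r + conj (valueMode v (-n) r)‖ ^ 2 * r) (Ioi 0) := by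
  have h1 := integrable_radialMeasure_iff.1 (integrable_angleMean h.integrable_dot_sq)
  have m1 := aestronglyMeasurable_radialMeasure_iff.1
    (aestronglyMeasurable_angleCoeff h.aesm (n + 1))
  have m2 := aestronglyMeasurable_radialMeasure_iff.1
    (aestronglyMeasurable_angleCoeff h.aesm (-n + 1))
  refine (h1.const_mul 4).mono' (((m1.add (Complex.continuous_conj.comp_aestronglyMeasurable
    m2)).norm.pow 2).mul measurable_id.aestronglyMeasurable) ?_
  filter_upwards [ae_radialMeasure_iff.1 h.ae_hasSum_dot, ae_restrict_mem measurableSet_Ioi]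
    with r hr hr0
  have hr1 : 0 < r := hr0
  have := le_hasSum hr n fun j _ => by positivity
  rw [norm_div, Complex.norm_ofNat, div_pow] at this
  rw [Real.norm_of_nonneg (by positivity), smul_eq_mul]
  nlinarith

theorem memH1_mode (n : ℤ) : MemH1 (valueMode v n) (derivMode vx vy n)
    (valueMode v (-n)) (derivMode vx vy (-n)) where
  h1_fst := h.memH1Loc_mode n
  h1_snd := h.memH1Loc_mode (-n)
  energy := by
    have hi := (((h.integrableOn_deriv_sq n).add (h.integrableOn_deriv_sq (-n))).add
      ((h.integrableOn_value_sq n).add (h.integrableOn_value_sq (-n)))).add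
      (h.integrableOn_dot_mode n)
    refine hi.congr_fun (fun r hr => ?_) measurableSet_Ioi
    have hr0 : r ≠ 0 := ne_of_gt hr
    simp only [Pi.add_apply]
    field_simp

variable {κ : ℝ} {f : ℝ → ℝ} (hp : VortexProfile κ f) {δ : ℝ}
include hp

theorem integrable_decay : Integrable fun z =>
    (-((1 - f ‖z‖ ^ 2) * ‖z‖ ^ 2)) * (‖v z‖ ^ 2 * (‖z‖ ^ 2)⁻¹) := by
  obtain ⟨C, hC0, hC⟩ := hp.exists_decay
  have hm : Continuous fun z : ℂ => f ‖z‖ :=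
    hp.continuousOn_Ici.comp_continuous continuous_norm fun z => norm_nonneg z
  refine h.integrable_sq_weight.bdd_mul (c := C)
    ((continuous_const.sub (hm.pow 2)).mul (continuous_norm.pow 2)).neg.aestronglyMeasurable
    (Eventually.of_forall fun z => ?_)
  rcases eq_or_ne z 0 with rfl | hz
  · simpa using hC0
  have hz' : 0 < ‖z‖ := norm_pos_iff.2 hz
  have h1 := hC _ hz'
  have h2 := hp.sq_lt_one hz'
  have h3 : (1 - f ‖z‖ ^ 2) * ‖z‖ ^ 2 ≤ C := by
    rwa [le_div_iff₀ (by positivity)] at h1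
  rw [norm_neg, Real.norm_of_nonneg (mul_nonneg (by linarith) (by positivity))]
  exact h3

theorem integrable_sq_mul_dot_sq : Integrable fun z =>
    2 * f ‖z‖ ^ 2 * dot (eiTheta z) (v z) ^ 2 := by
  have hm : Continuous fun z : ℂ => f ‖z‖ :=
    hp.continuousOn_Ici.comp_continuous continuous_norm fun z => norm_nonneg z
  refine h.integrable_dot_sq.bdd_mul (c := 2)
    (continuous_const.mul (hm.pow 2)).aestronglyMeasurable
    (Eventually.of_forall fun z => ?_)
  rw [Real.norm_of_nonneg (by positivity)]
  rcases eq_or_ne z 0 with rfl | hz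
  · simp [hp.map_zero]
  · linarith [hp.sq_lt_one (norm_pos_iff.2 hz)]

variable (δ)

/-- The second variation is the integral of the angular means of its ingredients. -/
theorem QRad_eq_integral_radialMeasure : (2 * Real.pi)⁻¹ * QRad δ f v vx vy = ∫ r,
    ((1 / 2 - δ) * (angleMean fun θ =>
        ‖vx (polarMap (r, θ)) - Complex.I * vy (polarMap (r, θ))‖ ^ 2)
      + 1 / 2 * (angleMean fun θ =>
        ‖vx (polarMap (r, θ)) + Complex.I * vy (polarMap (r, θ))‖ ^ 2)
      + 2 * δ * (angleMean fun θ =>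
        (vx (polarMap (r, θ)) - Complex.I * vy (polarMap (r, θ))).re ^ 2)
      + (-((1 - f r ^ 2) * r ^ 2)) * (angleMean fun θ =>
        ‖v (polarMap (r, θ))‖ ^ 2 * (‖polarMap (r, θ)‖ ^ 2)⁻¹)
      + 2 * f r ^ 2 * (angleMean fun θ =>
        dot (eiTheta (polarMap (r, θ))) (v (polarMap (r, θ))) ^ 2)) ∂radialMeasure := by
  have i1 := h.integrable_hol_sq.const_mul (1 / 2 - δ)
  have i2 := h.integrable_antihol_sq.const_mul (1 / 2)
  have i3 := h.integrable_hol_re_sq.const_mul (2 * δ)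
  have i4 := h.integrable_decay hp
  have i5 := h.integrable_sq_mul_dot_sq hp
  rw [QRad_eq_integral]
  refine (integral_angleMean ((((i1.add i2).add i3).add i4).add i5)).symm.trans ?_
  refine integral_congr_ae ?_
  filter_upwards [(integrable_comp_polarMap i1).prod_right_ae,
    (integrable_comp_polarMap i2).prod_right_ae, (integrable_comp_polarMap i3).prod_right_ae,
    (integrable_comp_polarMap i4).prod_right_ae, (integrable_comp_polarMap i5).prod_right_ae,
    ae_radialMeasure_pos] with r j1 j2 j3 j4 j5 hr
  simp only [Pi.add_apply]
  refine ((angleMean_add (((j1.add j2).add j3).add j4) j5).trans (congrArg₂ (· + ·)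
    ((angleMean_add ((j1.add j2).add j3) j4).trans (congrArg₂ (· + ·)
    ((angleMean_add (j1.add j2) j3).trans (congrArg₂ (· + ·) (angleMean_add j1 j2) rfl))
    rfl)) rfl)).trans ?_
  rw [angleMean_const_mul, angleMean_const_mul, angleMean_const_mul]
  congr 1
  · congr 1
    rw [← angleMean_const_mul]
    simp only [norm_polarMap hr]
  · rw [← angleMean_const_mul]
    simp only [norm_polarMap hr]

/-- Dominated convergence: the majorants from `abs_modeTerm_le` sum, by Parseval, to angular means
that are integrable for r dr. -/
theorem hasSum_integral_modeTerm (hδ : |δ| ≤ 1) : HasSum (fun n : ℤ =>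
      ∫ r, modeTerm δ (f r) (holMode vx vy n r) (holMode vx vy (-n) r) (antiholMode vx vy n r)
        (valueMode v n r) (valueMode v (-n) r) ∂radialMeasure)
    ((2 * Real.pi)⁻¹ * QRad δ f v vx vy) := by
  obtain ⟨C, hC0, hC⟩ := hp.exists_decay
  rw [h.QRad_eq_integral_radialMeasure hp δ]
  have key : ∀ᵐ r ∂radialMeasure, HasSum (fun n : ℤ => 3 * ‖holMode vx vy n r‖ ^ 2
      + ‖holMode vx vy (-n) r‖ ^ 2 + ‖antiholMode vx vy n r‖ ^ 2
      + C / r ^ 2 * ‖valueMode v n r‖ ^ 2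
      + 2 * ‖(valueMode v n r + conj (valueMode v (-n) r)) / 2‖ ^ 2)
      (4 * (angleMean fun θ => ‖vx (polarMap (r, θ)) - Complex.I * vy (polarMap (r, θ))‖ ^ 2)
      + (angleMean fun θ => ‖vx (polarMap (r, θ)) + Complex.I * vy (polarMap (r, θ))‖ ^ 2)
      + C * (angleMean fun θ => ‖v (polarMap (r, θ))‖ ^ 2 * (‖polarMap (r, θ)‖ ^ 2)⁻¹)
      + 2 * (angleMean fun θ =>
        dot (eiTheta (polarMap (r, θ))) (v (polarMap (r, θ))) ^ 2)) := by
    filter_upwards [h.ae_hasSum_hol, h.ae_hasSum_antihol, h.ae_hasSum_value, h.ae_hasSum_dot,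
      ae_radialMeasure_pos] with r h1 h2 h3 h4 hr
    have h1' := (Equiv.neg ℤ).hasSum_iff.2 h1
    have := ((((h1.mul_left 3).add h1').add h2).add (h3.mul_left (C / r ^ 2))).add
      (h4.mul_left 2)
    have e : ∀ x : ℝ, C / r ^ 2 * (r ^ 2 * x) = C * x := fun x => by field_simp
    rw [e] at this
    refine this.of_eq (fun n => rfl) ?_
    ring
  refine hasSum_integral_of_dominated_convergence _ (fun n => ?_) (fun n => ?_)
    (key.mono fun r hr => hr.summable) ?_ ?_
  · have hf : AEStronglyMeasurable f radialMeasure := aestronglyMeasurable_radialMeasure_iff.2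
      ((hp.continuousOn_Ici.mono Ioi_subset_Ici_self).aestronglyMeasurable measurableSet_Ioi)
    exact aestronglyMeasurable_modeTerm hf (aestronglyMeasurable_angleCoeff h.aesm_hol n)
      (aestronglyMeasurable_angleCoeff h.aesm_hol (-n))
      (aestronglyMeasurable_angleCoeff h.aesm_antihol (n + 2))
      (aestronglyMeasurable_angleCoeff h.aesm (n + 1))
      (aestronglyMeasurable_angleCoeff h.aesm (-n + 1))
  · filter_upwards [ae_radialMeasure_pos] with r hr
    exact abs_modeTerm_le hδ (hp.sq_lt_one hr).le (hC r hr) _ _ _ _ _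
  · have hi := ((((integrable_angleMean h.integrable_hol_sq).const_mul 4).add
      (integrable_angleMean h.integrable_antihol_sq)).add
      ((integrable_angleMean h.integrable_sq_weight).const_mul C)).add
      ((integrable_angleMean h.integrable_dot_sq).const_mul 2)
    refine hi.congr ?_
    filter_upwards [key] with r hr
    rw [hr.tsum_eq]
    rfl
  · filter_upwards [h.ae_hasSum_hol, h.ae_hasSum_antihol, h.ae_hasSum_hol_re, h.ae_hasSum_value,
      h.ae_hasSum_dot, ae_radialMeasure_pos] with r h1 h2 h3 h4 h5 hr
    have := ((((h1.mul_left (1 / 2 - δ)).add (h2.mul_left (1 / 2))).add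
      (h3.mul_left (2 * δ))).add (h4.mul_left (-(1 - f r ^ 2)))).add (h5.mul_left (2 * f r ^ 2))
    refine this.of_eq (fun n => ?_) ?_
    · simp only [modeTerm]
      ring
    · ring

end AnisoGL.MemEnergySpace

/-! ### Nonnegativity of the second variation and its kernel -/

theorem pairForm_mode_neg (δ : ℝ) (f : ℝ → ℝ) (v vx vy : ℂ → ℂ) (n : ℤ) :
    (∫ r in Ioi 0, pairDensity (-n : ℤ) δ 1 (f r) r (valueMode v (-n) r) (derivMode vx vy (-n) r)
        (valueMode v (- -n) r) (derivMode vx vy (- -n) r) * r)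
      = ∫ r in Ioi 0, pairDensity n δ 1 (f r) r (valueMode v n r) (derivMode vx vy n r)
        (valueMode v (-n) r) (derivMode vx vy (-n) r) * r := by
  simp only [Int.cast_neg, pairDensity_neg, neg_neg]

namespace AnisoGL.MemEnergySpace

variable {v vx vy : ℂ → ℂ} (h : MemEnergySpace v vx vy)
include h

variable {κ : ℝ} {f : ℝ → ℝ} (hp : VortexProfile κ f) {δ : ℝ}
include hp

theorem integrable_modeTerm (hδ : |δ| ≤ 1) (n : ℤ) : Integrable (fun r =>
    modeTerm δ (f r) (holMode vx vy n r) (holMode vx vy (-n) r) (antiholMode vx vy n r)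
      (valueMode v n r) (valueMode v (-n) r)) radialMeasure := by
  obtain ⟨C, hC0, hC⟩ := hp.exists_decay
  have hf : AEStronglyMeasurable f radialMeasure := aestronglyMeasurable_radialMeasure_iff.2
    ((hp.continuousOn_Ici.mono Ioi_subset_Ici_self).aestronglyMeasurable measurableSet_Ioi)
  have hm := aestronglyMeasurable_modeTerm (δ := δ) hf
    (aestronglyMeasurable_angleCoeff h.aesm_hol n)
    (aestronglyMeasurable_angleCoeff h.aesm_hol (-n))
    (aestronglyMeasurable_angleCoeff h.aesm_antihol (n + 2))
    (aestronglyMeasurable_angleCoeff h.aesm (n + 1))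
    (aestronglyMeasurable_angleCoeff h.aesm (-n + 1))
  have hi : IntegrableOn (fun r : ℝ => r • (3 * ‖holMode vx vy n r‖ ^ 2
      + ‖holMode vx vy (-n) r‖ ^ 2 + ‖antiholMode vx vy n r‖ ^ 2
      + C / r ^ 2 * ‖valueMode v n r‖ ^ 2
      + 2 * ‖(valueMode v n r + conj (valueMode v (-n) r)) / 2‖ ^ 2)) (Ioi 0) := by
    have := (((((h.integrableOn_hol_sq n).const_mul 3).add (h.integrableOn_hol_sq (-n))).add
      (h.integrableOn_antihol_sq n)).add ((h.integrableOn_value_sq n).const_mul C)).add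
      ((h.integrableOn_dot_mode n).const_mul (1 / 2))
    refine IntegrableOn.congr_fun this (fun r hr => ?_) measurableSet_Ioi
    have hr0 : r ≠ 0 := ne_of_gt hr
    simp only [Pi.add_apply, norm_div, Complex.norm_ofNat, smul_eq_mul]
    field_simp
  refine (integrable_radialMeasure_iff.2 hi).mono' hm ?_
  filter_upwards [ae_radialMeasure_pos] with r hr
  exact abs_modeTerm_le hδ (hp.sq_lt_one hr).le (hC r hr) _ _ _ _ _

/-- A single mode term is not symmetric in n and -n. Adding the series reindexed by n ↦ -n turns
each term into a pair density, and this doubling replaces 1/(2π) by 1/π. -/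
theorem hasSum_pairForm (hδ : |δ| ≤ 1) : HasSum (fun n : ℤ =>
      ∫ r in Ioi 0, pairDensity n δ 1 (f r) r (valueMode v n r) (derivMode vx vy n r)
        (valueMode v (-n) r) (derivMode vx vy (-n) r) * r)
    (Real.pi⁻¹ * QRad δ f v vx vy) := by
  have h1 := h.hasSum_integral_modeTerm hp δ hδ
  have h2 := (Equiv.neg ℤ).hasSum_iff.2 h1
  refine (h1.add h2).of_eq (fun n => ?_) ?_
  · have i2 := h.integrable_modeTerm hp hδ (-n)
    simp only [Function.comp, Equiv.neg_apply, neg_neg] at i2 ⊢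
    rw [← integral_add (h.integrable_modeTerm hp hδ n) i2]
    trans ∫ r, pairDensity n δ 1 (f r) r (valueMode v n r) (derivMode vx vy n r)
        (valueMode v (-n) r) (derivMode vx vy (-n) r) ∂radialMeasure
    · rw [integral_radialMeasure]
      simp only [smul_eq_mul, mul_comm]
    · refine integral_congr_ae ?_
      filter_upwards [h.ae_hol_sub_antihol n, h.ae_hol_sub_antihol (-n)] with r e1 e2
      rw [Int.cast_neg, ← sub_eq_add_neg] at e2
      exact (modeTerm_add_modeTerm n δ (f r) r e1 e2).symm
  · field_simp
    ring

/-- Every pair of modes contributes a nonnegative quantity, and only the translational modes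
contribute nothing. -/
theorem pairForm_mode_nonneg (hδ : δ ∈ Ioc (-1 : ℝ) 0) (hκ : (1 + δ) * κ = 1) {n : ℤ} (hn : 0 ≤ n) :
    0 ≤ (∫ r in Ioi 0, pairDensity n δ 1 (f r) r (valueMode v n r) (derivMode vx vy n r)
        (valueMode v (-n) r) (derivMode vx vy (-n) r) * r) ∧
    ((∫ r in Ioi 0, pairDensity n δ 1 (f r) r (valueMode v n r) (derivMode vx vy n r)
        (valueMode v (-n) r) (derivMode vx vy (-n) r) * r) ≤ 0 →
      (n ≠ 1 → ∀ᵐ r ∂radialMeasure, valueMode v n r = 0 ∧ valueMode v (-n) r = 0) ∧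
      (n = 1 → ∃ γ : ℂ, ∀ᵐ r ∂radialMeasure,
        valueMode v 1 r = γ * ((deriv f r - f r / r : ℝ) : ℂ) ∧
        valueMode v (-1) r = conj γ * ((deriv f r + f r / r : ℝ) : ℂ))) := by
  simp only [ae_radialMeasure_iff]
  rcases hn.eq_or_lt with rfl | hn
  · have key := hp.modeForm_nonneg_of_memH0 hδ (h.memH1_mode 0).memH0
    simp only [Int.cast_zero, neg_zero, pairDensity_zero_self, mul_assoc, integral_const_mul]
    rw [hκ] at key
    refine ⟨by linarith [key.1], fun hle => ⟨fun _ => ?_, fun h0 => by omega⟩⟩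
    filter_upwards [key.2 (by linarith)] with r hr using ⟨hr, hr⟩
  · have hn1 : (1 : ℝ) ≤ n := by exact_mod_cast hn
    have key := hp.pairForm_nonneg_of_memH1 hn1 hδ (h.memH1_mode n)
    rw [hκ] at key
    refine ⟨key.1, fun hle => ⟨fun hne => (key.2 hle).1 ?_, ?_⟩⟩
    · have : 1 < n := by omega
      exact_mod_cast this
    · rintro rfl
      exact (key.2 hle).2

theorem pairForm_mode_nonneg_int (hδ : δ ∈ Ioc (-1 : ℝ) 0) (hκ : (1 + δ) * κ = 1) (n : ℤ) :
    0 ≤ ∫ r in Ioi 0, pairDensity n δ 1 (f r) r (valueMode v n r) (derivMode vx vy n r)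
        (valueMode v (-n) r) (derivMode vx vy (-n) r) * r := by
  rcases le_total 0 n with hn | hn
  · exact (h.pairForm_mode_nonneg hp hδ hκ hn).1
  · rw [← pairForm_mode_neg]
    exact (h.pairForm_mode_nonneg hp hδ hκ (neg_nonneg.2 hn)).1

theorem QRad_nonneg (hδ : δ ∈ Ioc (-1 : ℝ) 0) (hκ : (1 + δ) * κ = 1) : 0 ≤ QRad δ f v vx vy := by
  have h1 := h.hasSum_pairForm hp (abs_le.2 ⟨hδ.1.le, hδ.2.trans zero_le_one⟩)
  have h2 := h1.nonneg (h.pairForm_mode_nonneg_int hp hδ hκ)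
  exact nonneg_of_mul_nonneg_right h2 (inv_pos.2 Real.pi_pos)

/-- A series of nonnegative terms with sum zero has only zero terms, and the equality cases of the
pair forms then determine every mode. -/
theorem exists_valueMode_eq (hδ : δ ∈ Ioc (-1 : ℝ) 0) (hκ : (1 + δ) * κ = 1)
    (hQ : QRad δ f v vx vy ≤ 0) : ∃ γ : ℂ, ∀ᵐ r ∂radialMeasure, ∀ n : ℤ, valueMode v n r =
      (γ * ((deriv f r - f r / r : ℝ) : ℂ)) * (if n = 1 then 1 else 0)
      + (conj γ * ((deriv f r + f r / r : ℝ) : ℂ)) * (if n = -1 then 1 else 0) := by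
  have h1 := h.hasSum_pairForm hp (abs_le.2 ⟨hδ.1.le, hδ.2.trans zero_le_one⟩)
  have hQ0 : QRad δ f v vx vy = 0 := le_antisymm hQ (h.QRad_nonneg hp hδ hκ)
  rw [hQ0, mul_zero, hasSum_zero_iff_of_nonneg (h.pairForm_mode_nonneg_int hp hδ hκ)] at h1
  have h2 := fun {n : ℤ} (hn : 0 ≤ n) =>
    (h.pairForm_mode_nonneg hp hδ hκ hn).2 (congrFun h1 n).le
  obtain ⟨γ, hγ⟩ := (h2 zero_le_one).2 rfl
  refine ⟨γ, ae_all_iff.2 fun n => ?_⟩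
  by_cases hn : n = 1
  · subst hn
    filter_upwards [hγ] with r hr
    simpa using hr.1
  by_cases hn' : n = -1
  · subst hn'
    filter_upwards [hγ] with r hr
    simpa using hr.2
  simp only [hn, hn', if_false, mul_zero, add_zero]
  rcases le_total 0 n with h0 | h0
  · filter_upwards [(h2 h0).1 hn] with r hr using hr.1
  · filter_upwards [(h2 (neg_nonneg.2 h0)).1 (by omega)] with r hr
    rw [← neg_neg n]
    exact hr.2

/-- An element of the energy space at which the second variation is not positive is a combination
of `e^{2iθ}` and a radial function. -/
theorem exists_ae_eq (hδ : δ ∈ Ioc (-1 : ℝ) 0) (hκ : (1 + δ) * κ = 1)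
    (hQ : QRad δ f v vx vy ≤ 0) : ∃ γ : ℂ, ∀ᵐ z, v z =
      γ * ((deriv f ‖z‖ - f ‖z‖ / ‖z‖ : ℝ) : ℂ) * eiTheta z ^ 2
      + conj γ * ((deriv f ‖z‖ + f ‖z‖ / ‖z‖ : ℝ) : ℂ) := by
  obtain ⟨γ, hγ⟩ := h.exists_valueMode_eq hp hδ hκ hQ
  refine ⟨γ, ?_⟩
  have hfm : Measurable fun z : ℂ => f ‖z‖ :=
    (hp.continuousOn_Ici.comp_continuous continuous_norm fun z => norm_nonneg z).measurable
  have hdm : Measurable fun z : ℂ => deriv f ‖z‖ := (measurable_deriv f).comp measurable_norm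
  have hWm : Measurable fun z : ℂ => γ * ((deriv f ‖z‖ - f ‖z‖ / ‖z‖ : ℝ) : ℂ) * eiTheta z ^ 2
      + conj γ * ((deriv f ‖z‖ + f ‖z‖ / ‖z‖ : ℝ) : ℂ) :=
    ((measurable_const.mul (Complex.measurable_ofReal.comp
      (hdm.sub (hfm.div measurable_norm)))).mul (measurable_eiTheta.pow_const 2)).add
      (measurable_const.mul (Complex.measurable_ofReal.comp (hdm.add (hfm.div measurable_norm))))
  have hslice : ∀ r : ℝ, 0 < r → ∀ θ : ℝ,
      γ * ((deriv f ‖polarMap (r, θ)‖ - f ‖polarMap (r, θ)‖ / ‖polarMap (r, θ)‖ : ℝ) : ℂ)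
        * eiTheta (polarMap (r, θ)) ^ 2
      + conj γ * ((deriv f ‖polarMap (r, θ)‖ + f ‖polarMap (r, θ)‖ / ‖polarMap (r, θ)‖ : ℝ) : ℂ)
      = (γ * ((deriv f r - f r / r : ℝ) : ℂ)) * Complex.exp ((2 : ℤ) * θ * Complex.I)
        + (conj γ * ((deriv f r + f r / r : ℝ) : ℂ)) * Complex.exp ((0 : ℤ) * θ * Complex.I) := by
    intro r hr θ
    rw [norm_polarMap hr, eiTheta_polarMap hr, ← Complex.exp_nat_mul]
    simp [mul_assoc]
  have hexp : ∀ (c : ℂ) (m : ℤ), MemLp (fun θ : ℝ => c * Complex.exp (m * θ * Complex.I)) 2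
      angleMeasure := fun c m => by
    refine MemLp.of_bound (Continuous.aestronglyMeasurable (by fun_prop)) ‖c‖
      (Eventually.of_forall fun θ => ?_)
    rw [norm_mul, ← neg_neg ((m : ℂ) * θ * Complex.I)]
    have := norm_exp_neg_int_mul (-m) θ
    rw [show -(((-m : ℤ) : ℂ) * θ * Complex.I) = - -((m : ℂ) * θ * Complex.I) by
      push_cast; ring] at this
    rw [this, mul_one]
  have h0 := ae_eq_zero_of_angleCoeff_eq_zero (h.aesm.sub hWm.aestronglyMeasurable) ?_ ?_
  · filter_upwards [h0] with z hz using sub_eq_zero.1 hz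
  · filter_upwards [h.ae_memLp, ae_radialMeasure_pos] with r hr hr0
    simp only [Pi.sub_apply, hslice r hr0]
    exact hr.sub ((hexp _ _).add (hexp _ _))
  · filter_upwards [h.ae_memLp, ae_radialMeasure_pos, hγ] with r hr hr0 hc k
    simp only [Pi.sub_apply, hslice r hr0]
    have i1 := (hexp (γ * ((deriv f r - f r / r : ℝ) : ℂ)) 2).integrable one_le_two
    have i2 := (hexp (conj γ * ((deriv f r + f r / r : ℝ) : ℂ)) 0).integrable one_le_two
    refine (angleCoeff_sub (hr.integrable one_le_two) (i1.add i2) k).trans ?_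
    refine (congrArg (_ - ·) (angleCoeff_add i1 i2 k)).trans ?_
    rw [angleCoeff_const_mul, angleCoeff_const_mul, angleCoeff_exp, angleCoeff_exp]
    -- Index shift: `valueMode` of order n is the coefficient of e^{i(n+1)θ}, so the orders 1 and -1
    -- are the frequencies 2 and 0.
    have := hc (k - 1)
    rw [valueMode, sub_add_cancel] at this
    rw [this]
    have e1 : (k - 1 = 1) = (k = 2) := propext (by omega)
    have e2 : (k - 1 = -1) = (k = 0) := propext (by omega)
    simp only [e1, e2, sub_self]

end AnisoGL.MemEnergySpace

/-! ### Identification of the kernel with the translational modes -/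

namespace VortexProfile

variable {κ : ℝ} {f : ℝ → ℝ} (h : VortexProfile κ f)
include h

/-- The derivative of `f(r) e^{iθ}` in the direction `e`. -/
theorem fderiv_uRad {z : ℂ} (hz : z ≠ 0) (e : ℂ) :
    fderiv ℝ (uRad f) z e = ((deriv f ‖z‖ - f ‖z‖ / ‖z‖ : ℝ) : ℂ) / 2 * eiTheta z ^ 2 * conj e
      + ((deriv f ‖z‖ + f ‖z‖ / ‖z‖ : ℝ) : ℂ) / 2 * e := by
  have hz0 : 0 < ‖z‖ := norm_pos_iff.2 hz
  have hzc : (‖z‖ : ℂ) ≠ 0 := by exact_mod_cast hz0.ne'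
  have hd : DifferentiableAt ℝ (uRad f) z := by
    have hn : DifferentiableAt ℝ (fun z : ℂ => ‖z‖) z :=
      (contDiffAt_norm ℝ hz (n := 1)).differentiableAt (by norm_num)
    have hf : DifferentiableAt ℝ (fun z : ℂ => f ‖z‖) z :=
      DifferentiableAt.comp (g := f) z (h.hasDerivAt hz0).differentiableAt hn
    have o1 : DifferentiableAt ℝ (fun z : ℂ => (f ‖z‖ : ℂ)) z :=
      Complex.ofRealCLM.differentiableAt.comp z hf
    have o2 : DifferentiableAt ℝ (fun z : ℂ => ((‖z‖ : ℝ) : ℂ)) z :=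
      Complex.ofRealCLM.differentiableAt.comp z hn
    exact o1.mul (differentiableAt_id.mul (DifferentiableAt.inv o2 hzc))
  have hl : HasDerivAt (fun t : ℝ => z + t * e) e 0 := by
    simpa using ((Complex.ofRealCLM.hasDerivAt (x := (0:ℝ))).mul_const e).const_add z
  have hzl : z + ((0:ℝ) : ℂ) * e = z := by simp
  have k1 : HasDerivAt (fun t : ℝ => uRad f (z + t * e)) (fderiv ℝ (uRad f) z e) 0 := by
    refine HasFDerivAt.comp_hasDerivAt (f := fun t : ℝ => z + t * e) (l := uRad f) (0:ℝ) ?_ hl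
    rw [hzl]; exact hd.hasFDerivAt
  have hn : ‖z + ((0:ℝ) : ℂ) * e‖ ^ 2 ≠ 0 := by rw [hzl]; simpa using hz
  have k2 : HasDerivAt (fun t : ℝ => ‖z + t * e‖) ((conj z * e).re / ‖z‖) 0 := by
    have q := (hl.norm_sq).sqrt hn
    simp only [Real.sqrt_sq (norm_nonneg _)] at q
    refine q.congr_deriv ?_
    rw [hzl, Complex.inner]
    field_simp
  have k3 : HasDerivAt (fun t : ℝ => f ‖z + t * e‖)
      (deriv f ‖z‖ * ((conj z * e).re / ‖z‖)) 0 := by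
    refine HasDerivAt.comp (h₂ := f) (h := fun t : ℝ => ‖z + t * e‖) (0:ℝ) ?_ k2
    rw [hzl]
    exact h.hasDerivAt hz0
  have k4 := k3.ofReal_comp.mul (hl.div k2.ofReal_comp (by rw [hzl]; exact hzc))
  have k6 := k1.unique k4
  rw [k6]
  simp only [Pi.div_apply, hzl]
  -- Averaging z̄e and zē separates the parts linear in e and in ē, which carry Ψ and Φ.
  have er : ((conj z * e).re : ℂ) = (conj z * e + z * conj e) / 2 := by
    have := Complex.add_conj (conj z * e)
    rw [map_mul, Complex.conj_conj] at this
    rw [this]; push_cast; ring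
  have ez : z * conj z = (‖z‖ : ℂ) ^ 2 := Complex.mul_conj' z
  simp only [eiTheta]
  push_cast
  rw [er]
  field_simp
  linear_combination (deriv f ‖z‖ * ‖z‖ * e - f ‖z‖ * e : ℂ) * ez

theorem memTranslationModes_of_ae_eq {v : ℂ → ℂ} {γ : ℂ} (hv : ∀ᵐ z, v z =
      γ * ((deriv f ‖z‖ - f ‖z‖ / ‖z‖ : ℝ) : ℂ) * eiTheta z ^ 2
      + conj γ * ((deriv f ‖z‖ + f ‖z‖ / ‖z‖ : ℝ) : ℂ)) : MemTranslationModes f v := by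
  -- In a∂ₓu + b∂_y u the coefficient of Φe^{2iθ} is (a - ib)/2, which has to equal γ.
  refine ⟨2 * γ.re, -2 * γ.im, ?_⟩
  filter_upwards [hv, Measure.ae_ne volume (0:ℂ)] with z hz hz0
  rw [hz, h.fderiv_uRad hz0, h.fderiv_uRad hz0]
  have e1 : γ = γ.re + γ.im * Complex.I := (Complex.re_add_im γ).symm
  have e2 : conj γ = γ.re - γ.im * Complex.I := by
    apply Complex.ext <;> simp
  rw [e2]
  nth_rewrite 1 [e1]
  simp only [map_one, Complex.conj_I]
  push_cast
  ring

end VortexProfile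

/-! ### Stability of the radial solution and the threshold -/

namespace AnisoGL.IsRadialProfile

variable {δ : ℝ} {f : ℝ → ℝ} (h : IsRadialProfile δ f) (hδ : δ ∈ Ioc (-1 : ℝ) 0)
include h hδ

theorem not_linearlyUnstable : ¬ LinearlyUnstable δ f := by
  rintro ⟨v, vx, vy, hv, hQ⟩
  have h1 : 1 + δ ≠ 0 := by linarith [hδ.1]
  exact hQ.not_ge (hv.QRad_nonneg (h.vortexProfile hδ.1) hδ (mul_one_div_cancel h1))

theorem nondegenerateStable : NondegenerateStable δ f := by
  intro v vx vy hv hne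
  have h1 : 1 + δ ≠ 0 := by linarith [hδ.1]
  by_contra! hQ
  obtain ⟨γ, hγ⟩ := hv.exists_ae_eq (h.vortexProfile hδ.1) hδ (mul_one_div_cancel h1) hQ
  exact hne ((h.vortexProfile hδ.1).memTranslationModes_of_ae_eq hγ)

end AnisoGL.IsRadialProfile

theorem neg_one_lt_neg_one_div_sqrt_five : (-1 : ℝ) < -1 / Real.sqrt 5 := by
  have h1 : 1 < Real.sqrt 5 := by
    rw [Real.lt_sqrt zero_le_one]; norm_num
  rw [lt_div_iff₀ (by linarith)]
  linarith

/-- If no profile with `δ ∈ (-1,0)` is unstable, the stability threshold is `-1`. -/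
theorem AnisoGL.stabilityThreshold_le {f : ℝ → ℝ → ℝ}
    (hf : ∀ δ ∈ Ioo (-1 : ℝ) 0, ¬ LinearlyUnstable δ (f δ)) : stabilityThreshold f ≤ -1 := by
  refine csSup_le ⟨-1, Or.inl rfl⟩ ?_
  rintro x (rfl | ⟨hx, hu⟩)
  · exact le_rfl
  · exact absurd hu (hf x hx)

end

theorem mainTheorem2 (f : ℝ → ℝ → ℝ)
    (hf : ∀ δ ∈ Ioo (-1 : ℝ) 1, IsRadialProfile δ (f δ)) :
    -- higher modes
    (∀ n : ℕ, 2 ≤ n → ∀ δ ∈ Icc (-1 / Real.sqrt 5) 0, ∀ φ dφ ψ dψ : ℝ → ℂ,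
      MemH1 φ dφ ψ dψ →
      ¬ (∀ᵐ r ∂(volume.restrict (Ioi (0 : ℝ))), φ r = 0 ∧ ψ r = 0) →
      0 < Qn n δ (f 0) φ dφ ψ dψ) ∧
    -- mode zero
    (∀ δ ∈ Ioc (-1 : ℝ) 0, ∀ φ dφ : ℝ → ℂ, MemH0 φ dφ →
      ¬ (∀ᵐ r ∂(volume.restrict (Ioi (0 : ℝ))), φ r = 0) →
      0 < Q0 δ (f 0) φ dφ) ∧
    -- mode one
    (∀ δ ∈ Ioc (-1 : ℝ) 0, ∀ φ dφ ψ dψ : ℝ → ℂ, MemH1 φ dφ ψ dψ →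
      0 ≤ Qn 1 δ (f 0) φ dφ ψ dψ ∧
      (Qn 1 δ (f 0) φ dφ ψ dψ = 0 → MemTranslationPairs (f 0) φ ψ)) ∧
    -- stability of the radial solution, and the resulting bound on the threshold
    (∀ δ ∈ Icc (-1 / Real.sqrt 5) 0, NondegenerateStable δ (f δ)) ∧
    stabilityThreshold f ≤ -1 / Real.sqrt 5 := by
  have hlt := neg_one_lt_neg_one_div_sqrt_five
  have h0 : IsRadialProfile 0 (f 0) := hf 0 (by norm_num)
  have hstab : ∀ δ ∈ Ioc (-1 : ℝ) 0, IsRadialProfile δ (f δ) := fun δ hδ =>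
    hf δ ⟨hδ.1, hδ.2.trans_lt zero_lt_one⟩
  have hmem : ∀ δ ∈ Icc (-1 / Real.sqrt 5) 0, δ ∈ Ioc (-1 : ℝ) 0 := fun δ hδ =>
    ⟨hlt.trans_le hδ.1, hδ.2⟩
  refine ⟨fun n hn δ hδ φ dφ ψ dψ hm hne => h0.Qn_pos hn (hmem δ hδ) hm hne,
    fun δ hδ φ dφ hm hne => h0.Q0_pos hδ hm hne,
    fun δ hδ φ dφ ψ dψ hm => h0.Q1_nonneg hδ hm,
    fun δ hδ => (hstab δ (hmem δ hδ)).nondegenerateStable (hmem δ hδ), ?_⟩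
  exact (stabilityThreshold_le fun δ hδ =>
    (hstab δ ⟨hδ.1, hδ.2.le⟩).not_linearlyUnstable ⟨hδ.1, hδ.2.le⟩).trans hlt.le
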